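/- Let $\mathbb H,\mathbb U$ be (real or complex) Hilbert spaces, let $(S(t))_{t\in\mathbb R}$ be a strongly continuous group on $\mathbb H$ with infinitesimal generator $(A,\mathcal D(A))$, and let $B\in\mathcal L(\mathbb U,\mathcal D(A^*)')$ (equivalently $B^*\in\mathcal L(\mathcal D(A^*),\mathbb U)$, where $\mathcal D(A^*)$ carries the graph norm) be an admissible control operator: for all $T>0$ and $u\in L^2((0,T);\mathbb U)$ the function $t\mapsto\int_0^tS(t-s)Bu(s)\,ds$ (integral in $\mathcal D(A^*)'$) belongs to $C([0,T];\mathbb H)$. Weak solutions of $y'=Ay+h+Bu$ on $[0,T]$ are functions $y\in C([0,T];\mathbb H)$ such that $\frac{d}{dt}\langle y,\varphi\rangle=\langle y,A^*\varphi\rangle+\langle h,\varphi\rangle+\langle u,B^*\varphi\rangle$ in the sense of distributions on $(0,T)$ for all $\varphi\in\mathcal D(A^*)$. Assume that $y'=Ay+Bu$ is exactly controllable in some time $T>0$, i.e. for all $y_0,y_T\in\mathbb H$ there is $u\in L^2((0,T);\mathbb U)$ such that the weak solution with $y(0)=y_0$ satisfies $y(T)=y_T$. Let $f:\mathbb H\to\mathbb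 H$ be continuous and such that * for every $\varepsilon>0$ there is $\delta>0$ with $\|f(x)\|\le\varepsilon\|x\|$ whenever $\|x\|<\delta$; * there are $r,\Lambda>0$ with $\|f(x)-f(y)\|\le\Lambda\|x-y\|$ whenever $\|x\|,\|y\|<r$. Then $y'=Ay+f(y)+Bu$ is locally rapidly dynamically stabilizable: for every rate $\mu>0$ there are a Hilbert space $\mathbb X$ over the same field, the generator $\widetilde A$ of a strongly continuous group on $\mathbb X$, an admissible observation operator $K\in\mathcal L(\mathcal D(\widetilde A),\mathbb U)$ for this group (for every $T>0$ there is $C_T$ with $\int_0^T\|Ke^{t\widetilde A}x\|^2dt\le C_T\|x\|^2$ for all $x\in\mathcal D(\widetilde A)$), and a continuous map $g:\mathbb H\times\mathbb X\to\mathbb X$ that is Lipschitz in a neighbourhood of $0$, such that the extended system $$y'=Ay+f(y)+BKz,\qquad z'=\widetilde Az+g(y,z)$$ is locally well-posed and locally exponentially stable with rate $\mu$, in the following sense. There are $\varepsilon,C>0$ such that, for all $y_0\in\mathbb H$, $z_0\in\mathbb X$ with $\|y_0\|+\|z_0\|\le\varepsilon$, there is a global weak solution $(y,z)\in C([0,\infty);\mathbb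 H\times\mathbb X)$ with $(y,z)(0)=(y_0,z_0)$ and $$\|y(t)\|+\|z(t)\|\le Ce^{-\mu t}\big(\|y_0\|+\|z_0\|\big)\quad\text{for all }t\ge0;$$ moreover, for every $T>0$ there is $L_T$ such that any two weak solutions $(y,z),(\hat y,\hat z)$ on $[0,T]$ with initial data of size $\|y(0)\|+\|z(0)\|\le\varepsilon$, $\|\hat y(0)\|+\|\hat z(0)\|\le\varepsilon$ satisfy $\|y(t)-\hat y(t)\|+\|z(t)-\hat z(t)\|\le L_T\big(\|y(0)-\hat y(0)\|+\|z(0)-\hat z(0)\|\big)$ on $[0,T]$ (in particular, weak solutions are unique). Here $u=Kz$ is the function $u\in L^2((0,T);\mathbb U)$ with $\int_0^tu(s)\,ds=K\int_0^tz(s)\,ds$ for $t\in[0,T]$, which is the continuous extension of $z\mapsto Kz$ from solutions with values in $\mathcal D(\widetilde A)$. -/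

import Mathlib

open Filter Topology MeasureTheory Set
open scoped InnerProductSpace

universe u v w

noncomputable section

namespace StabControl

/-- A strongly continuous group `(S(t))_{t ∈ ℝ}` of bounded operators on `H`. -/
structure C0Group (𝕜 : Type w) (H : Type u) [RCLike 𝕜] [NormedAddCommGroup H]
    [InnerProductSpace 𝕜 H] where
  toFun : ℝ → H →L[𝕜] H
  map_zero : toFun 0 = ContinuousLinearMap.id 𝕜 H
  map_add : ∀ s t : ℝ, toFun (s + t) = (toFun s).comp (toFun t)
  strongly_continuous : ∀ x : H, Tendsto (fun t : ℝ => toFun t x) (𝓝 0) (𝓝 x)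

section Generator

variable {𝕜 : Type w} {H : Type u} [RCLike 𝕜] [NormedAddCommGroup H] [InnerProductSpace 𝕜 H]

/-- `w = lim_{t → 0} (S(t) x - x) / t`. -/
def C0Group.HasGeneratorValue (S : C0Group 𝕜 H) (x w : H) : Prop :=
  Tendsto (fun t : ℝ => ((t⁻¹ : ℝ) : 𝕜) • (S.toFun t x - x)) (𝓝[≠] 0) (𝓝 w)

theorem C0Group.HasGeneratorValue.unique {S : C0Group 𝕜 H} {x w w' : H}
    (h : S.HasGeneratorValue x w) (h' : S.HasGeneratorValue x w') : w = w' :=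
  tendsto_nhds_unique h h'

theorem C0Group.HasGeneratorValue.add {S : C0Group 𝕜 H} {x x' w w' : H}
    (h : S.HasGeneratorValue x w) (h' : S.HasGeneratorValue x' w') :
    S.HasGeneratorValue (x + x') (w + w') := by
  refine (Tendsto.add h h').congr fun t => ?_
  rw [← smul_add, _root_.map_add]
  congr 1
  abel

theorem C0Group.HasGeneratorValue.map {S : C0Group 𝕜 H} {x w : H}
    (h : S.HasGeneratorValue x w) (L : H →L[𝕜] H)
    (hL : ∀ t y, L (S.toFun t y) = S.toFun t (L y)) :
    S.HasGeneratorValue (L x) (L w) := by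
  refine ((L.continuous.tendsto w).comp h).congr fun t => ?_
  simp [hL]

theorem C0Group.HasGeneratorValue.smul {S : C0Group 𝕜 H} {x w : H} (c : 𝕜)
    (h : S.HasGeneratorValue x w) : S.HasGeneratorValue (c • x) (c • w) :=
  h.map (c • ContinuousLinearMap.id 𝕜 H) (by simp)

theorem C0Group.hasGeneratorValue_zero (S : C0Group 𝕜 H) : S.HasGeneratorValue 0 0 := by
  simp [C0Group.HasGeneratorValue]

/-- The infinitesimal generator `(A, D(A))` of the group: `D(A)` is the set of all `x` for which
`lim_{t → 0} (S(t) x - x) / t` exists, and `A x` is this limit. -/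
def C0Group.generator (S : C0Group 𝕜 H) : H →ₗ.[𝕜] H where
  domain :=
    { carrier := {x | ∃ w, S.HasGeneratorValue x w}
      add_mem' := fun ⟨_, h⟩ ⟨_, h'⟩ => ⟨_, h.add h'⟩
      zero_mem' := ⟨0, S.hasGeneratorValue_zero⟩
      smul_mem' := fun c _ ⟨_, h⟩ => ⟨_, h.smul c⟩ }
  toFun :=
    { toFun := fun x => Classical.choose x.2
      map_add' := fun x y => (Classical.choose_spec (x + y).2).unique
        ((Classical.choose_spec x.2).add (Classical.choose_spec y.2))
      map_smul' := fun c x => (Classical.choose_spec (c • x).2).unique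
        ((Classical.choose_spec x.2).smul c) }

theorem C0Group.generator_spec (S : C0Group 𝕜 H) (x : S.generator.domain) :
    S.HasGeneratorValue (x : H) (S.generator x) :=
  Classical.choose_spec x.2

theorem C0Group.comm (S : C0Group 𝕜 H) (s t : ℝ) (x : H) :
    S.toFun s (S.toFun t x) = S.toFun t (S.toFun s x) := by
  rw [← ContinuousLinearMap.comp_apply, ← S.map_add, add_comm, S.map_add,
    ContinuousLinearMap.comp_apply]

theorem C0Group.hasGeneratorValue_apply (S : C0Group 𝕜 H) (t : ℝ) (x : S.generator.domain) :
    S.HasGeneratorValue (S.toFun t x) (S.toFun t (S.generator x)) :=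
  (S.generator_spec x).map (S.toFun t) fun s y => S.comm t s y

/-- `S(t) x`, as an element of `D(A)`, for `x ∈ D(A)`. -/
def C0Group.onDomain (S : C0Group 𝕜 H) (t : ℝ) (x : S.generator.domain) : S.generator.domain :=
  ⟨S.toFun t x, _, S.hasGeneratorValue_apply t x⟩

variable [CompleteSpace H]

/-- The adjoint `(A^*, D(A^*))` of the generator `(A, D(A))`. -/
abbrev C0Group.adjointGenerator (S : C0Group 𝕜 H) : H →ₗ.[𝕜] H :=
  LinearPMap.adjoint S.generator

theorem C0Group.adjoint_mem (S : C0Group 𝕜 H) (t : ℝ) (z : S.adjointGenerator.domain) :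
    ContinuousLinearMap.adjoint (S.toFun t) (z : H) ∈ S.adjointGenerator.domain := by
  have hz : Continuous fun x : S.generator.domain => ⟪(z : H), S.generator x⟫_𝕜 := z.2
  have hS : Continuous (S.onDomain t) :=
    ((S.toFun t).continuous.comp continuous_subtype_val).subtype_mk _
  change Continuous fun x : S.generator.domain =>
    ⟪ContinuousLinearMap.adjoint (S.toFun t) (z : H), S.generator x⟫_𝕜
  refine (hz.comp hS).congr fun x => ?_
  have h : S.generator (S.onDomain t x) = S.toFun t (S.generator x) :=
    (S.generator_spec (S.onDomain t x)).unique (S.hasGeneratorValue_apply t x)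
  simp only [Function.comp_apply]
  rw [ContinuousLinearMap.adjoint_inner_left, h]

/-- `S(t)^* z`, as an element of `D(A^*)`, for `z ∈ D(A^*)`. -/
def C0Group.adjointOnDomain (S : C0Group 𝕜 H) (t : ℝ) (z : S.adjointGenerator.domain) :
    S.adjointGenerator.domain :=
  ⟨ContinuousLinearMap.adjoint (S.toFun t) (z : H), S.adjoint_mem t z⟩

end Generator

/-- The space `𝓛(D(A), U)` of linear maps that are bounded for the graph norm of `A`. -/
structure DomainOperator {𝕜 : Type w} {X : Type u} [RCLike 𝕜] [NormedAddCommGroup X]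
    [InnerProductSpace 𝕜 X] (A : X →ₗ.[𝕜] X) (U : Type v) [NormedAddCommGroup U]
    [InnerProductSpace 𝕜 U] where
  toMap : A.domain →ₗ[𝕜] U
  bound : ∃ C : ℝ, ∀ x : A.domain, ‖toMap x‖ ≤ C * (‖(x : X)‖ + ‖A x‖)

section Systems

variable {𝕜 : Type w} {H : Type u} {U : Type v} [RCLike 𝕜]
  [NormedAddCommGroup H] [InnerProductSpace 𝕜 H] [CompleteSpace H]
  [NormedAddCommGroup U] [InnerProductSpace 𝕜 U]

/-- A control operator `B ∈ 𝓛(U, D(A^*)')` is given by its adjoint `B^* ∈ 𝓛(D(A^*), U)`; thus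
`B u` is the functional `φ ↦ ⟨u, B^* φ⟩` on `D(A^*)`. -/
abbrev ControlOperator (S : C0Group 𝕜 H) (U : Type v) [NormedAddCommGroup U]
    [InnerProductSpace 𝕜 U] :=
  DomainOperator S.adjointGenerator U

/-- Square integrability on `(0, T)`. -/
def IsL2 (T : ℝ) (u : ℝ → U) : Prop :=
  MemLp u 2 (volume.restrict (Ioc 0 T))

/-- `B` is admissible: for all `T > 0` and `u ∈ L²((0, T); U)`, the function
`t ↦ ∫_0^t S(t - s) B u(s) ds`, where the integral is understood in `D(A^*)'`, belongs to
`C([0, T]; H)`. -/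
def IsAdmissibleControl (S : C0Group 𝕜 H) (B : ControlOperator S U) : Prop :=
  ∀ T : ℝ, 0 < T → ∀ u : ℝ → U, IsL2 T u →
    ∃ φ : ℝ → H, ContinuousOn φ (Icc 0 T) ∧
      ∀ t ∈ Icc 0 T, ∀ z : S.adjointGenerator.domain,
        ⟪(z : H), φ t⟫_𝕜 = ∫ s in (0 : ℝ)..t, ⟪B.toMap (S.adjointOnDomain (t - s) z), u s⟫_𝕜

/-- Weak solutions on `[0, T]` of `y' = A y + F`, where `F φ s` stands for the pairing of `F(s)`
with `φ ∈ D(A^*)`: `y ∈ C([0, T]; H)` and `d/dt ⟨y, φ⟩ = ⟨y, A^* φ⟩ + ⟨F, φ⟩` for all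
`φ ∈ D(A^*)`, in integrated form. -/
structure IsWeakSolution (S : C0Group 𝕜 H) (T : ℝ) (F : S.adjointGenerator.domain → ℝ → 𝕜)
    (y : ℝ → H) : Prop where
  continuousOn : ContinuousOn y (Icc 0 T)
  integrable : ∀ φ, IntegrableOn (F φ) (Ioc 0 T)
  weak : ∀ φ : S.adjointGenerator.domain, ∀ t ∈ Icc 0 T,
    ⟪(φ : H), y t⟫_𝕜 = ⟪(φ : H), y 0⟫_𝕜 +
      ∫ s in (0 : ℝ)..t, (⟪S.adjointGenerator φ, y s⟫_𝕜 + F φ s)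

/-- The system `y' = A y + B u` is exactly controllable in time `T`. -/
def IsExactlyControllableIn (S : C0Group 𝕜 H) (B : ControlOperator S U) (T : ℝ) : Prop :=
  ∀ y₀ y₁ : H, ∃ u : ℝ → U, IsL2 T u ∧ ∃ y : ℝ → H,
    IsWeakSolution S T (fun φ s => ⟪B.toMap φ, u s⟫_𝕜) y ∧ y 0 = y₀ ∧ y T = y₁

end Systems

section Feedback

variable {𝕜 : Type w} {X : Type u} {U : Type v} [RCLike 𝕜]
  [NormedAddCommGroup X] [InnerProductSpace 𝕜 X]
  [NormedAddCommGroup U] [InnerProductSpace 𝕜 U]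

/-- `K ∈ 𝓛(D(A), U)` is an admissible observation operator: for every `T > 0` the map
`x ↦ K S(·) x` extends to a bounded operator from the state space to `L²((0, T); U)`. -/
def IsAdmissibleObservation (S : C0Group 𝕜 X) (K : DomainOperator S.generator U) : Prop :=
  ∀ T : ℝ, 0 < T → ∃ C : ℝ, ∀ x : S.generator.domain,
    ∫ t in (0 : ℝ)..T, ‖K.toMap (S.onDomain t x)‖ ^ 2 ≤ C * ‖(x : X)‖ ^ 2

/-- `u = K z` on `(0, T)`, where `u ∈ L²((0, T); U)` and `K` is defined on `D(A)` only:
for all `t ∈ [0, T]` one has `∫_0^t z(s) ds ∈ D(A)` and `K ∫_0^t z(s) ds = ∫_0^t u(s) ds`.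
The vector `x` below is `∫_0^t z(s) ds`; both vector integrals are tested against vectors.
If `z` is a solution of `z' = A z + h` with `h` integrable and `K` is an admissible observation
operator, then there is exactly one such `u`, namely the value at `z` of the continuous extension
of `z ↦ K z` from solutions with values in `D(A)`. -/
def IsOutput (S : C0Group 𝕜 X) (K : DomainOperator S.generator U) (T : ℝ) (z : ℝ → X)
    (u : ℝ → U) : Prop :=
  IsL2 T u ∧ ∀ t ∈ Icc 0 T, ∃ x : S.generator.domain,
    (∀ ξ : X, ⟪ξ, (x : X)⟫_𝕜 = ∫ s in (0 : ℝ)..t, ⟪ξ, z s⟫_𝕜) ∧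
    ∀ η : U, ⟪η, K.toMap x⟫_𝕜 = ∫ s in (0 : ℝ)..t, ⟪η, u s⟫_𝕜

/-- A dynamic feedback for a control system with state `y ∈ H` and control `u ∈ U`: an auxiliary
state `z ∈ X` driven by `z' = Ã z + g(y, z)`, and the control law `u = K z`. Here `Ã` generates a
strongly continuous group, `g` is continuous, and Lipschitz near `0`, and `K` may be unbounded, but
is an admissible observation operator. -/
structure DynamicFeedback (𝕜 : Type w) (H : Type u) (U : Type v) (X : Type u) [RCLike 𝕜]
    [NormedAddCommGroup H] [NormedAddCommGroup U] [InnerProductSpace 𝕜 U]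
    [NormedAddCommGroup X] [InnerProductSpace 𝕜 X] where
  group : C0Group 𝕜 X
  K : DomainOperator group.generator U
  admissible : IsAdmissibleObservation group K
  g : H × X → X
  continuous_g : Continuous g
  lipschitz_g : ∃ r > 0, ∃ Λ : NNReal, LipschitzOnWith Λ g (Metric.ball 0 r)

variable {H : Type u} [NormedAddCommGroup H] [InnerProductSpace 𝕜 H] [CompleteSpace H]
  [CompleteSpace X]

/-- Weak solutions on `[0, T]` of the extended system
`y' = A y + f(y) + B K z`, `z' = Ã z + g(y, z)`. -/
def IsClosedLoopSolution (S : C0Group 𝕜 H) (B : ControlOperator S U) (f : H → H)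
    (D : DynamicFeedback 𝕜 H U X) (T : ℝ) (y : ℝ → H) (z : ℝ → X) : Prop :=
  ∃ u : ℝ → U, IsOutput D.group D.K T z u ∧
    IsWeakSolution S T (fun φ s => ⟪(φ : H), f (y s)⟫_𝕜 + ⟪B.toMap φ, u s⟫_𝕜) y ∧
    IsWeakSolution D.group T (fun φ s => ⟪(φ : X), D.g (y s, z s)⟫_𝕜) z

/-- The extended system is well-posed and exponentially stable with rate `μ`, locally near `0`:
for all sufficiently small initial data there is a global weak solution, which decays like
`exp (-μ t)`, and the weak solutions on a bounded interval are unique and depend continuously on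
the data (take equal data in the second part for uniqueness). -/
def IsLocallyExpStable (S : C0Group 𝕜 H) (B : ControlOperator S U) (f : H → H)
    (D : DynamicFeedback 𝕜 H U X) (μ : ℝ) : Prop :=
  ∃ ε > 0, ∃ C > 0,
    (∀ (y₀ : H) (z₀ : X), ‖y₀‖ + ‖z₀‖ ≤ ε → ∃ (y : ℝ → H) (z : ℝ → X),
      y 0 = y₀ ∧ z 0 = z₀ ∧ (∀ T > 0, IsClosedLoopSolution S B f D T y z) ∧
      ∀ t ≥ 0, ‖y t‖ + ‖z t‖ ≤ C * Real.exp (-μ * t) * (‖y₀‖ + ‖z₀‖)) ∧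
    ∀ T > 0, ∃ L : ℝ, ∀ (y y' : ℝ → H) (z z' : ℝ → X),
      IsClosedLoopSolution S B f D T y z → IsClosedLoopSolution S B f D T y' z' →
      ‖y 0‖ + ‖z 0‖ ≤ ε → ‖y' 0‖ + ‖z' 0‖ ≤ ε →
      ∀ t ∈ Icc 0 T, ‖y t - y' t‖ + ‖z t - z' t‖ ≤ L * (‖y 0 - y' 0‖ + ‖z 0 - z' 0‖)

/-- The system `y' = A y + f(y) + B u` is locally rapidly dynamically stabilizable: for every rate
`μ > 0` it is, for a suitable dynamic feedback, a subsystem of an extended system that is locally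
well-posed and locally exponentially stable with rate `μ`. -/
def IsLocallyRapidlyDynamicallyStabilizable (S : C0Group 𝕜 H) (B : ControlOperator S U)
    (f : H → H) : Prop :=
  ∀ μ : ℝ, 0 < μ → ∃ (X : Type u) (_ : NormedAddCommGroup X) (_ : InnerProductSpace 𝕜 X)
    (_ : CompleteSpace X) (D : DynamicFeedback 𝕜 H U X), IsLocallyExpStable S B f D μ

end Feedback

end StabControl

end

/-! Fix `c` large and let `Ã = -A^* - 2c`, the generator of `e^{-2ct} S(-t)^*`, and `K = -B^*`. The
weighted Gramian is formally `P = ∫_0^∞ e^{-2cs} S(-s) B B^* S(-s)^* ds`; admissibility of `B` and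
the exponential growth bound of `S` make it converge, as `P = Q^* Q` with `Q φ = e^{-cs} B^* S(-s)^*
φ` in `L²(0, ∞)`. Differentiating `P` along the dual group gives the Lyapunov equation
(`IsOutputMap.lyapunov`), which reads `P Ã = A P + B K`. Hence, if `z' = Ã z + g`, then `P z` solves
the control equation with control `K z` and forcing `P g` (`IsOutput.isWeakSolution_map`). By
duality, exact controllability is an observability inequality for `B^* S(-s)^*`, so `P` is coercive
and has a bounded inverse `R`.

The feedback is `g(y, z) = R (f(y) + λ (y - P z))`. In the equation for `ζ = y - P z` both the
unbounded control term and the nonlinearity cancel, leaving `ζ' = (A - λ) ζ`, while `z' = Ã z + R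
f(ζ + P z) + λ R ζ`. For `c` and `λ` large, both linear parts decay faster than `e^{-μt}`. The
coupling `λ R ζ` is bounded but not small; in the coordinate `k ζ` with `k` large it becomes small
(`exists_coordForcing_bound`). The remaining term is small near `0` since `f(y) = o(‖y‖)`. A
semilinear perturbation argument (`LinearFlow.exists_locally_exp_stable`), based on Picard–Lindelöf,
Grönwall and a continuity argument, gives existence, decay and Lipschitz dependence.

Two points need care. Weak solutions must be identified with mild ones, which rests on
differentiating `⟨S(-t)^* φ, y(t)⟩` (`IsWeakSolution.inner_star_neg`). Moreover `K z` has to make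
sense for merely continuous `z`: since `‖e^Ã‖ < 1`, the generator `Ã` is invertible, `K = J Ã` with
`J` bounded, and `∫ z` lies in `D(Ã)`; the output itself is built by variation of constants in `L²`
(`IsExtendedOutput.exists_isOutput`). -/

noncomputable section

namespace StabControl

/-! ### Strongly continuous groups: growth, generators, density of domains, rescaling -/

section GroupBasics

variable {𝕜 : Type w} {H : Type u} [RCLike 𝕜] [NormedAddCommGroup H] [InnerProductSpace 𝕜 H]

theorem C0Group.apply_add (S : C0Group 𝕜 H) (s t : ℝ) (x : H) :
    S.toFun (s + t) x = S.toFun s (S.toFun t x) := by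
  rw [S.map_add, ContinuousLinearMap.comp_apply]

theorem C0Group.apply_zero (S : C0Group 𝕜 H) (x : H) : S.toFun 0 x = x := by
  rw [S.map_zero, ContinuousLinearMap.id_apply]

theorem C0Group.apply_neg_apply (S : C0Group 𝕜 H) (t : ℝ) (x : H) :
    S.toFun t (S.toFun (-t) x) = x := by
  rw [← S.apply_add, add_neg_cancel, S.apply_zero]

theorem C0Group.neg_apply_apply (S : C0Group 𝕜 H) (t : ℝ) (x : H) :
    S.toFun (-t) (S.toFun t x) = x := by
  rw [← S.apply_add, neg_add_cancel, S.apply_zero]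

theorem C0Group.continuous_orbit (S : C0Group 𝕜 H) (x : H) :
    Continuous fun t : ℝ => S.toFun t x := by
  rw [continuous_iff_continuousAt]
  intro t
  have h : Tendsto (fun s : ℝ => S.toFun (s - t) x) (𝓝 t) (𝓝 x) := by
    refine (S.strongly_continuous x).comp ?_
    have : Tendsto (fun s : ℝ => s - t) (𝓝 t) (𝓝 (t - t)) := tendsto_id.sub_const t
    simpa using this
  refine (((S.toFun t).continuous.tendsto x).comp h).congr fun s => ?_
  simp only [Function.comp_apply]
  rw [← S.apply_add, add_sub_cancel]

theorem C0Group.exists_bound_Icc [CompleteSpace H] (S : C0Group 𝕜 H) (T : ℝ) :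
    ∃ M : ℝ, 0 < M ∧ ∀ t : ℝ, |t| ≤ T → ‖S.toFun t‖ ≤ M := by
  obtain ⟨C, hC⟩ := banach_steinhaus (g := fun t : Icc (-T) T => S.toFun t) (fun x => by
    obtain ⟨C, hC⟩ := (isCompact_Icc (a := -T) (b := T)).exists_bound_of_continuousOn
      (S.continuous_orbit x).continuousOn
    exact ⟨C, fun t => hC t t.2⟩)
  exact ⟨max C 1, lt_max_of_lt_right one_pos, fun t ht =>
    (hC ⟨t, abs_le.1 ht⟩).trans (le_max_left _ _)⟩

theorem C0Group.exists_growth_bound [CompleteSpace H] (S : C0Group 𝕜 H) :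
    ∃ M : ℝ, 1 ≤ M ∧ ∃ a : ℝ, 0 ≤ a ∧ ∀ t : ℝ, ‖S.toFun t‖ ≤ M * Real.exp (a * |t|) := by
  obtain ⟨M₀, hM₀, hM⟩ := S.exists_bound_Icc 1
  set M := max M₀ 1
  have h1 : 1 ≤ M := le_max_right _ _
  have hM' : ∀ t : ℝ, |t| ≤ 1 → ‖S.toFun t‖ ≤ M := fun t ht => (hM t ht).trans (le_max_left _ _)
  have key : ∀ n : ℕ, ∀ t : ℝ, |t| ≤ n + 1 → ‖S.toFun t‖ ≤ M * M ^ n := by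
    intro n
    induction n with
    | zero => intro t ht; simpa using hM' t (by simpa using ht)
    | succ n ih =>
      intro t ht
      have hpos : (0 : ℝ) < n + 2 := by positivity
      push_cast at ht
      -- When `|t| ≤ n + 2`, the two summands have modulus at most `1` and `n + 1`.
      have e : t = t / (n + 2) + t * (n + 1) / (n + 2) := by field_simp; ring
      rw [e, S.map_add]
      refine (ContinuousLinearMap.opNorm_comp_le _ _).trans ?_
      have a1 : |t / (n + 2)| ≤ 1 := by
        rw [abs_div, abs_of_pos hpos, div_le_one hpos]; linarith
      have a2 : |t * (n + 1) / (n + 2)| ≤ n + 1 := by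
        rw [abs_div, abs_of_pos hpos, abs_mul, abs_of_pos (by positivity : (0 : ℝ) < n + 1),
          div_le_iff₀ hpos]
        nlinarith
      calc _ ≤ M * (M * M ^ n) :=
            mul_le_mul (hM' _ a1) (ih _ a2) (norm_nonneg _) (by positivity)
        _ = M * M ^ (n + 1) := by ring
  refine ⟨M, h1, Real.log M, Real.log_nonneg h1, fun t => ?_⟩
  have hle := Nat.floor_le (abs_nonneg t)
  refine (key ⌊|t|⌋₊ t (Nat.lt_floor_add_one _).le).trans ?_
  gcongr
  rw [← Real.exp_log (by positivity : 0 < M), ← Real.exp_nat_mul, Real.log_exp, mul_comm]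
  exact Real.exp_le_exp.2 (mul_le_mul_of_nonneg_left hle (Real.log_nonneg h1))

theorem C0Group.tendsto_apply [CompleteSpace H] (S : C0Group 𝕜 H) {α : Type*} {l : Filter α}
    {p : α → ℝ} {q : α → H} {t : ℝ} {x : H} (hp : Tendsto p l (𝓝 t)) (hq : Tendsto q l (𝓝 x)) :
    Tendsto (fun i => S.toFun (p i) (q i)) l (𝓝 (S.toFun t x)) := by
  obtain ⟨M, hM, hb⟩ := S.exists_bound_Icc (|t| + 1)
  have h1 : Tendsto (fun i => S.toFun (p i) x) l (𝓝 (S.toFun t x)) :=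
    ((S.continuous_orbit x).tendsto t).comp hp
  have h2 : Tendsto (fun i => S.toFun (p i) (q i - x)) l (𝓝 0) := by
    have h0 : Tendsto (fun i => M * ‖q i - x‖) l (𝓝 0) := by
      have := ((hq.sub_const x).norm).const_mul M
      simpa using this
    refine squeeze_zero_norm' ?_ h0
    have : ∀ᶠ i in l, |p i| < |t| + 1 := (hp.abs).eventually_lt_const (by linarith)
    filter_upwards [this] with i hi
    exact (S.toFun (p i)).le_of_opNorm_le (hb _ hi.le) _
  have := h1.add h2
  rw [add_zero] at this
  refine this.congr fun i => ?_
  rw [← _root_.map_add, add_sub_cancel]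

theorem C0Group.continuous_apply [CompleteSpace H] (S : C0Group 𝕜 H) {α : Type*}
    [TopologicalSpace α] {p : α → ℝ} {q : α → H} (hp : Continuous p) (hq : Continuous q) :
    Continuous fun i => S.toFun (p i) (q i) :=
  continuous_iff_continuousAt.2 fun i => S.tendsto_apply (hp.tendsto i) (hq.tendsto i)

theorem C0Group.continuousOn_apply [CompleteSpace H] (S : C0Group 𝕜 H) {α : Type*}
    [TopologicalSpace α] {s : Set α} {p : α → ℝ} {q : α → H} (hp : ContinuousOn p s)
    (hq : ContinuousOn q s) : ContinuousOn (fun i => S.toFun (p i) (q i)) s :=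
  fun i hi => S.tendsto_apply (hp i hi) (hq i hi)

theorem C0Group.HasGeneratorValue.mem {S : C0Group 𝕜 H} {x w : H}
    (h : S.HasGeneratorValue x w) : x ∈ S.generator.domain :=
  ⟨w, h⟩

theorem C0Group.generator_eq_of {S : C0Group 𝕜 H} {x w : H} (h : S.HasGeneratorValue x w)
    (hx : x ∈ S.generator.domain) : S.generator ⟨x, hx⟩ = w :=
  (S.generator_spec ⟨x, hx⟩).unique h

theorem C0Group.generator_onDomain (S : C0Group 𝕜 H) (t : ℝ) (x : S.generator.domain) :
    S.generator (S.onDomain t x) = S.toFun t (S.generator x) :=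
  (S.generator_spec _).unique (S.hasGeneratorValue_apply t x)

/-- The rescaled group `e^{ct} S(t)`. -/
def C0Group.scale (S : C0Group 𝕜 H) (c : ℝ) : C0Group 𝕜 H where
  toFun t := ((Real.exp (c * t) : ℝ) : 𝕜) • S.toFun t
  map_zero := by simp [S.map_zero]
  map_add s t := by
    ext x
    simp only [_root_.smul_apply, ContinuousLinearMap.comp_apply, map_smul, smul_smul,
      S.apply_add]
    rw [← RCLike.ofReal_mul, ← Real.exp_add, mul_add, add_comm (c * s)]
  strongly_continuous x := by
    have h1 : Tendsto (fun t : ℝ => ((Real.exp (c * t) : ℝ) : 𝕜)) (𝓝 0) (𝓝 1) := by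
      have : Continuous fun t : ℝ => ((Real.exp (c * t) : ℝ) : 𝕜) :=
        RCLike.continuous_ofReal.comp (by fun_prop)
      simpa using this.tendsto 0
    simpa using h1.smul (S.strongly_continuous x)

theorem C0Group.scale_apply (S : C0Group 𝕜 H) (c t : ℝ) (x : H) :
    (S.scale c).toFun t x = ((Real.exp (c * t) : ℝ) : 𝕜) • S.toFun t x := rfl

theorem C0Group.norm_scale_le (S : C0Group 𝕜 H) (c t : ℝ) :
    ‖(S.scale c).toFun t‖ ≤ Real.exp (c * t) * ‖S.toFun t‖ := by
  refine (norm_smul_le ((Real.exp (c * t) : ℝ) : 𝕜) (S.toFun t)).trans (le_of_eq ?_)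
  rw [RCLike.norm_ofReal, abs_of_pos (Real.exp_pos _)]

variable [NormedSpace ℝ H] [IsScalarTower ℝ 𝕜 H]

theorem ofReal_smul_eq (r : ℝ) (x : H) : ((r : ℝ) : 𝕜) • x = r • x := by
  rw [← RCLike.real_smul_eq_coe_smul]

theorem C0Group.hasGeneratorValue_iff_hasDerivAt (S : C0Group 𝕜 H) {x w : H} :
    S.HasGeneratorValue x w ↔ HasDerivAt (fun t : ℝ => S.toFun t x) w 0 := by
  rw [hasDerivAt_iff_tendsto_slope, C0Group.HasGeneratorValue]
  refine tendsto_congr fun t => ?_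
  rw [slope_def_module, ofReal_smul_eq, sub_zero, S.apply_zero]

theorem C0Group.HasGeneratorValue.hasDerivAt {S : C0Group 𝕜 H} {x w : H}
    (h : S.HasGeneratorValue x w) (t : ℝ) :
    HasDerivAt (fun s : ℝ => S.toFun s x) (S.toFun t w) t := by
  have h0 := S.hasGeneratorValue_iff_hasDerivAt.1 h
  have h1 : HasDerivAt (fun s : ℝ => S.toFun (s - t) x) w t := by
    have : HasDerivAt (fun s : ℝ => S.toFun s x) w (t - t) := by simpa using h0
    exact this.comp_sub_const t t
  have h2 := ((S.toFun t).restrictScalars ℝ).hasFDerivAt.comp_hasDerivAt t h1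
  refine h2.congr_of_eventuallyEq (Eventually.of_forall fun s => ?_)
  simp only [Function.comp_apply, ContinuousLinearMap.coe_restrictScalars']
  rw [← S.apply_add, add_sub_cancel]

theorem C0Group.integral_orbit [CompleteSpace H] {S : C0Group 𝕜 H} {x w : H}
    (h : S.HasGeneratorValue x w) (t : ℝ) :
    ∫ s in (0 : ℝ)..t, S.toFun s w = S.toFun t x - x := by
  rw [intervalIntegral.integral_eq_sub_of_hasDerivAt (fun s _ => h.hasDerivAt s)
    ((S.continuous_orbit w).intervalIntegrable _ _), S.apply_zero]

theorem C0Group.hasGeneratorValue_integral [CompleteSpace H] (S : C0Group 𝕜 H) (r : ℝ) (x : H) :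
    S.HasGeneratorValue (∫ s in (0 : ℝ)..r, S.toFun s x) (S.toFun r x - x) := by
  rw [S.hasGeneratorValue_iff_hasDerivAt]
  have hc := S.continuous_orbit x
  have hi : ∀ a b : ℝ, IntervalIntegrable (fun s => S.toFun s x) volume a b :=
    fun a b => hc.intervalIntegrable a b
  have e : (fun t : ℝ => S.toFun t (∫ s in (0 : ℝ)..r, S.toFun s x)) =
      fun t => (∫ s in (0 : ℝ)..(r + t), S.toFun s x) - ∫ s in (0 : ℝ)..t, S.toFun s x := by
    funext t
    rw [← ContinuousLinearMap.intervalIntegral_comp_comm _ (hi 0 r),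
      intervalIntegral.integral_interval_sub_left (hi _ _) (hi _ _)]
    have : ∀ s, S.toFun t (S.toFun s x) = S.toFun (s + t) x := fun s => by
      rw [add_comm, S.apply_add]
    simp only [this]
    rw [intervalIntegral.integral_comp_add_right (fun s => S.toFun s x) t, zero_add]
  rw [e]
  have h1 : ∀ c : ℝ, HasDerivAt (fun t : ℝ => ∫ s in (0 : ℝ)..t, S.toFun s x) (S.toFun c x) c :=
    fun c => intervalIntegral.integral_hasDerivAt_right (hi _ _)
      (hc.stronglyMeasurableAtFilter _ _) hc.continuousAt
  have h2 : HasDerivAt (fun t : ℝ => ∫ s in (0 : ℝ)..(r + t), S.toFun s x) (S.toFun r x) 0 := by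
    have := h1 (r + 0)
    rw [add_zero r] at this
    exact HasDerivAt.comp_const_add r 0 (by rwa [add_zero])
  have := h2.sub (h1 0)
  rw [S.apply_zero] at this
  exact this

omit [IsScalarTower ℝ 𝕜 H] in
theorem C0Group.tendsto_average [CompleteSpace H] (S : C0Group 𝕜 H) (x : H) :
    Tendsto (fun r : ℝ => r⁻¹ • ∫ s in (0 : ℝ)..r, S.toFun s x) (𝓝[≠] 0) (𝓝 x) := by
  have hc := S.continuous_orbit x
  have h1 : HasDerivAt (fun t : ℝ => ∫ s in (0 : ℝ)..t, S.toFun s x) (S.toFun 0 x) 0 :=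
    intervalIntegral.integral_hasDerivAt_right (hc.intervalIntegrable _ _)
      (hc.stronglyMeasurableAtFilter _ _) hc.continuousAt
  rw [hasDerivAt_iff_tendsto_slope, S.apply_zero] at h1
  refine h1.congr fun t => ?_
  simp [slope_def_module]

/-- Averaging an orbit over `[0, r]` moves a vector into the domain, and averaging twice moves it
into the domain of the square; as `r → 0` the double averages return to the vector. -/
theorem C0Group.dense_domain_sq [CompleteSpace H] (S : C0Group 𝕜 H) :
    Dense {x : H | ∃ y z, S.HasGeneratorValue x y ∧ S.HasGeneratorValue y z} := by
  intro x
  refine mem_closure_of_tendsto (f := fun r : ℝ => r⁻¹ • ∫ s in (0 : ℝ)..r, S.toFun s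
    (r⁻¹ • ∫ s in (0 : ℝ)..r, S.toFun s x)) (b := 𝓝[≠] 0) ?_ ?_
  · obtain ⟨M, hM, hb⟩ := S.exists_bound_Icc 1
    have h0 := (S.tendsto_average x)
    have h1 : Tendsto (fun r : ℝ => r⁻¹ • ∫ s in (0 : ℝ)..r, S.toFun s
        ((r⁻¹ • ∫ s in (0 : ℝ)..r, S.toFun s x) - x)) (𝓝[≠] 0) (𝓝 0) := by
      have h2 : Tendsto (fun r : ℝ => M * ‖(r⁻¹ • ∫ s in (0 : ℝ)..r, S.toFun s x) - x‖)
          (𝓝[≠] 0) (𝓝 0) := by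
        have := ((h0.sub_const x).norm).const_mul M
        simpa using this
      refine squeeze_zero_norm' ?_ h2
      have h3 : ∀ᶠ r : ℝ in 𝓝[≠] 0, |r| < 1 :=
        ((continuous_abs.tendsto (0 : ℝ)).mono_left nhdsWithin_le_nhds).eventually_lt_const
          (by simp)
      filter_upwards [h3, self_mem_nhdsWithin] with r hr hr0
      set y := (r⁻¹ • ∫ s in (0 : ℝ)..r, S.toFun s x) - x
      have h4 : ‖∫ s in (0 : ℝ)..r, S.toFun s y‖ ≤ (M * ‖y‖) * |r - 0| := by
        refine intervalIntegral.norm_integral_le_of_norm_le_const fun s hs => ?_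
        refine (S.toFun s).le_of_opNorm_le (hb _ ?_) _
        have := uIoc_subset_uIcc hs
        rw [mem_uIcc] at this
        rw [abs_lt] at hr
        rw [abs_le]
        constructor <;> rcases this with h | h <;> linarith
      have hr0' : |r| ≠ 0 := abs_ne_zero.2 hr0
      rw [norm_smul, norm_inv, Real.norm_eq_abs]
      rw [sub_zero] at h4
      calc |r|⁻¹ * _ ≤ |r|⁻¹ * (M * ‖y‖ * |r|) := by gcongr
        _ = M * ‖y‖ := by field_simp
    have := h1.add h0
    rw [zero_add] at this
    refine this.congr fun r => ?_
    rw [← smul_add]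
    have hi : ∀ y : H, IntervalIntegrable (fun s => S.toFun s y) volume 0 r :=
      fun y => (S.continuous_orbit y).intervalIntegrable _ _
    rw [← intervalIntegral.integral_add (hi _) (hi _)]
    simp [sub_add_cancel]
  · filter_upwards with r
    have a : ∀ y : H, S.HasGeneratorValue (r⁻¹ • ∫ s in (0 : ℝ)..r, S.toFun s y)
        (r⁻¹ • (S.toFun r y - y)) := fun y => by
      have := (S.hasGeneratorValue_integral r y).smul ((r⁻¹ : ℝ) : 𝕜)
      simpa only [ofReal_smul_eq] using this
    have a' := a x
    set d := r⁻¹ • (S.toFun r x - x)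
    refine ⟨_, r⁻¹ • (S.toFun r d - d), a _, ?_⟩
    have hm := (a'.map (S.toFun r) fun t y => S.comm r t y).add (a'.smul (-1 : 𝕜))
    have := hm.smul ((r⁻¹ : ℝ) : 𝕜)
    simpa only [ofReal_smul_eq, neg_smul, one_smul, ← sub_eq_add_neg] using this

theorem C0Group.dense_domain [CompleteSpace H] (S : C0Group 𝕜 H) :
    Dense (S.generator.domain : Set H) := by
  refine S.dense_domain_sq.mono ?_
  rintro _ ⟨_, _, h, _⟩
  exact ⟨_, h⟩

theorem C0Group.HasGeneratorValue.scale {S : C0Group 𝕜 H} {x w : H}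
    (h : S.HasGeneratorValue x w) (c : ℝ) : (S.scale c).HasGeneratorValue x (w + c • x) := by
  rw [C0Group.hasGeneratorValue_iff_hasDerivAt] at h ⊢
  have h1 : HasDerivAt (fun t : ℝ => Real.exp (c * t)) c 0 := by
    have := ((hasDerivAt_id (0 : ℝ)).const_mul c).exp
    simpa using this
  have := h1.smul h
  simp only [S.apply_zero, mul_zero, Real.exp_zero, one_smul] at this
  refine this.congr_of_eventuallyEq (Eventually.of_forall fun t => ?_)
  simp [S.scale_apply]

end GroupBasics


/-! ### The adjoint semigroup, its strong continuity, and the dual group `S(-t)^*` -/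

section Adjoint

variable {𝕜 : Type w} {H : Type u} [RCLike 𝕜] [NormedAddCommGroup H] [InnerProductSpace 𝕜 H]
  [CompleteSpace H] [NormedSpace ℝ H] [IsScalarTower ℝ 𝕜 H]

omit [IsScalarTower ℝ 𝕜 H] in
theorem inner_intervalIntegral {f : ℝ → H} {a b : ℝ} (hf : IntervalIntegrable f volume a b)
    (x : H) : ⟪x, ∫ s in a..b, f s⟫_𝕜 = ∫ s in a..b, ⟪x, f s⟫_𝕜 :=
  ((innerSL 𝕜 x).intervalIntegral_comp_comm hf).symm

omit [IsScalarTower ℝ 𝕜 H] in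
theorem intervalIntegral_inner {f : ℝ → H} {a b : ℝ} (hf : IntervalIntegrable f volume a b)
    (x : H) : ⟪∫ s in a..b, f s, x⟫_𝕜 = ∫ s in a..b, ⟪f s, x⟫_𝕜 := by
  rw [← inner_conj_symm, inner_intervalIntegral hf]
  have h : IntervalIntegrable (fun s => ⟪x, f s⟫_𝕜) volume a b :=
    ⟨hf.1.const_inner x, hf.2.const_inner x⟩
  have := (RCLike.conjCLE (K := 𝕜)).toContinuousLinearMap.intervalIntegral_comp_comm h
  simp only [ContinuousLinearEquiv.coe_coe, RCLike.conjCLE_apply, inner_conj_symm] at this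
  exact this.symm

/-- The dual orbit `S(t)^* φ`. -/
abbrev C0Group.star (S : C0Group 𝕜 H) (t : ℝ) : H →L[𝕜] H :=
  ContinuousLinearMap.adjoint (S.toFun t)

omit [NormedSpace ℝ H] [IsScalarTower ℝ 𝕜 H] in
theorem C0Group.star_apply_add (S : C0Group 𝕜 H) (s t : ℝ) (x : H) :
    S.star (s + t) x = S.star s (S.star t x) := by
  rw [add_comm, C0Group.star, S.map_add, ContinuousLinearMap.adjoint_comp,
    ContinuousLinearMap.comp_apply]

omit [NormedSpace ℝ H] [IsScalarTower ℝ 𝕜 H] in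
theorem C0Group.star_zero (S : C0Group 𝕜 H) (x : H) : S.star 0 x = x := by
  rw [C0Group.star, S.map_zero, ContinuousLinearMap.adjoint_id, ContinuousLinearMap.id_apply]

omit [NormedSpace ℝ H] [IsScalarTower ℝ 𝕜 H] in
theorem C0Group.norm_star (S : C0Group 𝕜 H) (t : ℝ) : ‖S.star t‖ = ‖S.toFun t‖ :=
  LinearIsometryEquiv.norm_map _ _

theorem C0Group.inner_adjointGenerator (S : C0Group 𝕜 H) (φ : S.adjointGenerator.domain)
    {x w : H} (h : S.HasGeneratorValue x w) :
    ⟪S.adjointGenerator φ, x⟫_𝕜 = ⟪(φ : H), w⟫_𝕜 := by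
  have := LinearPMap.adjoint_isFormalAdjoint S.dense_domain φ ⟨x, w, h⟩
  exact this.trans (congrArg _ (S.generator_eq_of h ⟨w, h⟩))

theorem C0Group.adjointGenerator_eq_of (S : C0Group 𝕜 H) (φ : S.adjointGenerator.domain) {w : H}
    (h : ∀ x : S.generator.domain, ⟪w, (x : H)⟫_𝕜 = ⟪(φ : H), S.generator x⟫_𝕜) :
    S.adjointGenerator φ = w :=
  LinearPMap.adjoint_apply_eq S.dense_domain φ h

theorem C0Group.adjointGenerator_adjointOnDomain (S : C0Group 𝕜 H) (t : ℝ)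
    (φ : S.adjointGenerator.domain) :
    S.adjointGenerator (S.adjointOnDomain t φ) = S.star t (S.adjointGenerator φ) := by
  refine S.adjointGenerator_eq_of _ fun x => ?_
  rw [ContinuousLinearMap.adjoint_inner_left,
    S.inner_adjointGenerator φ (S.hasGeneratorValue_apply t x)]
  exact (ContinuousLinearMap.adjoint_inner_left _ _ _).symm

/-- By duality, `⟨(S(t)^* - S(s)^*) φ, y⟩ = ⟨A^* φ, ∫_s^t S(r) y dr⟩`. Only orbits of `S` are
integrated, so continuity of the adjoint orbits is not presupposed; it is deduced from this bound.
-/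
theorem C0Group.norm_star_sub_le (S : C0Group 𝕜 H) (φ : S.adjointGenerator.domain) {M : ℝ}
    {s t : ℝ} (hM : ∀ r ∈ uIcc s t, ‖S.toFun r‖ ≤ M) :
    ‖S.star t φ - S.star s φ‖ ≤ M * ‖S.adjointGenerator φ‖ * |t - s| := by
  have hM0 : 0 ≤ M := (norm_nonneg _).trans (hM s left_mem_uIcc)
  have key : ∀ y : H, ‖⟪S.star t φ - S.star s φ, y⟫_𝕜‖ ≤
      M * ‖S.adjointGenerator φ‖ * |t - s| * ‖y‖ := by
    intro y
    refine S.dense_domain.induction (P := fun y => ‖⟪S.star t φ - S.star s φ, y⟫_𝕜‖ ≤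
      M * ‖S.adjointGenerator φ‖ * |t - s| * ‖y‖) ?_ (isClosed_le (by fun_prop) (by fun_prop)) y
    rintro y ⟨w, hw⟩
    have e : ⟪S.star t φ - S.star s φ, y⟫_𝕜 =
        ⟪S.adjointGenerator φ, ∫ r in s..t, S.toFun r y⟫_𝕜 := by
      have hc := S.continuous_orbit y
      rw [← intervalIntegral.integral_interval_sub_left (hc.intervalIntegrable 0 t)
        (hc.intervalIntegrable 0 s), inner_sub_left, inner_sub_right,
        S.inner_adjointGenerator φ (S.hasGeneratorValue_integral t y),
        S.inner_adjointGenerator φ (S.hasGeneratorValue_integral s y),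
        ContinuousLinearMap.adjoint_inner_left, ContinuousLinearMap.adjoint_inner_left,
        inner_sub_right, inner_sub_right]
      ring
    rw [e]
    have h1 : ‖∫ r in s..t, S.toFun r y‖ ≤ M * ‖y‖ * |t - s| :=
      intervalIntegral.norm_integral_le_of_norm_le_const fun r hr =>
        (S.toFun r).le_of_opNorm_le (hM r (uIoc_subset_uIcc hr)) _
    calc _ ≤ ‖S.adjointGenerator φ‖ * ‖∫ r in s..t, S.toFun r y‖ := norm_inner_le_norm _ _
      _ ≤ ‖S.adjointGenerator φ‖ * (M * ‖y‖ * |t - s|) := by gcongr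
      _ = _ := by ring
  have h := key (S.star t φ - S.star s φ)
  rw [inner_self_eq_norm_sq_to_K, norm_pow, RCLike.norm_ofReal, abs_norm, sq] at h
  by_cases h0 : ‖S.star t φ - S.star s φ‖ = 0
  · rw [h0]; positivity
  · exact le_of_mul_le_mul_right h ((norm_nonneg _).lt_of_ne' h0)

/-- The operator `x ↦ ∫_0^r S(s) x ds`. -/
def C0Group.integralCLM (S : C0Group 𝕜 H) (r : ℝ) : H →L[𝕜] H :=
  LinearMap.mkContinuousOfExistsBound
    { toFun := fun x => ∫ s in (0 : ℝ)..r, S.toFun s x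
      map_add' := fun x y => by
        simp only [_root_.map_add]
        exact intervalIntegral.integral_add ((S.continuous_orbit x).intervalIntegrable _ _)
          ((S.continuous_orbit y).intervalIntegrable _ _)
      map_smul' := fun c x => by
        simp only [map_smul, RingHom.id_apply]
        exact intervalIntegral.integral_smul c _ } <| by
    obtain ⟨M, hM, hb⟩ := S.exists_bound_Icc |r|
    refine ⟨M * |r|, fun x => ?_⟩
    have : ‖∫ s in (0 : ℝ)..r, S.toFun s x‖ ≤ M * ‖x‖ * |r - 0| := by
      refine intervalIntegral.norm_integral_le_of_norm_le_const fun s hs => ?_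
      refine (S.toFun s).le_of_opNorm_le (hb _ ?_) _
      simpa using abs_sub_left_of_mem_uIcc (uIoc_subset_uIcc hs)
    rw [sub_zero] at this
    exact this.trans (le_of_eq (by ring))

theorem C0Group.integralCLM_apply (S : C0Group 𝕜 H) (r : ℝ) (x : H) :
    S.integralCLM r x = ∫ s in (0 : ℝ)..r, S.toFun s x := rfl

/-- The adjoint of `∫_0^r S(s) ds` maps into `D(A^*)`. A vector orthogonal to `D(A^*)` is therefore
annihilated by `∫_0^r S(s) ds` for every `r`; dividing by `r` and letting `r → 0` shows that it
vanishes. -/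
theorem C0Group.dense_adjoint_domain (S : C0Group 𝕜 H) :
    Dense (S.adjointGenerator.domain : Set H) := by
  rw [Submodule.dense_iff_topologicalClosure_eq_top, Submodule.topologicalClosure_eq_top_iff,
    Submodule.eq_bot_iff]
  intro ξ hξ
  have h0 : ∀ r : ℝ, S.integralCLM r ξ = 0 := by
    intro r
    refine ext_inner_left 𝕜 fun x => ?_
    rw [inner_zero_right, ← ContinuousLinearMap.adjoint_inner_left]
    refine (Submodule.mem_orthogonal _ _).1 hξ _ ?_
    refine LinearPMap.mem_adjoint_domain_of_exists _ ⟨S.star r x - x, fun y => ?_⟩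
    rw [ContinuousLinearMap.adjoint_inner_left, inner_sub_left,
      ContinuousLinearMap.adjoint_inner_left, S.integralCLM_apply,
      S.integral_orbit (S.generator_spec y), inner_sub_right]
  have h1 := S.tendsto_average ξ
  simp only [← S.integralCLM_apply, h0, smul_zero] at h1
  exact tendsto_nhds_unique h1 tendsto_const_nhds

theorem C0Group.tendsto_star (S : C0Group 𝕜 H) (x : H) :
    Tendsto (fun t : ℝ => S.star t x) (𝓝 0) (𝓝 x) := by
  obtain ⟨M, hM, hb⟩ := S.exists_bound_Icc 1
  rw [Metric.tendsto_nhds]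
  intro ε hε
  obtain ⟨φ, hφ, hd⟩ := S.dense_adjoint_domain.exists_dist_lt x
    (show 0 < ε / (2 * (M + 1)) by positivity)
  have h1 : Tendsto (fun t : ℝ => M * ‖S.adjointGenerator ⟨φ, hφ⟩‖ * |t - 0|) (𝓝 0) (𝓝 0) := by
    have : Continuous fun t : ℝ => M * ‖S.adjointGenerator ⟨φ, hφ⟩‖ * |t - 0| := by fun_prop
    simpa using this.tendsto 0
  have h2 : ∀ᶠ t : ℝ in 𝓝 0, |t| < 1 :=
    (continuous_abs.tendsto (0 : ℝ)).eventually_lt_const (by simp)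
  filter_upwards [h1.eventually_lt_const (half_pos hε), h2] with t ht ht1
  have h3 : ‖S.star t φ - S.star 0 φ‖ ≤ M * ‖S.adjointGenerator ⟨φ, hφ⟩‖ * |t - 0| := by
    refine S.norm_star_sub_le ⟨φ, hφ⟩ fun r hr => hb r ?_
    have := abs_sub_left_of_mem_uIcc hr
    simp only [sub_zero] at this
    linarith
  rw [S.star_zero] at h3
  have h4 : ‖S.star t (x - φ)‖ ≤ M * ‖x - φ‖ :=
    (S.star t).le_of_opNorm_le ((S.norm_star t).le.trans (hb t ht1.le)) _
  rw [dist_eq_norm] at hd ⊢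
  have e : S.star t x - x = S.star t (x - φ) + (S.star t φ - φ) - (x - φ) := by
    rw [map_sub]; abel
  rw [e]
  have h5 : (M + 1) * ‖x - φ‖ < ε / 2 := by
    have := mul_lt_mul_of_pos_left hd (show 0 < M + 1 by positivity)
    refine this.trans_le (le_of_eq ?_)
    field_simp
  calc _ ≤ ‖S.star t (x - φ)‖ + ‖S.star t φ - φ‖ + ‖x - φ‖ :=
        (norm_sub_le _ _).trans (by gcongr; exact norm_add_le _ _)
    _ < ε := by linarith

/-- The dual group `S(-t)^*`. -/
def C0Group.dual (S : C0Group 𝕜 H) : C0Group 𝕜 H where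
  toFun t := S.star (-t)
  map_zero := by ext x; simp [S.star_zero]
  map_add s t := by
    ext x
    rw [neg_add, S.star_apply_add, ContinuousLinearMap.comp_apply]
  strongly_continuous x := by
    refine (S.tendsto_star x).comp ?_
    have : Continuous fun t : ℝ => -t := continuous_neg
    simpa using this.tendsto 0

theorem C0Group.dual_apply (S : C0Group 𝕜 H) (t : ℝ) (x : H) :
    S.dual.toFun t x = S.star (-t) x := rfl

theorem C0Group.continuous_star (S : C0Group 𝕜 H) (x : H) :
    Continuous fun t : ℝ => S.star t x := by
  have := (S.dual.continuous_orbit x).comp continuous_neg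
  refine this.congr fun t => ?_
  simp [S.dual_apply]

theorem C0Group.integral_star (S : C0Group 𝕜 H) (φ : S.adjointGenerator.domain) (t : ℝ) :
    ∫ s in (0 : ℝ)..t, S.star s (S.adjointGenerator φ) = S.star t φ - φ := by
  have hc := S.continuous_star (S.adjointGenerator φ)
  refine ext_inner_right 𝕜 fun y => ?_
  have hy := S.continuous_orbit y
  rw [intervalIntegral_inner (hc.intervalIntegrable _ _), inner_sub_left,
    ContinuousLinearMap.adjoint_inner_left, ← inner_sub_right,
    ← S.inner_adjointGenerator φ (S.hasGeneratorValue_integral t y),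
    inner_intervalIntegral (hy.intervalIntegrable _ _)]
  simp only [ContinuousLinearMap.adjoint_inner_left]

theorem C0Group.hasDerivAt_star (S : C0Group 𝕜 H) (φ : S.adjointGenerator.domain) (t : ℝ) :
    HasDerivAt (fun s : ℝ => S.star s φ) (S.star t (S.adjointGenerator φ)) t := by
  have hc := S.continuous_star (S.adjointGenerator φ)
  have h1 : HasDerivAt (fun t : ℝ => ∫ s in (0 : ℝ)..t, S.star s (S.adjointGenerator φ))
      (S.star t (S.adjointGenerator φ)) t :=
    intervalIntegral.integral_hasDerivAt_right (hc.intervalIntegrable _ _)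
      (hc.stronglyMeasurableAtFilter _ _) hc.continuousAt
  refine (h1.add_const (φ : H)).congr_of_eventuallyEq (Eventually.of_forall fun s => ?_)
  simp [S.integral_star]

theorem C0Group.dual_hasGeneratorValue (S : C0Group 𝕜 H) (φ : S.adjointGenerator.domain) :
    S.dual.HasGeneratorValue φ (-S.adjointGenerator φ) := by
  rw [C0Group.hasGeneratorValue_iff_hasDerivAt]
  have h := S.hasDerivAt_star φ (-0)
  have h1 := HasDerivAt.comp_const_sub (f := fun s : ℝ => S.star s φ)
    (f' := S.star (-0) (S.adjointGenerator φ)) 0 0 (by simpa using h)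
  simpa [S.star_zero, S.dual_apply] using h1

/-- The pairing `⟨S(-t)^* x, S(t) y⟩` is constant in `t`; its derivative at `0` is the adjoint
relation. Thus the generator of the dual group is no larger than `-A^*`. -/
theorem C0Group.exists_adjoint_of_dual (S : C0Group 𝕜 H) {x w : H}
    (h : S.dual.HasGeneratorValue x w) :
    ∃ hx : x ∈ S.adjointGenerator.domain, S.adjointGenerator ⟨x, hx⟩ = -w := by
  have key : ∀ y : S.generator.domain, ⟪-w, (y : H)⟫_𝕜 = ⟪x, S.generator y⟫_𝕜 := by
    intro y
    have h1 := (C0Group.hasGeneratorValue_iff_hasDerivAt _).1 h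
    have h2 := (C0Group.hasGeneratorValue_iff_hasDerivAt _).1 (S.generator_spec y)
    have h3 := h1.inner 𝕜 h2
    have h4 : (fun t : ℝ => ⟪S.dual.toFun t x, S.toFun t y⟫_𝕜) = fun _ => ⟪x, (y : H)⟫_𝕜 := by
      funext t
      rw [S.dual_apply, ContinuousLinearMap.adjoint_inner_left, S.neg_apply_apply]
    rw [h4] at h3
    have h5 := h3.unique (hasDerivAt_const _ _)
    rw [C0Group.apply_zero, C0Group.apply_zero] at h5
    rw [inner_neg_left, neg_eq_iff_add_eq_zero, add_comm, h5]
  exact ⟨LinearPMap.mem_adjoint_domain_of_exists _ ⟨_, key⟩, S.adjointGenerator_eq_of _ key⟩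

end Adjoint


/-! ### One-sided calculus on a compact interval -/

section Calculus

variable {E : Type*} [NormedAddCommGroup E] [NormedSpace ℝ E]

theorem hasDerivWithinAt_zero_of_le {R : ℝ → E} {e : ℝ → ℝ} {s : Set ℝ} {t₀ : ℝ}
    (h : ∀ t ∈ s, ‖R t - R t₀‖ ≤ e t * |t - t₀|) (he : Tendsto e (𝓝[s] t₀) (𝓝 0)) :
    HasDerivWithinAt R 0 s t₀ := by
  rw [hasDerivWithinAt_iff_isLittleO, Asymptotics.isLittleO_iff]
  intro c hc
  filter_upwards [he.eventually_lt_const hc, self_mem_nhdsWithin] with t ht hts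
  rw [smul_zero, sub_zero, Real.norm_eq_abs]
  exact (h t hts).trans (mul_le_mul_of_nonneg_right ht.le (abs_nonneg _))

omit [NormedSpace ℝ E] in
theorem intervalIntegrable_of_Ioc {f : ℝ → E} {T a b : ℝ} (hf : IntegrableOn f (Ioc 0 T))
    (ha : a ∈ Icc 0 T) (hb : b ∈ Icc 0 T) : IntervalIntegrable f volume a b := by
  have h : IntervalIntegrable f volume 0 T :=
    (intervalIntegrable_iff_integrableOn_Ioc_of_le (ha.1.trans ha.2)).2 hf
  refine h.mono_set ?_
  rw [uIcc_of_le (ha.1.trans ha.2)]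
  exact ordConnected_Icc.uIcc_subset ha hb

omit [NormedSpace ℝ E] in
theorem ContinuousOn.integrableOn_Ioc {f : ℝ → E} {T : ℝ} (hf : ContinuousOn f (Icc 0 T)) :
    IntegrableOn f (Ioc 0 T) :=
  (hf.integrableOn_compact isCompact_Icc).mono_set Ioc_subset_Icc_self

omit [NormedSpace ℝ E] in
theorem intervalIntegrable_of_continuousOn {f : ℝ → E} {T a b : ℝ} (hf : ContinuousOn f (Icc 0 T))
    (ha : a ∈ Icc 0 T) (hb : b ∈ Icc 0 T) : IntervalIntegrable f volume a b :=
  intervalIntegrable_of_Ioc (ContinuousOn.integrableOn_Ioc hf) ha hb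

theorem hasDerivWithinAt_integral_Icc [CompleteSpace E] {f : ℝ → E} {T t : ℝ}
    (hf : ContinuousOn f (Icc 0 T)) (ht : t ∈ Icc 0 T) :
    HasDerivWithinAt (fun r => ∫ s in (0 : ℝ)..r, f s) (f t) (Icc 0 T) t := by
  haveI : Fact (t ∈ Icc 0 T) := ⟨ht⟩
  exact intervalIntegral.integral_hasDerivWithinAt_right
    (intervalIntegrable_of_continuousOn hf ⟨le_rfl, ht.1.trans ht.2⟩ ht)
    (hf.stronglyMeasurableAtFilter_nhdsWithin measurableSet_Icc t) (hf t ht)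

theorem integral_eq_sub_of_hasDerivWithinAt_Icc [CompleteSpace E] {f f' : ℝ → E} {T t : ℝ}
    (hf : ∀ s ∈ Icc 0 T, HasDerivWithinAt f (f' s) (Icc 0 T) s) (hf' : ContinuousOn f' (Icc 0 T))
    (ht : t ∈ Icc 0 T) : ∫ s in (0 : ℝ)..t, f' s = f t - f 0 := by
  refine intervalIntegral.integral_eq_sub_of_hasDerivAt_of_le ht.1
    (fun s hs => ((hf s ⟨hs.1, hs.2.trans ht.2⟩).continuousWithinAt).mono
      (Icc_subset_Icc_right ht.2)) (fun s hs => ?_)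
    (intervalIntegrable_of_continuousOn hf' ⟨le_rfl, ht.1.trans ht.2⟩ ht)
  exact (hf s ⟨hs.1.le, hs.2.le.trans ht.2⟩).hasDerivAt (Icc_mem_nhds hs.1 (hs.2.trans_le ht.2))

theorem eq_of_hasDerivWithinAt_zero {f : ℝ → E} {T t : ℝ}
    (hf : ∀ s ∈ Icc 0 T, HasDerivWithinAt f 0 (Icc 0 T) s) (ht : t ∈ Icc 0 T) : f t = f 0 := by
  have := (convex_Icc 0 T).norm_image_sub_le_of_norm_hasDerivWithin_le (C := 0) hf
    (fun _ _ => by simp) ⟨le_rfl, ht.1.trans ht.2⟩ ht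
  rw [zero_mul] at this
  exact sub_eq_zero.1 (norm_le_zero_iff.1 this)

end Calculus

/-! ### Weak solutions and the variation of constants formula -/

section WeakSolutions

variable {𝕜 : Type w} {H : Type u} {U : Type v} [RCLike 𝕜]
  [NormedAddCommGroup H] [InnerProductSpace 𝕜 H] [CompleteSpace H]
  [NormedAddCommGroup U] [InnerProductSpace 𝕜 U] [NormedSpace ℝ H] [IsScalarTower ℝ 𝕜 H]

omit [NormedSpace ℝ H] [IsScalarTower ℝ 𝕜 H] in
theorem C0Group.adjointOnDomain_coe (S : C0Group 𝕜 H) (t : ℝ) (φ : S.adjointGenerator.domain) :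
    ((S.adjointOnDomain t φ : S.adjointGenerator.domain) : H) = S.star t φ := rfl

theorem DomainOperator.exists_bound_sub {S : C0Group 𝕜 H} (B : ControlOperator S U) :
    ∃ C : ℝ, 0 ≤ C ∧ ∀ (φ : S.adjointGenerator.domain) (s t : ℝ),
      ‖B.toMap (S.adjointOnDomain t φ) - B.toMap (S.adjointOnDomain s φ)‖ ≤
        C * (‖S.star t φ - S.star s φ‖ +
          ‖S.star t (S.adjointGenerator φ) - S.star s (S.adjointGenerator φ)‖) := by
  obtain ⟨C, hC⟩ := B.bound
  refine ⟨max C 0, le_max_right _ _, fun φ s t => ?_⟩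
  rw [← map_sub]
  refine (hC _).trans ?_
  rw [LinearPMap.map_sub, S.adjointGenerator_adjointOnDomain, S.adjointGenerator_adjointOnDomain]
  exact mul_le_mul_of_nonneg_right (le_max_left _ _) (by positivity)

theorem DomainOperator.continuous_orbit {S : C0Group 𝕜 H} (B : ControlOperator S U)
    (φ : S.adjointGenerator.domain) :
    Continuous fun t : ℝ => B.toMap (S.adjointOnDomain t φ) := by
  obtain ⟨C, hC, hb⟩ := B.exists_bound_sub
  rw [continuous_iff_continuousAt]
  intro s
  rw [ContinuousAt, tendsto_iff_norm_sub_tendsto_zero]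
  have h1 := S.continuous_star (φ : H)
  have h2 := S.continuous_star (S.adjointGenerator φ)
  have h3 : Continuous fun t : ℝ => C * (‖S.star t φ - S.star s φ‖ +
      ‖S.star t (S.adjointGenerator φ) - S.star s (S.adjointGenerator φ)‖) := by fun_prop
  refine squeeze_zero (fun _ => norm_nonneg _) (fun t => hb φ s t) ?_
  simpa using h3.tendsto s

/-- The domain of the square of the adjoint generator. -/
def C0Group.adjointDomainSq (S : C0Group 𝕜 H) : Set H :=
  {x | ∃ h : x ∈ S.adjointGenerator.domain,
    S.adjointGenerator ⟨x, h⟩ ∈ S.adjointGenerator.domain}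

theorem C0Group.dense_adjointDomainSq (S : C0Group 𝕜 H) : Dense S.adjointDomainSq := by
  refine S.dual.dense_domain_sq.mono ?_
  rintro x ⟨y, z, hxy, hyz⟩
  obtain ⟨hx, hx'⟩ := S.exists_adjoint_of_dual hxy
  obtain ⟨hy, -⟩ := S.exists_adjoint_of_dual hyz
  exact ⟨hx, by rw [hx']; exact neg_mem hy⟩

/-- For `φ ∈ D(A^*²)` the dual orbits of both `φ` and `A^* φ` are locally Lipschitz, so the orbit of
`φ` is locally Lipschitz in the graph norm, in which `B^*` is bounded. -/
theorem DomainOperator.exists_lipschitz {S : C0Group 𝕜 H} (B : ControlOperator S U)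
    (φ : S.adjointGenerator.domain)
    (hφ : S.adjointGenerator φ ∈ S.adjointGenerator.domain) (T : ℝ) :
    ∃ C : ℝ, 0 ≤ C ∧ ∀ s t : ℝ, |s| ≤ T → |t| ≤ T →
      ‖B.toMap (S.adjointOnDomain t φ) - B.toMap (S.adjointOnDomain s φ)‖ ≤ C * |t - s| := by
  obtain ⟨C, hC, hb⟩ := B.exists_bound_sub
  obtain ⟨M, hM, hMb⟩ := S.exists_bound_Icc T
  refine ⟨C * (M * ‖S.adjointGenerator φ‖ + M * ‖S.adjointGenerator ⟨_, hφ⟩‖), by positivity,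
    fun s t hs ht => (hb φ s t).trans ?_⟩
  have hr : ∀ r ∈ uIcc s t, ‖S.toFun r‖ ≤ M := fun r hr =>
    hMb r (abs_le.2 (ordConnected_Icc.uIcc_subset (abs_le.1 hs) (abs_le.1 ht) hr))
  have h1 := S.norm_star_sub_le φ hr
  have h2 := S.norm_star_sub_le ⟨_, hφ⟩ hr
  rw [mul_assoc, add_mul]
  gcongr

theorem integrableOn_inner {b u : ℝ → U} {T : ℝ} (hb : Continuous b)
    (hu : IntegrableOn u (Ioc 0 T)) : IntegrableOn (fun s => ⟪b s, u s⟫_𝕜) (Ioc 0 T) := by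
  obtain ⟨C, hC⟩ := (isCompact_Icc (a := 0) (b := T)).exists_bound_of_continuousOn hb.continuousOn
  refine (hu.norm.const_mul C).mono'
    (hb.aestronglyMeasurable.inner hu.aestronglyMeasurable) ?_
  refine ae_restrict_of_forall_mem measurableSet_Ioc fun s hs => ?_
  exact (norm_inner_le_norm _ _).trans
    (mul_le_mul_of_nonneg_right (hC s (Ioc_subset_Icc_self hs)) (norm_nonneg _))

/-- The product rule is not directly available, since `y` is differentiable only against fixed test
vectors and `u` is only integrable. At each `t₀` the weak equation is used with the frozen test
vector `S(-t₀)^* φ`, and the error is shown to be of higher order. The derivative then exists at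
every point of the interval and is zero. -/
theorem IsWeakSolution.inner_star_neg {S : C0Group 𝕜 H}
    {B : ControlOperator S U} {T : ℝ}
    {u : ℝ → U} {y : ℝ → H} (hu : IntegrableOn u (Ioc 0 T))
    (hy : IsWeakSolution S T (fun φ s => ⟪B.toMap φ, u s⟫_𝕜) y)
    (φ : S.adjointGenerator.domain)
    (hφ : S.adjointGenerator φ ∈ S.adjointGenerator.domain) {t : ℝ} (ht : t ∈ Icc 0 T) :
    ⟪S.star (-t) φ, y t⟫_𝕜 = ⟪(φ : H), y 0⟫_𝕜 +
      ∫ s in (0 : ℝ)..t, ⟪B.toMap (S.adjointOnDomain (-s) φ), u s⟫_𝕜 := by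
  have hT : (0 : ℝ) ∈ Icc 0 T := ⟨le_rfl, ht.1.trans ht.2⟩
  set b : ℝ → U := fun s => B.toMap (S.adjointOnDomain (-s) φ) with hb
  have hbc : Continuous b := (B.continuous_orbit φ).comp continuous_neg
  have hbu : IntegrableOn (fun s => ⟪b s, u s⟫_𝕜) (Ioc 0 T) := integrableOn_inner hbc hu
  set p : ℝ → 𝕜 := fun t => ⟪S.star (-t) φ, y t⟫_𝕜 - ∫ s in (0 : ℝ)..t, ⟪b s, u s⟫_𝕜 with hp
  have key : ∀ t₀ ∈ Icc 0 T, HasDerivWithinAt p 0 (Icc 0 T) t₀ := by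
    intro t₀ ht₀
    set ψ := S.adjointOnDomain (-t₀) φ
    have hbu₀ : IntegrableOn (fun s => ⟪b t₀, u s⟫_𝕜) (Ioc 0 T) := hu.const_inner _
    have hyψ : ContinuousOn (fun s => ⟪S.adjointGenerator ψ, y s⟫_𝕜) (Icc 0 T) :=
      continuousOn_const.inner hy.continuousOn
    -- The first and third terms have opposite derivatives at `t₀`; the second and fourth are `o(|t
    -- - t₀|)`; the last is constant.
    have e : ∀ t ∈ Icc 0 T, p t = ⟪S.star (-t) φ, y t₀⟫_𝕜
        + ⟪S.star (-t) φ - S.star (-t₀) φ, y t - y t₀⟫_𝕜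
        + (∫ s in (0 : ℝ)..t, ⟪S.adjointGenerator ψ, y s⟫_𝕜)
        + (∫ s in (0 : ℝ)..t, ⟪b t₀ - b s, u s⟫_𝕜) 
        + (⟪(ψ : H), y 0⟫_𝕜 - ⟪(ψ : H), y t₀⟫_𝕜) := by
      intro t ht
      have h1 := hy.weak ψ t ht
      rw [intervalIntegral.integral_add (intervalIntegrable_of_continuousOn hyψ hT ht)
        (intervalIntegrable_of_Ioc hbu₀ hT ht)] at h1
      simp only [inner_sub_left, inner_sub_right, hp]
      rw [intervalIntegral.integral_sub (intervalIntegrable_of_Ioc hbu₀ hT ht)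
        (intervalIntegrable_of_Ioc hbu hT ht), ← S.adjointOnDomain_coe (-t₀), h1]
      ring
    have d1 : HasDerivWithinAt (fun t => ⟪S.star (-t) φ, y t₀⟫_𝕜)
        (-⟪S.adjointGenerator ψ, y t₀⟫_𝕜) (Icc 0 T) t₀ := by
      have h1 := HasDerivAt.scomp (h := fun t : ℝ => -t) t₀ (S.hasDerivAt_star φ (-t₀))
        (hasDerivAt_neg t₀)
      have h2 := h1.inner 𝕜 (hasDerivAt_const t₀ (y t₀))
      rw [S.adjointGenerator_adjointOnDomain]
      simpa using h2.hasDerivWithinAt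
    have d2 : HasDerivWithinAt (fun t => ⟪S.star (-t) φ - S.star (-t₀) φ, y t - y t₀⟫_𝕜)
        0 (Icc 0 T) t₀ := by
      obtain ⟨M, hM, hMb⟩ := S.exists_bound_Icc T
      refine hasDerivWithinAt_zero_of_le
        (e := fun t => M * ‖S.adjointGenerator φ‖ * ‖y t - y t₀‖) (fun t ht => ?_) ?_
      · rw [sub_self, inner_zero_left, sub_zero]
        refine (norm_inner_le_norm _ _).trans ?_
        have h1 : ‖S.star (-t) φ - S.star (-t₀) φ‖ ≤ M * ‖S.adjointGenerator φ‖ * |-t - -t₀| := by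
          refine S.norm_star_sub_le φ fun r hr => hMb r ?_
          have h3 : r ∈ Icc (-T) 0 := ordConnected_Icc.uIcc_subset
            (⟨by linarith [ht₀.2], by linarith [ht₀.1]⟩) (⟨by linarith [ht.2], by linarith [ht.1]⟩)
            hr
          rw [abs_le]
          exact ⟨h3.1, h3.2.trans (ht.1.trans ht.2)⟩
        rw [show -t - -t₀ = -(t - t₀) by ring, abs_neg] at h1
        calc _ ≤ M * ‖S.adjointGenerator φ‖ * |t - t₀| * ‖y t - y t₀‖ := by gcongr
          _ = _ := by ring
      · have h1 : ContinuousWithinAt (fun t => M * ‖S.adjointGenerator φ‖ * ‖y t - y t₀‖)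
            (Icc 0 T) t₀ :=
          continuousWithinAt_const.mul ((hy.continuousOn t₀ ht₀).sub continuousWithinAt_const).norm
        simpa [ContinuousWithinAt] using h1
    have d3 := hasDerivWithinAt_integral_Icc hyψ ht₀
    -- The Lipschitz bound on `b` estimates this integral by `C |t - t₀|` times `|∫_{t₀}^t ‖u‖|`,
    -- which is `o(|t - t₀|)` although `u` need not have Lebesgue points at `t₀`. This is where `φ ∈
    -- D(A^*²)` is needed.
    have d4 : HasDerivWithinAt (fun t => ∫ s in (0 : ℝ)..t, ⟪b t₀ - b s, u s⟫_𝕜)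
        0 (Icc 0 T) t₀ := by
      obtain ⟨C, hC, hCb⟩ := B.exists_lipschitz φ hφ T
      have hu' : IntegrableOn (fun s => ‖u s‖) (Ioc 0 T) := hu.norm
      have hbs : IntegrableOn (fun s => ⟪b t₀ - b s, u s⟫_𝕜) (Ioc 0 T) :=
        integrableOn_inner (continuous_const.sub hbc) hu
      refine hasDerivWithinAt_zero_of_le (e := fun t => C * |(∫ s in (0 : ℝ)..t, ‖u s‖) -
        ∫ s in (0 : ℝ)..t₀, ‖u s‖|) (fun t ht => ?_) ?_
      · rw [intervalIntegral.integral_interval_sub_left (intervalIntegrable_of_Ioc hbs hT ht)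
          (intervalIntegrable_of_Ioc hbs hT ht₀),
          intervalIntegral.integral_interval_sub_left (intervalIntegrable_of_Ioc hu' hT ht)
          (intervalIntegrable_of_Ioc hu' hT ht₀)]
        refine (intervalIntegral.norm_integral_le_abs_of_norm_le (g := fun s => C * |t - t₀| * ‖u s‖)
          ?_ ((intervalIntegrable_of_Ioc hu' ht₀ ht).const_mul _)).trans (le_of_eq ?_)
        · refine ae_restrict_of_forall_mem measurableSet_uIoc fun s hs => ?_
          have hs' := uIoc_subset_uIcc hs
          have hs'' : s ∈ Icc 0 T := ordConnected_Icc.uIcc_subset ht₀ ht hs'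
          refine (norm_inner_le_norm _ _).trans ?_
          gcongr
          refine (hCb (-s) (-t₀) ?_ ?_).trans ?_
          · rw [abs_neg, abs_of_nonneg hs''.1]; exact hs''.2
          · rw [abs_neg, abs_of_nonneg ht₀.1]; exact ht₀.2
          · gcongr C * ?_
            rw [show -t₀ - -s = s - t₀ by ring]
            exact abs_sub_left_of_mem_uIcc hs'
        · rw [intervalIntegral.integral_const_mul, abs_mul, abs_of_nonneg (by positivity)]
          ring
      · have h0 : uIcc 0 T = Icc 0 T := uIcc_of_le hT.2
        have h1 : ContinuousOn (fun t => ∫ s in (0 : ℝ)..t, ‖u s‖) (Icc 0 T) := by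
          have := intervalIntegral.continuousOn_primitive_interval (a := 0) (b := T)
            (μ := volume) (f := fun s => ‖u s‖) (by
              rw [h0, integrableOn_Icc_iff_integrableOn_Ioc]; exact hu')
          rwa [h0] at this
        have h2 := continuousWithinAt_const (b := C).mul
          ((h1 t₀ ht₀).sub (continuousWithinAt_const (b := ∫ s in (0 : ℝ)..t₀, ‖u s‖))).abs
        simpa [ContinuousWithinAt, Pi.mul_def] using h2
    have d := ((((d1.add d2).add d3).add d4).add_const
      (⟪(ψ : H), y 0⟫_𝕜 - ⟪(ψ : H), y t₀⟫_𝕜)).congr e (e t₀ ht₀)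
    simpa using d
  have := eq_of_hasDerivWithinAt_zero key ht
  simp only [hp, intervalIntegral.integral_same, neg_zero, S.star_zero, sub_zero] at this
  rw [← this]
  ring

theorem IsWeakSolution.hasDerivWithinAt {S : C0Group 𝕜 H} {T : ℝ} {h y : ℝ → H}
    (hh : ContinuousOn h (Icc 0 T))
    (hy : IsWeakSolution S T (fun φ s => ⟪(φ : H), h s⟫_𝕜) y) {t : ℝ} (ht : t ∈ Icc 0 T) :
    HasDerivWithinAt (fun s => S.toFun (-s) (y s)) (S.toFun (-t) (h t)) (Icc 0 T) t := by
  -- A continuous forcing is a control with `U = H` and `B^*` the inclusion of `D(A^*)` in `H`.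
  let B : ControlOperator S H :=
    { toMap := S.adjointGenerator.domain.subtype
      bound := ⟨1, fun x => by simp⟩ }
  have hc : ContinuousOn (fun s => S.toFun (-s) (h s)) (Icc 0 T) :=
    S.continuousOn_apply continuous_neg.continuousOn hh
  have key : ∀ t ∈ Icc 0 T, S.toFun (-t) (y t) = y 0 + ∫ s in (0 : ℝ)..t, S.toFun (-s) (h s) := by
    intro t ht
    refine S.dense_adjointDomainSq.eq_of_inner_right 𝕜 ?_
    rintro φ ⟨hφ, hφ'⟩
    have := IsWeakSolution.inner_star_neg (B := B) (ContinuousOn.integrableOn_Ioc hh) hy ⟨φ, hφ⟩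
      hφ' ht
    rw [ContinuousLinearMap.adjoint_inner_left] at this
    rw [this, inner_add_right, inner_intervalIntegral
      (intervalIntegrable_of_continuousOn hc ⟨le_rfl, ht.1.trans ht.2⟩ ht)]
    congr 1
    refine intervalIntegral.integral_congr fun s _ => ?_
    exact ContinuousLinearMap.adjoint_inner_left _ _ _
  exact ((hasDerivWithinAt_integral_Icc hc ht).const_add (y 0)).congr key (key t ht)

theorem isWeakSolution_of_hasDerivWithinAt {S : C0Group 𝕜 H} {T : ℝ} {h y : ℝ → H}
    (hyc : ContinuousOn y (Icc 0 T)) (hh : ContinuousOn h (Icc 0 T))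
    (hy : ∀ t ∈ Icc 0 T,
      HasDerivWithinAt (fun s => S.toFun (-s) (y s)) (S.toFun (-t) (h t)) (Icc 0 T) t) :
    IsWeakSolution S T (fun φ s => ⟪(φ : H), h s⟫_𝕜) y where
  continuousOn := hyc
  integrable φ := ContinuousOn.integrableOn_Ioc (continuousOn_const.inner hh)
  weak φ t ht := by
    have hc : ContinuousOn (fun s => ⟪S.adjointGenerator φ, y s⟫_𝕜 + ⟪(φ : H), h s⟫_𝕜)
        (Icc 0 T) := (continuousOn_const.inner hyc).add (continuousOn_const.inner hh)
    rw [integral_eq_sub_of_hasDerivWithinAt_Icc (f := fun s => ⟪(φ : H), y s⟫_𝕜) (fun s hs => ?_)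
      hc ht]
    · ring
    have h1 := ((S.hasDerivAt_star φ s).hasDerivWithinAt (s := Icc 0 T)).inner 𝕜 (hy s hs)
    simp only [ContinuousLinearMap.adjoint_inner_left, S.apply_neg_apply] at h1
    rwa [add_comm] at h1

end WeakSolutions


/-! ### Uniform boundedness by duality, and inner products in `L²` -/

section L2

variable {𝕜 : Type w} {E : Type u} {U : Type v} {α : Type*} [RCLike 𝕜]
  [NormedAddCommGroup E] [InnerProductSpace 𝕜 E]
  [NormedAddCommGroup U] [InnerProductSpace 𝕜 U] [MeasurableSpace α] {μ : Measure α}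

/-- Banach–Steinhaus for the functionals defined by `v i / N i`. Where `N i = 0`, the hypothesis
forces `v i = 0`. This turns both admissibility and controllability, which concern individual
controls or states, into uniform inequalities for the dual output. -/
theorem exists_norm_le_mul_of_inner [CompleteSpace E] {ι : Type*} (v : ι → E) (N : ι → ℝ)
    (hN : ∀ i, 0 ≤ N i) (h : ∀ x : E, ∃ C, ∀ i, ‖⟪v i, x⟫_𝕜‖ ≤ C * N i) :
    ∃ C : ℝ, 0 ≤ C ∧ ∀ i, ‖v i‖ ≤ C * N i := by
  obtain ⟨C, hC⟩ := banach_steinhaus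
    (g := fun i => innerSL 𝕜 ((((N i)⁻¹ : ℝ) : 𝕜) • v i)) (fun x => by
      obtain ⟨C, hC⟩ := h x
      refine ⟨max C 0, fun i => ?_⟩
      rw [innerSL_apply_apply, inner_smul_left, norm_mul, RCLike.norm_conj, RCLike.norm_ofReal,
        abs_of_nonneg (inv_nonneg.2 (hN i))]
      rcases (hN i).eq_or_lt with h0 | h0
      · rw [← h0]; simp
      · rw [inv_mul_le_iff₀ h0, mul_comm]
        exact (hC i).trans (mul_le_mul_of_nonneg_right (le_max_left _ _) h0.le))
  refine ⟨max C 0, le_max_right _ _, fun i => ?_⟩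
  rcases (hN i).eq_or_lt with h0 | h0
  · have : v i = 0 := by
      refine ext_inner_right 𝕜 fun x => ?_
      obtain ⟨C, hC⟩ := h x
      have := hC i
      rw [← h0, mul_zero] at this
      rw [norm_le_zero_iff.1 this, inner_zero_left]
    rw [this, ← h0]; simp
  · have := hC i
    rw [innerSL_apply_norm, norm_smul, RCLike.norm_ofReal, abs_of_nonneg (inv_nonneg.2 (hN i)),
      inv_mul_le_iff₀ h0, mul_comm] at this
    exact this.trans (mul_le_mul_of_nonneg_right (le_max_left _ _) h0.le)

theorem inner_toLp_left {f : α → U} (hf : MemLp f 2 μ) (g : Lp U 2 μ) :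
    ⟪hf.toLp f, g⟫_𝕜 = ∫ a, ⟪f a, g a⟫_𝕜 ∂μ := by
  rw [L2.inner_def]
  refine integral_congr_ae ?_
  filter_upwards [hf.coeFn_toLp] with a ha
  rw [ha]

theorem inner_toLp_toLp {f g : α → U} (hf : MemLp f 2 μ) (hg : MemLp g 2 μ) :
    ⟪hf.toLp f, hg.toLp g⟫_𝕜 = ∫ a, ⟪f a, g a⟫_𝕜 ∂μ := by
  rw [inner_toLp_left]
  refine integral_congr_ae ?_
  filter_upwards [hg.coeFn_toLp] with a ha
  rw [ha]

theorem memLp_Ioc_of_continuous {f : ℝ → U} (hf : Continuous f) (T : ℝ) :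
    MemLp f 2 (volume.restrict (Ioc 0 T)) := by
  obtain ⟨C, hC⟩ := (isCompact_Icc (a := 0) (b := T)).exists_bound_of_continuousOn hf.continuousOn
  exact MemLp.of_bound hf.aestronglyMeasurable C
    (ae_restrict_of_forall_mem measurableSet_Ioc fun s hs => hC s (Ioc_subset_Icc_self hs))

end L2

theorem norm_toLp_sq (𝕜 : Type w) {U : Type v} {α : Type*} [RCLike 𝕜] [NormedAddCommGroup U]
    [InnerProductSpace 𝕜 U] [MeasurableSpace α] {μ : Measure α} {f : α → U} (hf : MemLp f 2 μ) :
    ‖hf.toLp f‖ ^ 2 = ∫ a, ‖f a‖ ^ 2 ∂μ := by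
  have h := inner_toLp_toLp (𝕜 := 𝕜) hf hf
  simp only [inner_self_eq_norm_sq_to_K] at h
  have h2 : ∫ a, ((‖f a‖ : 𝕜)) ^ 2 ∂μ = ((∫ a, ‖f a‖ ^ 2 ∂μ : ℝ) : 𝕜) := by
    rw [← integral_ofReal]
    simp
  rw [h2] at h
  exact_mod_cast h

/-! ### Dual inequalities: admissibility and observability of `B^* S(-s)^*` -/

section Observability

variable {𝕜 : Type w} {H : Type u} {U : Type v} [RCLike 𝕜]
  [NormedAddCommGroup H] [InnerProductSpace 𝕜 H] [CompleteSpace H]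
  [NormedAddCommGroup U] [InnerProductSpace 𝕜 U] [CompleteSpace U]
  [NormedSpace ℝ H] [IsScalarTower ℝ 𝕜 H]
  {S : C0Group 𝕜 H} {B : ControlOperator S U}

omit [NormedSpace ℝ H] [IsScalarTower ℝ 𝕜 H] in
theorem C0Group.adjointOnDomain_add (S : C0Group 𝕜 H) (s t : ℝ)
    (φ : S.adjointGenerator.domain) :
    S.adjointOnDomain (s + t) φ = S.adjointOnDomain s (S.adjointOnDomain t φ) :=
  Subtype.ext (S.star_apply_add s t φ)

/-- The dual output `s ↦ B^* S(-s)^* φ`. -/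
def DomainOperator.dualOutput (B : ControlOperator S U) (φ : S.adjointGenerator.domain) (s : ℝ) :
    U :=
  B.toMap (S.adjointOnDomain (-s) φ)

omit [CompleteSpace U] in
theorem DomainOperator.continuous_dualOutput (B : ControlOperator S U)
    (φ : S.adjointGenerator.domain) : Continuous (B.dualOutput φ) :=
  (B.continuous_orbit φ).comp continuous_neg

omit [CompleteSpace U] in
omit [NormedSpace ℝ H] [IsScalarTower ℝ 𝕜 H] in
theorem DomainOperator.dualOutput_zero (B : ControlOperator S U)
    (φ : S.adjointGenerator.domain) : B.dualOutput φ 0 = B.toMap φ := by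
  rw [DomainOperator.dualOutput]
  congr 1
  exact Subtype.ext (by rw [S.adjointOnDomain_coe, neg_zero, S.star_zero])

omit [CompleteSpace U] in
omit [NormedSpace ℝ H] [IsScalarTower ℝ 𝕜 H] in
theorem DomainOperator.dualOutput_shift (B : ControlOperator S U)
    (φ : S.adjointGenerator.domain) (s t : ℝ) :
    B.dualOutput (S.adjointOnDomain (-t) φ) s = B.dualOutput φ (s + t) := by
  rw [DomainOperator.dualOutput, DomainOperator.dualOutput, neg_add, S.adjointOnDomain_add]

theorem IsAdmissibleControl.exists_bound (hB : IsAdmissibleControl S B) {T : ℝ} (hT : 0 < T) :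
    ∃ C : ℝ, 0 ≤ C ∧ ∀ φ : S.adjointGenerator.domain,
      ∫ s in (0 : ℝ)..T, ‖B.dualOutput φ s‖ ^ 2 ≤ C * ‖(φ : H)‖ ^ 2 := by
  obtain ⟨C, hC, hb⟩ := exists_norm_le_mul_of_inner (𝕜 := 𝕜)
    (fun φ : S.adjointGenerator.domain =>
      (memLp_Ioc_of_continuous (B.continuous_dualOutput φ) T).toLp (B.dualOutput φ))
    (fun φ => ‖(φ : H)‖) (fun _ => norm_nonneg _) (fun u => by
      obtain ⟨Φ, -, hΦ⟩ := hB T hT u (Lp.memLp u)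
      refine ⟨‖S.star (-T)‖ * ‖Φ T‖, fun φ => ?_⟩
      -- Testing with `S(-T)^* φ` turns `S(T - s)^*` into `S(-s)^*`, so that the value at the single
      -- time `T` pairs `u` with the dual output.
      have h1 := hΦ T ⟨hT.le, le_rfl⟩ (S.adjointOnDomain (-T) φ)
      have h2 : ∀ s, B.toMap (S.adjointOnDomain (T - s) (S.adjointOnDomain (-T) φ)) =
          B.dualOutput φ s := fun s => by
        rw [← S.adjointOnDomain_add, DomainOperator.dualOutput]
        congr 3; ring
      simp only [h2] at h1
      rw [inner_toLp_left, ← intervalIntegral.integral_of_le hT.le, ← h1]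
      refine (norm_inner_le_norm _ _).trans ?_
      have := (S.star (-T)).le_opNorm (φ : H)
      rw [S.adjointOnDomain_coe]
      calc _ ≤ ‖S.star (-T)‖ * ‖(φ : H)‖ * ‖Φ T‖ := by gcongr
        _ = _ := by ring)
  refine ⟨C ^ 2, by positivity, fun φ => ?_⟩
  rw [intervalIntegral.integral_of_le hT.le,
    ← norm_toLp_sq 𝕜 (memLp_Ioc_of_continuous (B.continuous_dualOutput φ) T), ← mul_pow]
  exact pow_le_pow_left₀ (norm_nonneg _) (hb φ) 2

omit [CompleteSpace U] in
theorem IsExactlyControllableIn.exists_bound {T : ℝ} (hT : 0 < T)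
    (hc : IsExactlyControllableIn S B T) :
    ∃ C : ℝ, 0 ≤ C ∧ ∀ φ : S.adjointGenerator.domain, (φ : H) ∈ S.adjointDomainSq →
      ‖(φ : H)‖ ^ 2 ≤ C * ∫ s in (0 : ℝ)..T, ‖B.dualOutput φ s‖ ^ 2 := by
  obtain ⟨C, hC, hb⟩ := exists_norm_le_mul_of_inner (𝕜 := 𝕜)
    (fun φ : {φ : S.adjointGenerator.domain // (φ : H) ∈ S.adjointDomainSq} => ((φ : _) : H))
    (fun φ => ‖(memLp_Ioc_of_continuous (B.continuous_dualOutput φ.1) T).toLp (B.dualOutput φ.1)‖)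
    (fun _ => norm_nonneg _) (fun x => by
      -- Steering `x` to `0` gives `⟨φ, x⟩ = -∫_0^T ⟨B^* S(-s)^* φ, u(s)⟩ ds`, hence a bound by the
      -- norm of the dual output.
      obtain ⟨u, hu, y, hy, hy0, hyT⟩ := hc x 0
      refine ⟨‖hu.toLp u‖, fun φ => ?_⟩
      obtain ⟨h, h'⟩ := φ.2
      have h1 := hy.inner_star_neg (hu.integrable one_le_two) φ.1 h' ⟨hT.le, le_rfl⟩
      rw [hyT, hy0, inner_zero_right, intervalIntegral.integral_of_le hT.le] at h1
      have h2 := inner_toLp_toLp (𝕜 := 𝕜) (memLp_Ioc_of_continuous (B.continuous_dualOutput φ.1) T) hu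
      have h3 : ⟪((φ : _) : H), x⟫_𝕜 = -⟪(memLp_Ioc_of_continuous (B.continuous_dualOutput φ.1) T).toLp
          (B.dualOutput φ.1), hu.toLp u⟫_𝕜 := by
        rw [h2]; exact eq_neg_of_add_eq_zero_left h1.symm
      rw [h3, norm_neg, mul_comm]
      exact norm_inner_le_norm _ _)
  refine ⟨C ^ 2, by positivity, fun φ hφ => ?_⟩
  rw [intervalIntegral.integral_of_le hT.le,
    ← norm_toLp_sq 𝕜 (memLp_Ioc_of_continuous (B.continuous_dualOutput φ) T), ← mul_pow]
  exact pow_le_pow_left₀ (norm_nonneg _) (hb ⟨φ, hφ⟩) 2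

end Observability


/-! ### The weighted Gramian: convergence, Lyapunov equation, coercivity -/

section Gramian

variable {𝕜 : Type w} {H : Type u} {U : Type v} [RCLike 𝕜]
  [NormedAddCommGroup H] [InnerProductSpace 𝕜 H] [CompleteSpace H]
  [NormedAddCommGroup U] [InnerProductSpace 𝕜 U] [CompleteSpace U]
  [NormedSpace ℝ H] [IsScalarTower ℝ 𝕜 H]
  {S : C0Group 𝕜 H} {B : ControlOperator S U}

/-- The weighted dual output `s ↦ e^{-cs} B^* S(-s)^* φ` on `(0, ∞)`. -/
def DomainOperator.weightedOutput (B : ControlOperator S U) (c : ℝ)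
    (φ : S.adjointGenerator.domain) : ℝ → U :=
  (Ioi (0 : ℝ)).indicator fun s => ((Real.exp (-c * s) : ℝ) : 𝕜) • B.dualOutput φ s

omit [CompleteSpace U] in
theorem DomainOperator.continuous_weighted (B : ControlOperator S U) (c : ℝ)
    (φ : S.adjointGenerator.domain) :
    Continuous fun s => ((Real.exp (-c * s) : ℝ) : 𝕜) • B.dualOutput φ s :=
  (RCLike.continuous_ofReal.comp (by fun_prop)).smul (B.continuous_dualOutput φ)

omit [CompleteSpace U] in
theorem norm_exp_smul_sq (c s : ℝ) (x : U) :
    ‖((Real.exp (-c * s) : ℝ) : 𝕜) • x‖ ^ 2 = Real.exp (-(2 * c) * s) * ‖x‖ ^ 2 := by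
  rw [norm_smul, RCLike.norm_ofReal, abs_of_pos (Real.exp_pos _), mul_pow, ← Real.exp_nat_mul]
  congr 2
  push_cast
  ring

omit [CompleteSpace U] [NormedSpace ℝ H] [IsScalarTower ℝ 𝕜 H] in
theorem DomainOperator.weightedOutput_add (B : ControlOperator S U) (c : ℝ)
    (φ ψ : S.adjointGenerator.domain) (s : ℝ) :
    B.weightedOutput c (φ + ψ) s = B.weightedOutput c φ s + B.weightedOutput c ψ s := by
  have : S.adjointOnDomain (-s) (φ + ψ) = S.adjointOnDomain (-s) φ + S.adjointOnDomain (-s) ψ :=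
    Subtype.ext (map_add (S.star (-s)) (φ : H) ψ)
  simp only [DomainOperator.weightedOutput, DomainOperator.dualOutput, indicator]
  split_ifs
  · rw [this, map_add, smul_add]
  · rw [add_zero]

omit [CompleteSpace U] [NormedSpace ℝ H] [IsScalarTower ℝ 𝕜 H] in
theorem DomainOperator.weightedOutput_smul (B : ControlOperator S U) (c : ℝ) (a : 𝕜)
    (φ : S.adjointGenerator.domain) (s : ℝ) :
    B.weightedOutput c (a • φ) s = a • B.weightedOutput c φ s := by
  have : S.adjointOnDomain (-s) (a • φ) = a • S.adjointOnDomain (-s) φ :=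
    Subtype.ext (map_smul (S.star (-s)) a (φ : H))
  simp only [DomainOperator.weightedOutput, DomainOperator.dualOutput, indicator]
  split_ifs
  · rw [this, map_smul, smul_comm]
  · rw [smul_zero]

/-- Splitting off the unit interval and translating by `1` replaces `φ` by `S(-1)^* φ` and gains the
factor `e^{-2c}`; the hypothesis on `c` makes this step a contraction by `1/2`, so the bound does
not depend on `n`. -/
theorem IsAdmissibleControl.exists_bound_weighted (hB : IsAdmissibleControl S B) {c : ℝ}
    (hc : Real.exp (-(2 * c)) * ‖S.toFun (-1)‖ ^ 2 ≤ 1 / 2) :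
    ∃ C : ℝ, 0 ≤ C ∧ ∀ (n : ℕ) (φ : S.adjointGenerator.domain),
      ∫ s in (0 : ℝ)..n, Real.exp (-(2 * c) * s) * ‖B.dualOutput φ s‖ ^ 2 ≤ C * ‖(φ : H)‖ ^ 2 := by
  obtain ⟨C, hC, hb⟩ := hB.exists_bound one_pos
  set w := Real.exp (|2 * c|)
  have hw : 0 < w := Real.exp_pos _
  -- `w` bounds the weight on `[0, 1]`, and `2 w C` is the fixed point of `x ↦ w C + x / 2`.
  refine ⟨2 * (w * C), by positivity, fun n => ?_⟩
  have hcont : ∀ φ, Continuous fun s => Real.exp (-(2 * c) * s) * ‖B.dualOutput φ s‖ ^ 2 :=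
    fun φ => (by fun_prop : Continuous fun s : ℝ => Real.exp (-(2 * c) * s)).mul
      ((B.continuous_dualOutput φ).norm.pow 2)
  induction n with
  | zero => intro φ; simp; positivity
  | succ n ih =>
    intro φ
    rw [← intervalIntegral.integral_add_adjacent_intervals (b := 1)
      ((hcont φ).intervalIntegrable _ _) ((hcont φ).intervalIntegrable _ _)]
    have h1 : ∫ s in (0 : ℝ)..1, Real.exp (-(2 * c) * s) * ‖B.dualOutput φ s‖ ^ 2 ≤
        w * (C * ‖(φ : H)‖ ^ 2) := by
      refine le_trans ?_ (mul_le_mul_of_nonneg_left (hb φ) hw.le)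
      rw [← intervalIntegral.integral_const_mul]
      refine intervalIntegral.integral_mono_on zero_le_one ((hcont φ).intervalIntegrable _ _)
        ((continuous_const.mul ((B.continuous_dualOutput φ).norm.pow 2)).intervalIntegrable _ _)
        fun s hs => ?_
      gcongr
      refine Real.exp_le_exp.2 ?_
      have h3 : |-(2 * c) * s| ≤ |2 * c| := by
        rw [abs_mul, abs_neg, abs_of_nonneg hs.1]
        exact mul_le_of_le_one_right (abs_nonneg _) hs.2
      exact (le_abs_self _).trans h3
    have h2 : ∫ s in (1 : ℝ)..(n + 1 : ℕ), Real.exp (-(2 * c) * s) * ‖B.dualOutput φ s‖ ^ 2 =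
        Real.exp (-(2 * c)) * ∫ s in (0 : ℝ)..n, Real.exp (-(2 * c) * s) *
          ‖B.dualOutput (S.adjointOnDomain (-1) φ) s‖ ^ 2 := by
      have := intervalIntegral.integral_comp_add_right (a := 0) (b := n)
        (fun s => Real.exp (-(2 * c) * s) * ‖B.dualOutput φ s‖ ^ 2) 1
      rw [zero_add] at this
      push_cast
      rw [← this, ← intervalIntegral.integral_const_mul]
      refine intervalIntegral.integral_congr fun s _ => ?_
      simp only [B.dualOutput_shift]
      rw [← mul_assoc, ← Real.exp_add]
      congr 2
      ring
    rw [h2]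
    have h3 := ih (S.adjointOnDomain (-1) φ)
    have h4 : ‖S.star (-1) φ‖ ^ 2 ≤ ‖S.toFun (-1)‖ ^ 2 * ‖(φ : H)‖ ^ 2 := by
      rw [← mul_pow, ← S.norm_star]
      exact pow_le_pow_left₀ (norm_nonneg _) ((S.star (-1)).le_opNorm _) 2
    rw [S.adjointOnDomain_coe] at h3
    calc _ ≤ w * (C * ‖(φ : H)‖ ^ 2) + Real.exp (-(2 * c)) *
          (2 * (w * C) * (‖S.toFun (-1)‖ ^ 2 * ‖(φ : H)‖ ^ 2)) := by
            gcongr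
            exact h3.trans (by gcongr)
      _ = w * (C * ‖(φ : H)‖ ^ 2) + (Real.exp (-(2 * c)) * ‖S.toFun (-1)‖ ^ 2) *
          (2 * (w * C) * ‖(φ : H)‖ ^ 2) := by ring
      _ ≤ w * (C * ‖(φ : H)‖ ^ 2) + 1 / 2 * (2 * (w * C) * ‖(φ : H)‖ ^ 2) := by gcongr
      _ = _ := by ring

theorem IsAdmissibleControl.exists_weighted (hB : IsAdmissibleControl S B) {c : ℝ}
    (hc : Real.exp (-(2 * c)) * ‖S.toFun (-1)‖ ^ 2 ≤ 1 / 2) :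
    ∃ C : ℝ, 0 ≤ C ∧ ∀ φ : S.adjointGenerator.domain, MemLp (B.weightedOutput c φ) 2 volume ∧
      ∫ s, ‖B.weightedOutput c φ s‖ ^ 2 ≤ C * ‖(φ : H)‖ ^ 2 := by
  obtain ⟨C, hC, hb⟩ := hB.exists_bound_weighted hc
  refine ⟨C, hC, fun φ => ?_⟩
  have hcont : Continuous fun s => Real.exp (-(2 * c) * s) * ‖B.dualOutput φ s‖ ^ 2 :=
    (by fun_prop : Continuous fun s : ℝ => Real.exp (-(2 * c) * s)).mul
      ((B.continuous_dualOutput φ).norm.pow 2)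
  have hint : IntegrableOn (fun s => Real.exp (-(2 * c) * s) * ‖B.dualOutput φ s‖ ^ 2)
      (Ioi 0) := by
    refine integrableOn_Ioi_of_intervalIntegral_norm_bounded (l := atTop) (b := fun n : ℕ => (n : ℝ))
      (C * ‖(φ : H)‖ ^ 2) 0 (fun n => hcont.integrableOn_Ioc) tendsto_natCast_atTop_atTop
      (Eventually.of_forall fun n => ?_)
    refine le_trans (le_of_eq ?_) (hb n φ)
    refine intervalIntegral.integral_congr fun s _ => ?_
    simp only [Real.norm_eq_abs]
    exact abs_of_nonneg (by positivity)
  constructor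
  · rw [DomainOperator.weightedOutput, memLp_indicator_iff_restrict measurableSet_Ioi,
      memLp_two_iff_integrable_sq_norm (B.continuous_weighted c φ).aestronglyMeasurable]
    simp only [norm_exp_smul_sq]
    exact hint
  · have e : ∀ s, ‖B.weightedOutput c φ s‖ ^ 2 = (Ioi (0 : ℝ)).indicator
        (fun s => Real.exp (-(2 * c) * s) * ‖B.dualOutput φ s‖ ^ 2) s := by
      intro s
      rw [DomainOperator.weightedOutput]
      by_cases hs : s ∈ Ioi (0 : ℝ)
      · rw [indicator_of_mem hs, indicator_of_mem hs, norm_exp_smul_sq]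
      · rw [indicator_of_notMem hs, indicator_of_notMem hs]; simp
    simp only [e]
    rw [integral_indicator measurableSet_Ioi]
    exact le_of_tendsto' (intervalIntegral_tendsto_integral_Ioi 0 hint
      tendsto_natCast_atTop_atTop) fun n => hb n φ

theorem IsAdmissibleControl.exists_outputMap (hB : IsAdmissibleControl S B) {c : ℝ}
    (hc : Real.exp (-(2 * c)) * ‖S.toFun (-1)‖ ^ 2 ≤ 1 / 2) :
    ∃ Q : H →L[𝕜] Lp U 2 (volume : Measure ℝ), ∀ φ : S.adjointGenerator.domain,
      ∃ h : MemLp (B.weightedOutput c φ) 2 volume, Q φ = h.toLp (B.weightedOutput c φ) := by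
  obtain ⟨C, hC, hb⟩ := hB.exists_weighted hc
  let Q₀ : S.adjointGenerator.domain →ₗ[𝕜] Lp U 2 (volume : Measure ℝ) :=
    { toFun := fun φ => (hb φ).1.toLp _
      map_add' := fun φ ψ => by
        rw [← MemLp.toLp_add]
        exact MemLp.toLp_congr _ _ (Eventually.of_forall fun s => B.weightedOutput_add c φ ψ s)
      map_smul' := fun a φ => by
        rw [RingHom.id_apply, ← MemLp.toLp_const_smul]
        exact MemLp.toLp_congr _ _ (Eventually.of_forall fun s => B.weightedOutput_smul c a φ s) }
  have hQ : ∃ C', ∀ φ, ‖Q₀ φ‖ ≤ C' * ‖S.adjointGenerator.domain.subtype φ‖ := by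
    refine ⟨√C, fun φ => ?_⟩
    refine abs_le_of_sq_le_sq' ?_ (by positivity) |>.2
    rw [mul_pow, Real.sq_sqrt hC]
    refine (norm_toLp_sq 𝕜 (hb φ).1).le.trans (hb φ).2
  have hd : DenseRange S.adjointGenerator.domain.subtype := by
    simpa [DenseRange] using S.dense_adjoint_domain
  exact ⟨Q₀.extendOfNorm S.adjointGenerator.domain.subtype, fun φ =>
    ⟨(hb φ).1, LinearMap.extendOfNorm_eq hd hQ φ⟩⟩

/-- `Q` is the extension to `H` of the weighted output map `φ ↦ e^{-cs} B^* S(-s)^* φ`. -/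
def IsOutputMap (B : ControlOperator S U) (c : ℝ) (Q : H →L[𝕜] Lp U 2 (volume : Measure ℝ)) :
    Prop :=
  ∀ φ : S.adjointGenerator.domain,
    ∃ h : MemLp (B.weightedOutput c φ) 2 volume, Q φ = h.toLp (B.weightedOutput c φ)

omit [CompleteSpace U] [NormedSpace ℝ H] [IsScalarTower ℝ 𝕜 H] in
theorem IsOutputMap.inner_eq {c : ℝ} {Q : H →L[𝕜] Lp U 2 (volume : Measure ℝ)}
    (hQ : IsOutputMap B c Q) (φ ψ : S.adjointGenerator.domain) :
    ⟪Q φ, Q ψ⟫_𝕜 = ∫ s in Ioi (0 : ℝ),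
      ((Real.exp (-(2 * c) * s) : ℝ) : 𝕜) * ⟪B.dualOutput φ s, B.dualOutput ψ s⟫_𝕜 := by
  obtain ⟨h, e⟩ := hQ φ
  obtain ⟨h', e'⟩ := hQ ψ
  rw [e, e', inner_toLp_toLp, ← integral_indicator measurableSet_Ioi]
  congr 1
  funext s
  simp only [DomainOperator.weightedOutput, indicator]
  split_ifs
  · rw [inner_smul_left, inner_smul_right, RCLike.conj_ofReal, ← mul_assoc, ← RCLike.ofReal_mul,
      ← Real.exp_add]
    congr 3
    ring
  · rw [inner_zero_left]

omit [CompleteSpace U] [NormedSpace ℝ H] [IsScalarTower ℝ 𝕜 H] in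
theorem IsOutputMap.integrableOn {c : ℝ} {Q : H →L[𝕜] Lp U 2 (volume : Measure ℝ)}
    (hQ : IsOutputMap B c Q) (φ ψ : S.adjointGenerator.domain) :
    IntegrableOn (fun s => ((Real.exp (-(2 * c) * s) : ℝ) : 𝕜) *
      ⟪B.dualOutput φ s, B.dualOutput ψ s⟫_𝕜) (Ioi 0) := by
  obtain ⟨h, -⟩ := hQ φ
  obtain ⟨h', -⟩ := hQ ψ
  rw [← integrable_indicator_iff measurableSet_Ioi]
  refine (L2.integrable_inner (𝕜 := 𝕜) (h.toLp _) (h'.toLp _)).congr ?_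
  filter_upwards [h.coeFn_toLp, h'.coeFn_toLp] with s hs hs'
  rw [hs, hs']
  simp only [DomainOperator.weightedOutput, indicator]
  split_ifs
  · rw [inner_smul_left, inner_smul_right, RCLike.conj_ofReal, ← mul_assoc, ← RCLike.ofReal_mul,
      ← Real.exp_add]
    congr 3
    ring
  · rw [inner_zero_left]

omit [CompleteSpace U] in
-- On outputs, `e^{-ct} S(-t)^*` acts as left translation by `t` cut off to `(0, ∞)`: exactly the
-- part of the pairing carried by `(0, t)` is lost.
theorem IsOutputMap.inner_shift {c : ℝ} {Q : H →L[𝕜] Lp U 2 (volume : Measure ℝ)}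
    (hQ : IsOutputMap B c Q) (φ ψ : S.adjointGenerator.domain) {t : ℝ} (ht : 0 ≤ t) :
    ⟪Q ((S.dual.scale (-c)).toFun t φ), Q ((S.dual.scale (-c)).toFun t ψ)⟫_𝕜 = ⟪Q φ, Q ψ⟫_𝕜 -
      ∫ s in (0 : ℝ)..t, ((Real.exp (-(2 * c) * s) : ℝ) : 𝕜) *
        ⟪B.dualOutput φ s, B.dualOutput ψ s⟫_𝕜 := by
  rw [S.dual.scale_apply, S.dual.scale_apply, map_smul, map_smul, inner_smul_left,
    inner_smul_right, S.dual_apply, S.dual_apply, ← S.adjointOnDomain_coe, ← S.adjointOnDomain_coe,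
    hQ.inner_eq, hQ.inner_eq, ← intervalIntegral.integral_Ioi_sub_Ioi (hQ.integrableOn φ ψ) ht,
    sub_sub_cancel, ← mul_assoc, RCLike.conj_ofReal, ← RCLike.ofReal_mul, ← Real.exp_add,
    ← integral_const_mul, ← integral_indicator measurableSet_Ioi,
    ← integral_indicator measurableSet_Ioi]
  refine Eq.trans ?_ (integral_add_right_eq_self _ t)
  congr 1
  funext s
  simp only [indicator, mem_Ioi, lt_add_iff_pos_left]
  split_ifs
  · rw [B.dualOutput_shift, B.dualOutput_shift, ← mul_assoc, ← RCLike.ofReal_mul, ← Real.exp_add]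
    congr 3
    ring
  · rfl

omit [CompleteSpace H] in
theorem C0Group.HasGeneratorValue.of_scale {S : C0Group 𝕜 H} {x w : H} {c : ℝ}
    (h : (S.scale c).HasGeneratorValue x w) : S.HasGeneratorValue x (w - c • x) := by
  have h1 := h.scale (-c)
  rw [neg_smul, ← sub_eq_add_neg] at h1
  refine h1.congr fun t => ?_
  rw [C0Group.scale_apply, C0Group.scale_apply, smul_smul, ← RCLike.ofReal_mul, ← Real.exp_add,
    neg_mul, neg_add_cancel, Real.exp_zero, RCLike.ofReal_one, one_smul]

omit [CompleteSpace U] in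
-- Both sides of the shift identity are differentiated at `t = 0`: one by the product rule, the
-- other by the fundamental theorem of calculus. The derivative is from the right, because the
-- identity requires `t ≥ 0`.
theorem IsOutputMap.inner_derivative {c : ℝ} {Q : H →L[𝕜] Lp U 2 (volume : Measure ℝ)}
    (hQ : IsOutputMap B c Q) (φ ψ : S.adjointGenerator.domain) :
    ⟪Q φ, Q (-S.adjointGenerator ψ + (-c) • (ψ : H))⟫_𝕜 +
      ⟪Q (-S.adjointGenerator φ + (-c) • (φ : H)), Q ψ⟫_𝕜 = -⟪B.toMap φ, B.toMap ψ⟫_𝕜 := by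
  letI : NormedSpace ℝ U := NormedSpace.restrictScalars ℝ 𝕜 U
  have hd : ∀ φ : S.adjointGenerator.domain, HasDerivAt
      (fun t => Q ((S.dual.scale (-c)).toFun t φ)) (Q (-S.adjointGenerator φ + (-c) • (φ : H))) 0 :=
    fun φ => by
      have := (C0Group.hasGeneratorValue_iff_hasDerivAt _).1
        ((S.dual_hasGeneratorValue φ).scale (-c))
      exact (Q.restrictScalars ℝ).hasFDerivAt.comp_hasDerivAt 0 this
  have h1 := ((hd φ).inner 𝕜 (hd ψ)).hasDerivWithinAt (s := Ici 0)
  have hc : Continuous fun s => ((Real.exp (-(2 * c) * s) : ℝ) : 𝕜) *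
      ⟪B.dualOutput φ s, B.dualOutput ψ s⟫_𝕜 :=
    (RCLike.continuous_ofReal.comp (by fun_prop)).mul
      ((B.continuous_dualOutput φ).inner (B.continuous_dualOutput ψ))
  have h2 := (intervalIntegral.integral_hasDerivAt_right (hc.intervalIntegrable 0 0)
    (hc.stronglyMeasurableAtFilter _ _) hc.continuousAt).const_sub ⟪Q φ, Q ψ⟫_𝕜
  have h3 := (h2.hasDerivWithinAt (s := Ici 0)).congr
    (fun t ht => hQ.inner_shift φ ψ ht) (hQ.inner_shift φ ψ le_rfl)
  have h4 := (uniqueDiffOn_Ici (0 : ℝ) 0 self_mem_Ici).eq_deriv _ h1 h3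
  simpa [C0Group.apply_zero, B.dualOutput_zero] using h4

/-- The Lyapunov equation of the Gramian `Q^* Q`. -/
theorem IsOutputMap.lyapunov {c : ℝ} {Q : H →L[𝕜] Lp U 2 (volume : Measure ℝ)}
    (hQ : IsOutputMap B c Q) (φ ψ : S.adjointGenerator.domain) :
    ⟪(φ : H), (ContinuousLinearMap.adjoint Q ∘L Q)
      (-S.adjointGenerator ψ + (-(2 * c)) • (ψ : H))⟫_𝕜 =
    ⟪S.adjointGenerator φ, (ContinuousLinearMap.adjoint Q ∘L Q) ψ⟫_𝕜 -
      ⟪B.toMap φ, B.toMap ψ⟫_𝕜 := by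
  -- The two contributions `-c`, one from each slot, add up to the `-2c` acting on `ψ`.
  have h := hQ.inner_derivative φ ψ
  simp only [ContinuousLinearMap.comp_apply, ContinuousLinearMap.adjoint_inner_right]
  simp only [← ofReal_smul_eq (𝕜 := 𝕜), map_add, map_smul, map_neg, inner_add_left,
    inner_add_right, inner_neg_left, inner_neg_right, inner_smul_left, inner_smul_right,
    RCLike.conj_ofReal, RCLike.ofReal_neg, RCLike.ofReal_mul, RCLike.ofReal_ofNat] at h ⊢
  linear_combination h

omit [CompleteSpace U] in
-- Observability in time `T` already suffices, because on `(0, T)` the weight is bounded below and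
-- the rest of the half-line only increases `‖Q x‖`. The inequality is known on `D(A^*²)` and
-- extends by density.
theorem IsOutputMap.coercive {c : ℝ} {Q : H →L[𝕜] Lp U 2 (volume : Measure ℝ)}
    (hQ : IsOutputMap B c Q) {T : ℝ} (hT : 0 < T) (hctrl : IsExactlyControllableIn S B T) :
    ∃ κ : ℝ, 0 < κ ∧ ∀ x : H, κ * ‖x‖ ^ 2 ≤ ‖Q x‖ ^ 2 := by
  obtain ⟨C, hC, hb⟩ := hctrl.exists_bound hT
  set w := Real.exp (-(|2 * c| * T))
  have hw : 0 < w := Real.exp_pos _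
  refine ⟨w / (C + 1), by positivity, fun x => ?_⟩
  refine S.dense_adjointDomainSq.induction (P := fun x => w / (C + 1) * ‖x‖ ^ 2 ≤ ‖Q x‖ ^ 2) ?_
    (isClosed_le (by fun_prop) (by fun_prop)) x
  rintro x hx
  obtain ⟨φ, rfl⟩ : ∃ φ : S.adjointGenerator.domain, (φ : H) = x := ⟨⟨x, hx.1⟩, rfl⟩
  have h1 := hb φ hx
  obtain ⟨h, e⟩ := hQ φ
  have hcont : Continuous fun s => Real.exp (-(2 * c) * s) * ‖B.dualOutput φ s‖ ^ 2 :=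
    (by fun_prop : Continuous fun s : ℝ => Real.exp (-(2 * c) * s)).mul
      ((B.continuous_dualOutput φ).norm.pow 2)
  have h2 : ∫ s in (0 : ℝ)..T, Real.exp (-(2 * c) * s) * ‖B.dualOutput φ s‖ ^ 2 ≤ ‖Q φ‖ ^ 2 := by
    rw [e, norm_toLp_sq 𝕜, intervalIntegral.integral_of_le hT.le,
      ← integral_indicator measurableSet_Ioc]
    refine integral_mono_of_nonneg (Eventually.of_forall fun s => ?_)
      ((memLp_two_iff_integrable_sq_norm h.1).1 h) (Eventually.of_forall fun s => ?_)
    · exact indicator_nonneg (fun s _ => by positivity) s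
    · simp only [DomainOperator.weightedOutput]
      by_cases hs : s ∈ Ioc 0 T
      · rw [indicator_of_mem hs, indicator_of_mem (show s ∈ Ioi (0 : ℝ) from hs.1),
          norm_exp_smul_sq]
      · rw [indicator_of_notMem hs]; positivity
  have h3 : w * ∫ s in (0 : ℝ)..T, ‖B.dualOutput φ s‖ ^ 2 ≤
      ∫ s in (0 : ℝ)..T, Real.exp (-(2 * c) * s) * ‖B.dualOutput φ s‖ ^ 2 := by
    rw [← intervalIntegral.integral_const_mul]
    refine intervalIntegral.integral_mono_on hT.le
      ((continuous_const.mul ((B.continuous_dualOutput φ).norm.pow 2)).intervalIntegrable _ _)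
      (hcont.intervalIntegrable _ _) fun s hs => ?_
    gcongr
    refine Real.exp_le_exp.2 (neg_le.1 ?_)
    refine (neg_le_abs _).trans ?_
    rw [abs_mul, abs_neg, abs_of_nonneg hs.1]
    exact mul_le_mul_of_nonneg_left hs.2 (abs_nonneg _)
  have hI : 0 ≤ ∫ s in (0 : ℝ)..T, ‖B.dualOutput φ s‖ ^ 2 :=
    intervalIntegral.integral_nonneg hT.le fun s _ => by positivity
  rw [div_mul_eq_mul_div, div_le_iff₀ (by positivity)]
  nlinarith [mul_le_mul_of_nonneg_left h1 hw.le, mul_le_mul_of_nonneg_right (h3.trans h2) hC,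
    sq_nonneg ‖Q φ‖]

/-- Lax–Milgram for the coercive form `⟨Q x, Q y⟩`. -/
theorem IsOutputMap.exists_inverse {c : ℝ} {Q : H →L[𝕜] Lp U 2 (volume : Measure ℝ)}
    (hQ : IsOutputMap B c Q) {T : ℝ} (hT : 0 < T) (hctrl : IsExactlyControllableIn S B T) :
    ∃ R : H →L[𝕜] H, ∀ x, (ContinuousLinearMap.adjoint Q ∘L Q) (R x) = x := by
  obtain ⟨κ, hκ, hb⟩ := hQ.coercive hT hctrl
  obtain ⟨R, hR⟩ := (ContinuousLinearMap.isUnit_of_forall_le_norm_inner_map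
    (ContinuousLinearMap.adjoint Q ∘L Q) (c := ⟨κ, hκ.le⟩) hκ fun x => by
      rw [ContinuousLinearMap.comp_apply, ContinuousLinearMap.adjoint_inner_left,
        inner_self_eq_norm_sq_to_K, norm_pow, RCLike.norm_ofReal, abs_norm, mul_comm]
      exact hb x).exists_right_inv
  refine ⟨R, fun x => ?_⟩
  simpa using congrArg (fun L : H →L[𝕜] H => L x) hR

end Gramian


/-! ### Invertible generators and transport of solutions by an intertwining operator -/

section StableGroups

theorem intervalIntegrable_const_inner {𝕜 : Type w} {E : Type u} [RCLike 𝕜]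
    [NormedAddCommGroup E] [InnerProductSpace 𝕜 E] {f : ℝ → E} {a b : ℝ}
    (hf : IntervalIntegrable f volume a b) (x : E) :
    IntervalIntegrable (fun s => ⟪x, f s⟫_𝕜) volume a b :=
  ⟨Integrable.const_inner x hf.1, Integrable.const_inner x hf.2⟩

variable {𝕜 : Type w} {H : Type u} {U : Type v} [RCLike 𝕜]
  [NormedAddCommGroup H] [InnerProductSpace 𝕜 H] [CompleteSpace H]
  [NormedAddCommGroup U] [InnerProductSpace 𝕜 U]
  [NormedSpace ℝ H] [IsScalarTower ℝ 𝕜 H] {G : C0Group 𝕜 H}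

/-- The generator sends `∫_0^1 G(s) x ds` to `G(1) x - x`, and `1 - G(1)` is invertible by the
Neumann series; so the inverse is `-∫_0^1 G(s) ds (1 - G(1))^{-1}`. A vector in the kernel of the
generator is fixed by `G(1)`, hence zero. -/
theorem C0Group.exists_generator_inverse (G : C0Group 𝕜 H) (hG : ‖G.toFun 1‖ < 1) :
    ∃ L : H →L[𝕜] H, (∀ w, G.HasGeneratorValue (L w) w) ∧
      ∀ x w, G.HasGeneratorValue x w → L w = x := by
  obtain ⟨V, hV⟩ := isUnit_one_sub_of_norm_lt_one hG
  have hV' : ∀ x, (V : H →L[𝕜] H) x = x - G.toFun 1 x := fun x => by rw [hV]; rfl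
  have h1 : ∀ w, (V : H →L[𝕜] H) ((↑V⁻¹ : H →L[𝕜] H) w) = w := fun w =>
    congrArg (fun L : H →L[𝕜] H => L w) V.mul_inv
  have h2 : ∀ w, (↑V⁻¹ : H →L[𝕜] H) ((V : H →L[𝕜] H) w) = w := fun w =>
    congrArg (fun L : H →L[𝕜] H => L w) V.inv_mul
  have key : ∀ w, G.HasGeneratorValue ((G.integralCLM 1 ∘L (-↑V⁻¹ : H →L[𝕜] H)) w) w := fun w => by
    have := G.hasGeneratorValue_integral 1 ((-↑V⁻¹ : H →L[𝕜] H) w)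
    rw [← neg_sub, ← hV', _root_.neg_apply, map_neg, neg_neg, h1] at this
    exact this
  refine ⟨_, key, fun x w hx => ?_⟩
  set y := (G.integralCLM 1 ∘L (-↑V⁻¹ : H →L[𝕜] H)) w
  have h3 := (key w).add (hx.smul (-1))
  rw [neg_smul, one_smul, neg_smul, one_smul, add_neg_cancel] at h3
  have h4 := C0Group.integral_orbit h3 1
  simp only [_root_.map_zero, intervalIntegral.integral_zero] at h4
  have h5 : (V : H →L[𝕜] H) (y + -x) = 0 := by rw [hV', ← neg_sub, ← h4, neg_zero]
  have h6 := h2 (y + -x)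
  rw [h5, _root_.map_zero] at h6
  exact eq_of_sub_eq_zero (by rw [sub_eq_add_neg, ← h6])

/-- `J` is `K` composed with the inverse of the generator, bounded because `K` is bounded in the
graph norm. It allows `K` to be moved through vector integrals. -/
theorem DomainOperator.exists_factor (K : DomainOperator G.generator U)
    (hG : ‖G.toFun 1‖ < 1) :
    ∃ J : H →L[𝕜] U, ∀ x : G.generator.domain, K.toMap x = J (G.generator x) := by
  obtain ⟨L, hL, hL'⟩ := G.exists_generator_inverse hG
  obtain ⟨C, hC⟩ := K.bound
  let L' : H →ₗ[𝕜] G.generator.domain := (L : H →ₗ[𝕜] H).codRestrict _ fun w => ⟨w, hL w⟩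
  have hL'' : ∀ w, G.generator (L' w) = w := fun w => C0Group.generator_eq_of (hL w) ⟨w, hL w⟩
  refine ⟨LinearMap.mkContinuousOfExistsBound (K.toMap ∘ₗ L') ⟨max C 0 * (‖L‖ + 1), fun w => ?_⟩,
    fun x => ?_⟩
  · refine (hC (L' w)).trans ?_
    rw [hL'', mul_assoc, add_mul, one_mul]
    exact mul_le_mul (le_max_left _ _) (add_le_add_left (L.le_opNorm w) _) (by positivity)
      (le_max_right _ _)
  · change K.toMap x = K.toMap (L' (G.generator x))
    congr 1
    exact Subtype.ext (hL' x _ (G.generator_spec x)).symm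

/-- With `L` the inverse of the generator, every `ψ` equals the adjoint generator applied to `L^*
ψ`. Using `L^* ψ` as test vector in the weak equation yields `∫ z = L w` against all `ψ`. -/
theorem IsWeakSolution.hasGeneratorValue_integral (hG : ‖G.toFun 1‖ < 1) {T : ℝ} {g z : ℝ → H}
    (hg : ContinuousOn g (Icc 0 T))
    (hz : IsWeakSolution G T (fun φ s => ⟪(φ : H), g s⟫_𝕜) z) {t : ℝ} (ht : t ∈ Icc 0 T) :
    G.HasGeneratorValue (∫ s in (0 : ℝ)..t, z s) (z t - z 0 - ∫ s in (0 : ℝ)..t, g s) := by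
  have hT : (0 : ℝ) ∈ Icc 0 T := ⟨le_rfl, ht.1.trans ht.2⟩
  obtain ⟨L, hL, hL'⟩ := G.exists_generator_inverse hG
  set w := z t - z 0 - ∫ s in (0 : ℝ)..t, g s
  have key : L w = ∫ s in (0 : ℝ)..t, z s := by
    refine ext_inner_left 𝕜 fun ψ => ?_
    have h1 : ∀ y : G.generator.domain, ⟪ψ, (y : H)⟫_𝕜 =
        ⟪ContinuousLinearMap.adjoint L ψ, G.generator y⟫_𝕜 := fun y => by
      rw [ContinuousLinearMap.adjoint_inner_left, hL' _ _ (G.generator_spec y)]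
    set φ : G.adjointGenerator.domain := ⟨ContinuousLinearMap.adjoint L ψ,
      LinearPMap.mem_adjoint_domain_of_exists _ ⟨_, h1⟩⟩
    have h2 : G.adjointGenerator φ = ψ := G.adjointGenerator_eq_of φ h1
    have h3 := hz.weak φ t ht
    have hzi := intervalIntegrable_of_continuousOn hz.continuousOn hT ht
    have hgi := intervalIntegrable_of_continuousOn hg hT ht
    rw [intervalIntegral.integral_add (intervalIntegrable_const_inner hzi _)
      (intervalIntegrable_const_inner hgi _), ← inner_intervalIntegral hzi,
      ← inner_intervalIntegral hgi, h2] at h3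
    rw [← ContinuousLinearMap.adjoint_inner_left]
    change ⟪(φ : H), w⟫_𝕜 = _
    rw [inner_sub_right, inner_sub_right, h3]
    ring
  rw [← key]
  exact hL w

theorem IsOutput.inner_factor {K : DomainOperator G.generator U} (hG : ‖G.toFun 1‖ < 1)
    {T : ℝ} {g z : ℝ → H} {u : ℝ → U}
    (hg : ContinuousOn g (Icc 0 T))
    (hz : IsWeakSolution G T (fun φ s => ⟪(φ : H), g s⟫_𝕜) z) (hu : IsOutput G K T z u)
    {t : ℝ} (ht : t ∈ Icc 0 T) (η : U) :
    ∃ x : G.generator.domain, (x : H) = ∫ s in (0 : ℝ)..t, z s ∧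
      G.generator x = z t - z 0 - ∫ s in (0 : ℝ)..t, g s ∧
      ⟪η, K.toMap x⟫_𝕜 = ∫ s in (0 : ℝ)..t, ⟪η, u s⟫_𝕜 := by
  obtain ⟨x, hx, hx'⟩ := hu.2 t ht
  have e : (x : H) = ∫ s in (0 : ℝ)..t, z s := ext_inner_left 𝕜 fun ξ => by
    rw [hx, inner_intervalIntegral (intervalIntegrable_of_continuousOn hz.continuousOn
      ⟨le_rfl, ht.1.trans ht.2⟩ ht)]
  refine ⟨x, e, ?_, hx' η⟩
  have h := hz.hasGeneratorValue_integral hG hg ht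
  rw [← e] at h
  exact C0Group.generator_eq_of h x.2

/-- If `P` intertwines the auxiliary system with the control system, it maps solutions of the
former to solutions of the latter. -/
theorem IsOutput.isWeakSolution_map {S : C0Group 𝕜 H} {B : ControlOperator S U}
    {K : DomainOperator G.generator U} (hG : ‖G.toFun 1‖ < 1)
    {P : H →L[𝕜] H} (hP : ∀ (φ : S.adjointGenerator.domain) (x : G.generator.domain),
      ⟪(φ : H), P (G.generator x)⟫_𝕜 = ⟪S.adjointGenerator φ, P x⟫_𝕜 +
        ⟪B.toMap φ, K.toMap x⟫_𝕜)
    {T : ℝ} {g z : ℝ → H} {u : ℝ → U}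
    (hg : ContinuousOn g (Icc 0 T))
    (hz : IsWeakSolution G T (fun φ s => ⟪(φ : H), g s⟫_𝕜) z) (hu : IsOutput G K T z u) :
    IsWeakSolution S T (fun φ s => ⟪(φ : H), P (g s)⟫_𝕜 + ⟪B.toMap φ, u s⟫_𝕜)
      (fun s => P (z s)) := by
  have hPz : ContinuousOn (fun s => P (z s)) (Icc 0 T) := P.continuous.comp_continuousOn
    hz.continuousOn
  have hPg : ContinuousOn (fun s => P (g s)) (Icc 0 T) := P.continuous.comp_continuousOn hg
  have hui : IntegrableOn u (Ioc 0 T) := hu.1.integrable one_le_two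
  refine ⟨hPz, fun φ => (ContinuousOn.integrableOn_Ioc (continuousOn_const.inner hPg)).add
    (hui.const_inner _), fun φ t ht => ?_⟩
  have hT : (0 : ℝ) ∈ Icc 0 T := ⟨le_rfl, ht.1.trans ht.2⟩
  -- The intertwining relation is applied to `x = ∫_0^t z`, which lies in the domain of the
  -- generator although the values `z(s)` need not.
  obtain ⟨x, hx, hx', hK⟩ := hu.inner_factor hG hg hz ht (B.toMap φ)
  have h := hP φ x
  have hzi := intervalIntegrable_of_continuousOn hz.continuousOn hT ht
  have hgi := intervalIntegrable_of_continuousOn hg hT ht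
  have hPzi := intervalIntegrable_of_continuousOn hPz hT ht
  have hPgi := intervalIntegrable_of_continuousOn hPg hT ht
  have hBu : IntervalIntegrable (fun s => ⟪B.toMap φ, u s⟫_𝕜) volume 0 t :=
    intervalIntegrable_of_Ioc (hui.const_inner _) hT ht
  have i1 : IntervalIntegrable (fun s => ⟪S.adjointGenerator φ, P (z s)⟫_𝕜) volume 0 t :=
    intervalIntegrable_const_inner hPzi _
  have i2 : IntervalIntegrable (fun s => ⟪(φ : H), P (g s)⟫_𝕜) volume 0 t :=
    intervalIntegrable_const_inner hPgi _
  rw [intervalIntegral.integral_add i1 (i2.add hBu), intervalIntegral.integral_add i2 hBu,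
    ← inner_intervalIntegral hPzi, ← inner_intervalIntegral hPgi, ← hK,
    P.intervalIntegral_comp_comm hzi, P.intervalIntegral_comp_comm hgi, ← hx]
  rw [hx', map_sub, map_sub, inner_sub_right, inner_sub_right] at h
  linear_combination h

/-! ### Outputs of forced solutions as `L²`-valued integrals -/

/-- Right translation on `L²(ℝ; U)`. -/
def shiftL2 (U : Type v) [NormedAddCommGroup U] (τ : ℝ) :
    Lp U 2 (volume : Measure ℝ) →+ Lp U 2 (volume : Measure ℝ) :=
  Lp.compMeasurePreserving (fun s : ℝ => s - τ) (measurePreserving_sub_right volume τ)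

theorem continuousOn_shiftL2 {f : ℝ → Lp U 2 (volume : Measure ℝ)} {s : Set ℝ}
    (hf : ContinuousOn f s) : ContinuousOn (fun τ => shiftL2 U τ (f τ)) s := by
  let g : ℝ → C(ℝ, ℝ) := fun τ => ⟨fun s => s - τ, by fun_prop⟩
  have hg : Continuous g := ContinuousMap.continuous_of_continuous_uncurry _ (by
    simp only [Function.uncurry_def]
    change Continuous fun p : ℝ × ℝ => p.2 - p.1
    fun_prop)
  exact hf.compMeasurePreservingLp hg.continuousOn
    (fun τ => measurePreserving_sub_right volume τ) (by norm_num)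

/-- `Ψ` is the extension to `H` of the output map `x ↦ K G(·) x` on `(0, ∞)`. -/
def IsExtendedOutput (K : DomainOperator G.generator U)
    (Ψ : H →L[𝕜] Lp U 2 (volume : Measure ℝ)) : Prop :=
  ∀ x : G.generator.domain,
    Ψ x =ᵐ[volume] (Ioi (0 : ℝ)).indicator fun s => K.toMap (G.onDomain s x)

/-- On the domain, `K G(s) x = J G(s) (generator x)` integrates to `J (G(·) x - x)`; density gives
the rest. The maximum with `0` covers `τ ≥ t`, where the translated output vanishes on `(0, t]` and
the right-hand side is zero. -/
theorem IsExtendedOutput.inner_shift [CompleteSpace U]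
    {K : DomainOperator G.generator U} {Ψ : H →L[𝕜] Lp U 2 (volume : Measure ℝ)}
    (hΨ : IsExtendedOutput K Ψ) {J : H →L[𝕜] U}
    (hJ : ∀ x : G.generator.domain, K.toMap x = J (G.generator x)) {t τ : ℝ} (ht : 0 ≤ t)
    (hτ : 0 ≤ τ) (η : U) (x : H) :
    ⟪indicatorConstLp 2 (measurableSet_Ioc (a := (0 : ℝ)) (b := t)) (by simp) η,
      shiftL2 U τ (Ψ x)⟫_𝕜 = ⟪η, J (G.toFun (max (t - τ) 0) x - x)⟫_𝕜 := by
  refine G.dense_domain.induction (P := fun x =>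
    ⟪indicatorConstLp 2 (measurableSet_Ioc (a := (0 : ℝ)) (b := t)) (by simp) η,
      shiftL2 U τ (Ψ x)⟫_𝕜 = ⟪η, J (G.toFun (max (t - τ) 0) x - x)⟫_𝕜) ?_
    (isClosed_eq ?_ (by fun_prop)) x
  · intro x hx
    have h1 := (measurePreserving_sub_right (volume : Measure ℝ) τ).quasiMeasurePreserving.ae_eq_comp
      (hΨ ⟨x, hx⟩)
    have h2 := Lp.coeFn_compMeasurePreserving (Ψ x) (measurePreserving_sub_right volume τ)
    rw [L2.inner_indicatorConstLp_eq_setIntegral_inner]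
    have h3 : ∫ s in Ioc 0 t, ⟪η, shiftL2 U τ (Ψ x) s⟫_𝕜 =
        ∫ s in Ioc 0 t, (Ioi τ).indicator (fun s => ⟪η, J (G.toFun (s - τ) (G.generator ⟨x, hx⟩))⟫_𝕜) s := by
      refine integral_congr_ae (ae_restrict_of_ae ?_)
      filter_upwards [h1, h2] with s hs hs'
      rw [shiftL2, hs', hs]
      simp only [Function.comp_apply, indicator, mem_Ioi, sub_pos]
      split_ifs
      · rw [hJ, G.generator_onDomain]
      · rw [inner_zero_right]
    rw [h3, setIntegral_indicator measurableSet_Ioi]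
    rw [Ioc_inter_Ioi, max_eq_right hτ]
    rcases le_total τ t with h | h
    · letI : NormedSpace ℝ U := NormedSpace.restrictScalars ℝ 𝕜 U
      have hc : Continuous fun s => G.toFun s (G.generator ⟨x, hx⟩) := G.continuous_orbit _
      have hJc : Continuous fun s => J (G.toFun s (G.generator ⟨x, hx⟩)) := J.continuous.comp hc
      rw [← intervalIntegral.integral_of_le h, max_eq_left (sub_nonneg.2 h),
        intervalIntegral.integral_comp_sub_right
          (fun s => ⟪η, J (G.toFun s (G.generator ⟨x, hx⟩))⟫_𝕜) τ, sub_self,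
        ← inner_intervalIntegral (hJc.intervalIntegrable _ _),
        J.intervalIntegral_comp_comm (hc.intervalIntegrable _ _),
        C0Group.integral_orbit (G.generator_spec ⟨x, hx⟩)]
    · rw [Ioc_eq_empty (not_lt.2 h), setIntegral_empty, max_eq_right (sub_nonpos.2 h),
        G.apply_zero, sub_self, _root_.map_zero, inner_zero_right]
  · exact continuous_const.inner
      ((Lp.isometry_compMeasurePreserving _).continuous.comp Ψ.continuous)

/-- The output of a solution with continuous forcing exists. -/
theorem IsExtendedOutput.exists_isOutput [CompleteSpace U]
    {K : DomainOperator G.generator U} {Ψ : H →L[𝕜] Lp U 2 (volume : Measure ℝ)}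
    (hΨ : IsExtendedOutput K Ψ) (hG : ‖G.toFun 1‖ < 1) {T : ℝ} {g z : ℝ → H}
    (hg : ContinuousOn g (Icc 0 T))
    (hz : IsWeakSolution G T (fun φ s => ⟪(φ : H), g s⟫_𝕜) z) :
    ∃ u, IsOutput G K T z u := by
  letI : NormedSpace ℝ U := NormedSpace.restrictScalars ℝ 𝕜 U
  obtain ⟨J, hJ⟩ := K.exists_factor hG
  have hΨg : ContinuousOn (fun τ => shiftL2 U τ (Ψ (g τ))) (Icc 0 T) :=
    continuousOn_shiftL2 (Ψ.continuous.comp_continuousOn hg)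
  -- Variation of constants on the level of outputs: a forcing impulse at time `τ` contributes its
  -- free output delayed by `τ`. Integrating up to `T` is harmless, as only `τ < t` is visible on
  -- `(0, t]`.
  set v : Lp U 2 (volume : Measure ℝ) := shiftL2 U 0 (Ψ (z 0)) +
    ∫ τ in (0 : ℝ)..T, shiftL2 U τ (Ψ (g τ))
  refine ⟨v, (Lp.memLp v).restrict _, fun t ht => ?_⟩
  have hT : (0 : ℝ) ∈ Icc 0 T := ⟨le_rfl, ht.1.trans ht.2⟩
  have hTT : T ∈ Icc 0 T := ⟨ht.1.trans ht.2, le_rfl⟩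
  have hx := hz.hasGeneratorValue_integral hG hg ht
  refine ⟨⟨∫ s in (0 : ℝ)..t, z s, hx.mem⟩, fun ξ => inner_intervalIntegral
    (intervalIntegrable_of_continuousOn hz.continuousOn hT ht) ξ, fun η => ?_⟩
  rw [hJ, C0Group.generator_eq_of hx,
    intervalIntegral.integral_of_le (f := fun s => ⟪η, v s⟫_𝕜) ht.1,
    ← L2.inner_indicatorConstLp_eq_setIntegral_inner 𝕜 v measurableSet_Ioc η (by simp),
    inner_add_right, hΨ.inner_shift hJ ht.1 le_rfl,
    inner_intervalIntegral (intervalIntegrable_of_continuousOn hΨg hT hTT)]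
  have hc : ContinuousOn (fun τ => J (G.toFun (max (t - τ) 0) (g τ) - g τ)) (Icc 0 T) :=
    J.continuous.comp_continuousOn ((G.continuousOn_apply (by fun_prop) hg).sub hg)
  have hc' : ContinuousOn (fun τ => G.toFun (t - τ) (g τ)) (Icc 0 T) :=
    G.continuousOn_apply (by fun_prop) hg
  have e1 : ∫ τ in (0 : ℝ)..T, ⟪indicatorConstLp 2 (measurableSet_Ioc (a := (0 : ℝ)) (b := t))
      (by simp) η, shiftL2 U τ (Ψ (g τ))⟫_𝕜 =
      ⟪η, J ((∫ τ in (0 : ℝ)..t, G.toFun (t - τ) (g τ)) - ∫ τ in (0 : ℝ)..t, g τ)⟫_𝕜 := by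
    have h1 : ∫ τ in (0 : ℝ)..T, ⟪indicatorConstLp 2
        (measurableSet_Ioc (a := (0 : ℝ)) (b := t)) (by simp) η, shiftL2 U τ (Ψ (g τ))⟫_𝕜 =
        ∫ τ in (0 : ℝ)..T, ⟪η, J (G.toFun (max (t - τ) 0) (g τ) - g τ)⟫_𝕜 := by
      refine intervalIntegral.integral_congr fun τ hτ => ?_
      rw [uIcc_of_le hT.2] at hτ
      exact hΨ.inner_shift hJ ht.1 hτ.1 η (g τ)
    rw [h1, ← inner_intervalIntegral (intervalIntegrable_of_continuousOn hc hT hTT),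
      ← intervalIntegral.integral_add_adjacent_intervals
        (intervalIntegrable_of_continuousOn hc hT ht)
        (intervalIntegrable_of_continuousOn hc ht hTT)]
    have h2 : ∫ τ in t..T, J (G.toFun (max (t - τ) 0) (g τ) - g τ) = 0 := by
      rw [intervalIntegral.integral_congr (g := fun _ => (0 : U)) fun τ hτ => ?_]
      · simp
      rw [uIcc_of_le ht.2] at hτ
      simp only
      rw [max_eq_right (sub_nonpos.2 hτ.1), G.apply_zero, sub_self, _root_.map_zero]
    have h3 : ∫ τ in (0 : ℝ)..t, J (G.toFun (max (t - τ) 0) (g τ) - g τ) =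
        ∫ τ in (0 : ℝ)..t, J (G.toFun (t - τ) (g τ) - g τ) := by
      refine intervalIntegral.integral_congr fun τ hτ => ?_
      rw [uIcc_of_le ht.1] at hτ
      rw [max_eq_left (sub_nonneg.2 hτ.2)]
    have i1 := intervalIntegrable_of_continuousOn hc' hT ht
    have i2 := intervalIntegrable_of_continuousOn hg hT ht
    rw [h2, add_zero, h3, J.intervalIntegral_comp_comm (i1.sub i2),
      intervalIntegral.integral_sub i1 i2]
  have hv : ContinuousOn (fun s => G.toFun (-s) (g s)) (Icc 0 T) :=
    G.continuousOn_apply (by fun_prop) hg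
  have e2 : z t = G.toFun t (z 0) + ∫ τ in (0 : ℝ)..t, G.toFun (t - τ) (g τ) := by
    have h1 := integral_eq_sub_of_hasDerivWithinAt_Icc (fun s hs => hz.hasDerivWithinAt hg hs) hv ht
    have h2 := congrArg (G.toFun t) h1
    rw [← (G.toFun t).intervalIntegral_comp_comm (intervalIntegrable_of_continuousOn hv hT ht),
      map_sub, G.apply_neg_apply, neg_zero, G.apply_zero] at h2
    simp only [← G.apply_add, ← sub_eq_add_neg] at h2
    rw [h2]; abel
  rw [e1, ← inner_add_right, ← _root_.map_add, e2, sub_zero, max_eq_left ht.1]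
  congr 2
  abel

end StableGroups


/-! ### Semilinear equations with an exponentially stable linear part -/

section Semilinear

variable {E : Type*} [NormedAddCommGroup E] [NormedSpace ℝ E]

/-- A strongly continuous group of linear operators on a normed space. -/
structure LinearFlow (E : Type*) [NormedAddCommGroup E] [NormedSpace ℝ E] where
  toFun : ℝ → E →L[ℝ] E
  apply_zero : ∀ x, toFun 0 x = x
  apply_add : ∀ s t x, toFun (s + t) x = toFun s (toFun t x)
  continuous_uncurry : Continuous fun p : ℝ × E => toFun p.1 p.2
  exists_bound : ∀ T : ℝ, ∃ C : ℝ, 0 ≤ C ∧ ∀ t, |t| ≤ T → ‖toFun t‖ ≤ C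

theorem LinearFlow.apply_neg_apply (Φ : LinearFlow E) (t : ℝ) (x : E) :
    Φ.toFun t (Φ.toFun (-t) x) = x := by
  rw [← Φ.apply_add, add_neg_cancel, Φ.apply_zero]

theorem LinearFlow.neg_apply_apply (Φ : LinearFlow E) (t : ℝ) (x : E) :
    Φ.toFun (-t) (Φ.toFun t x) = x := by
  rw [← Φ.apply_add, neg_add_cancel, Φ.apply_zero]

theorem LinearFlow.continuousOn_apply (Φ : LinearFlow E) {p : ℝ → ℝ} {q : ℝ → E} {s : Set ℝ}
    (hp : ContinuousOn p s) (hq : ContinuousOn q s) :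
    ContinuousOn (fun t => Φ.toFun (p t) (q t)) s :=
  Φ.continuous_uncurry.comp_continuousOn (hp.prodMk hq)

/-- Mild solutions of `w' = A w + F(w)` on `[0, T]`, where `A` generates `Φ`. -/
structure IsMildSolution (Φ : LinearFlow E) (F : E → E) (T : ℝ) (w : ℝ → E) : Prop where
  continuousOn : ContinuousOn w (Icc 0 T)
  hasDerivWithinAt : ∀ t ∈ Icc 0 T,
    HasDerivWithinAt (fun s => Φ.toFun (-s) (w s)) (Φ.toFun (-t) (F (w t))) (Icc 0 T) t

theorem IsMildSolution.mono {Φ : LinearFlow E} {F : E → E} {T T' : ℝ} {w : ℝ → E}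
    (hw : IsMildSolution Φ F T w) (h : T' ≤ T) : IsMildSolution Φ F T' w :=
  ⟨hw.continuousOn.mono (Icc_subset_Icc_right h), fun t ht =>
    (hw.hasDerivWithinAt t (Icc_subset_Icc_right h ht)).mono (Icc_subset_Icc_right h)⟩

theorem IsMildSolution.congr {Φ : LinearFlow E} {F F' : E → E} {T : ℝ} {w w' : ℝ → E}
    (hw : IsMildSolution Φ F T w) (h : ∀ t ∈ Icc 0 T, w' t = w t)
    (hF : ∀ t ∈ Icc 0 T, F' (w t) = F (w t)) : IsMildSolution Φ F' T w' :=
  ⟨hw.continuousOn.congr h, fun t ht => by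
    rw [h t ht, hF t ht]
    exact (hw.hasDerivWithinAt t ht).congr (fun s hs => by rw [h s hs]) (by rw [h t ht])⟩

theorem hasDerivWithinAt_Ici_of_Icc {f : ℝ → E} {f' : E} {T t : ℝ}
    (h : HasDerivWithinAt f f' (Icc 0 T) t) (ht : t ∈ Ico 0 T) :
    HasDerivWithinAt f f' (Ici t) t :=
  h.mono_of_mem_nhdsWithin (Icc_mem_nhdsGE_of_mem ht)

theorem IsMildSolution.eq_add_integral [CompleteSpace E] {Φ : LinearFlow E} {F : E → E} {T : ℝ}
    {w : ℝ → E} (hw : IsMildSolution Φ F T w) (hF : ContinuousOn (fun s => F (w s)) (Icc 0 T))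
    {t : ℝ} (ht : t ∈ Icc 0 T) :
    w t = Φ.toFun t (w 0) + ∫ s in (0 : ℝ)..t, Φ.toFun (t - s) (F (w s)) := by
  have hv : ContinuousOn (fun s => Φ.toFun (-s) (F (w s))) (Icc 0 T) :=
    Φ.continuousOn_apply (by fun_prop) hF
  have h1 := integral_eq_sub_of_hasDerivWithinAt_Icc hw.hasDerivWithinAt hv ht
  have h2 := congrArg (Φ.toFun t) h1
  rw [← (Φ.toFun t).intervalIntegral_comp_comm (intervalIntegrable_of_continuousOn hv
      ⟨le_rfl, ht.1.trans ht.2⟩ ht),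
    map_sub, Φ.apply_neg_apply, neg_zero, Φ.apply_zero] at h2
  simp only [← Φ.apply_add, ← sub_eq_add_neg] at h2
  rw [h2]; abel

theorem le_exp_of_le_integral {p : ℝ → ℝ} {T a K : ℝ} (hp : ContinuousOn p (Icc 0 T))
    (hp0 : ∀ t ∈ Icc 0 T, 0 ≤ p t) (ha : 0 ≤ a) (hK : 0 ≤ K)
    (h : ∀ t ∈ Icc 0 T, p t ≤ a + K * ∫ s in (0 : ℝ)..t, p s) {t : ℝ} (ht : t ∈ Icc 0 T) :
    p t ≤ a * Real.exp (K * t) := by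
  have hd : ∀ t ∈ Icc 0 T, HasDerivWithinAt (fun t => a + K * ∫ s in (0 : ℝ)..t, p s)
      (K * p t) (Icc 0 T) t := fun t ht =>
    ((hasDerivWithinAt_integral_Icc hp ht).const_mul K).const_add a
  have hnn : ∀ t ∈ Icc 0 T, 0 ≤ a + K * ∫ s in (0 : ℝ)..t, p s := fun t ht => (hp0 t ht).trans (h t ht)
  have := norm_le_gronwallBound_of_norm_deriv_right_le (δ := a) (K := K) (ε := 0)
    (fun t ht => (hd t ht).continuousWithinAt)
    (fun t ht => hasDerivWithinAt_Ici_of_Icc (hd t (Ico_subset_Icc_self ht)) ht)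
    (by simp [abs_of_nonneg ha]) (fun t ht => by
      have ht' := Ico_subset_Icc_self ht
      rw [Real.norm_of_nonneg (mul_nonneg hK (hp0 t ht')), Real.norm_of_nonneg (hnn t ht'),
        add_zero]
      exact mul_le_mul_of_nonneg_left (h t ht') hK) t ht
  rw [Real.norm_of_nonneg (hnn t ht), gronwallBound_ε0, sub_zero] at this
  exact (h t ht).trans this

/-- Grönwall's inequality for `e^{νt} ‖w(t)‖`, obtained from the variation of constants formula; the
perturbation costs `M η` in the rate. -/
theorem IsMildSolution.norm_le [CompleteSpace E] {Φ : LinearFlow E} {M ν η : ℝ} (hM : 0 ≤ M)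
    (hη : 0 ≤ η) (hΦ : ∀ t, 0 ≤ t → ‖Φ.toFun t‖ ≤ M * Real.exp (-ν * t)) {F : E → E} {T : ℝ}
    {w : ℝ → E} (hw : IsMildSolution Φ F T w) (hF : ContinuousOn (fun s => F (w s)) (Icc 0 T))
    (hFb : ∀ t ∈ Icc 0 T, ‖F (w t)‖ ≤ η * ‖w t‖) {t : ℝ} (ht : t ∈ Icc 0 T) :
    ‖w t‖ ≤ M * Real.exp (-(ν - M * η) * t) * ‖w 0‖ := by
  have hpc : ContinuousOn (fun t => Real.exp (ν * t) * ‖w t‖) (Icc 0 T) :=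
    ContinuousOn.mul (by fun_prop) hw.continuousOn.norm
  have key : ∀ t ∈ Icc 0 T, Real.exp (ν * t) * ‖w t‖ ≤
      M * ‖w 0‖ + M * η * ∫ s in (0 : ℝ)..t, Real.exp (ν * s) * ‖w s‖ := by
    intro t ht
    rw [hw.eq_add_integral hF ht]
    have h1 : ‖Φ.toFun t (w 0)‖ ≤ M * Real.exp (-ν * t) * ‖w 0‖ :=
      (Φ.toFun t).le_of_opNorm_le (hΦ t ht.1) _
    have h2 : ‖∫ s in (0 : ℝ)..t, Φ.toFun (t - s) (F (w s))‖ ≤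
        ∫ s in (0 : ℝ)..t, M * η * Real.exp (-ν * t) * (Real.exp (ν * s) * ‖w s‖) := by
      refine intervalIntegral.norm_integral_le_of_norm_le ht.1 ?_
        ((intervalIntegrable_of_continuousOn hpc ⟨le_rfl, ht.1.trans ht.2⟩ ht).const_mul _)
      refine Eventually.of_forall fun s hs => ?_
      have hs' : s ∈ Icc 0 T := ⟨hs.1.le, hs.2.trans ht.2⟩
      refine ((Φ.toFun (t - s)).le_of_opNorm_le (hΦ _ (sub_nonneg.2 hs.2)) _).trans ?_
      calc M * Real.exp (-ν * (t - s)) * ‖F (w s)‖ ≤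
            M * Real.exp (-ν * (t - s)) * (η * ‖w s‖) := by gcongr; exact hFb s hs'
        _ = _ := by
          rw [show -ν * (t - s) = -ν * t + ν * s by ring, Real.exp_add]; ring
    rw [intervalIntegral.integral_const_mul] at h2
    have h3 : Real.exp (ν * t) * Real.exp (-ν * t) = 1 := by
      rw [← Real.exp_add]; simp
    calc _ ≤ Real.exp (ν * t) * (M * Real.exp (-ν * t) * ‖w 0‖ + M * η * Real.exp (-ν * t) *
          ∫ s in (0 : ℝ)..t, Real.exp (ν * s) * ‖w s‖) := by
            gcongr
            exact (norm_add_le _ _).trans (add_le_add h1 h2)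
      _ = (Real.exp (ν * t) * Real.exp (-ν * t)) * (M * ‖w 0‖ + M * η *
          ∫ s in (0 : ℝ)..t, Real.exp (ν * s) * ‖w s‖) := by ring
      _ = _ := by rw [h3, one_mul]
  have h4 := le_exp_of_le_integral hpc (fun t _ => by positivity) (by positivity) (by positivity)
    key ht
  calc ‖w t‖ = Real.exp (-ν * t) * (Real.exp (ν * t) * ‖w t‖) := by
        rw [← mul_assoc, ← Real.exp_add]; simp
    _ ≤ Real.exp (-ν * t) * (M * ‖w 0‖ * Real.exp (M * η * t)) := by gcongr
    _ = M * (Real.exp (-ν * t) * Real.exp (M * η * t)) * ‖w 0‖ := by ring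
    _ = _ := by rw [← Real.exp_add]; congr 3; ring

/-- Continuity argument: while `‖w‖ ≤ δ`, the decay estimate gives the strict inequality `‖w‖ < δ`,
so there is no first time at which `δ` is reached. -/
theorem IsMildSolution.norm_le_of_small [CompleteSpace E] {Φ : LinearFlow E} {M ν η δ : ℝ}
    (hM : 1 ≤ M) (hη : 0 ≤ η) (hΦ : ∀ t, 0 ≤ t → ‖Φ.toFun t‖ ≤ M * Real.exp (-ν * t))
    (hν : M * η ≤ ν) {F : E → E} (hF : Continuous F)
    (hFb : ∀ x, ‖x‖ ≤ δ → ‖F x‖ ≤ η * ‖x‖) {T : ℝ}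
    {w : ℝ → E} (hw : IsMildSolution Φ F T w) (h0 : M * ‖w 0‖ < δ) {t : ℝ} (ht : t ∈ Icc 0 T) :
    ‖w t‖ < δ ∧ ‖w t‖ ≤ M * Real.exp (-(ν - M * η) * t) * ‖w 0‖ := by
  have hM0 : 0 ≤ M := zero_le_one.trans hM
  have step : ∀ t ∈ Icc 0 T, (∀ s ∈ Icc 0 t, ‖w s‖ ≤ δ) →
      ‖w t‖ < δ ∧ ‖w t‖ ≤ M * Real.exp (-(ν - M * η) * t) * ‖w 0‖ := by
    intro t ht hs
    have hw' := hw.mono ht.2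
    have h1 := hw'.norm_le hM0 hη hΦ (hF.comp_continuousOn hw'.continuousOn)
      (fun s hs' => hFb _ (hs s hs')) (t := t) ⟨ht.1, le_rfl⟩
    refine ⟨lt_of_le_of_lt (h1.trans ?_) h0, h1⟩
    have h2 : Real.exp (-(ν - M * η) * t) ≤ 1 := by
      rw [Real.exp_le_one_iff]
      nlinarith [ht.1]
    gcongr
    exact mul_le_of_le_one_right hM0 h2
  refine step t ht ?_
  by_contra hcon
  push Not at hcon
  obtain ⟨t₀, ht₀, hlt⟩ := hcon
  set s : Set ℝ := {r | r ∈ Icc 0 T ∧ δ ≤ ‖w r‖} with hs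
  have hsc : IsClosed s := by
    have := hw.continuousOn.norm.preimage_isClosed_of_isClosed isClosed_Icc (isClosed_Ici (a := δ))
    exact this
  have hsne : s.Nonempty := ⟨t₀, ⟨ht₀.1, ht₀.2.trans ht.2⟩, hlt.le⟩
  have hbb : BddBelow s := ⟨0, fun r hr => hr.1.1⟩
  have hmem := hsc.csInf_mem hsne hbb
  set t₁ := sInf s
  have hbefore : ∀ r ∈ Ico 0 t₁, ‖w r‖ ≤ δ := by
    intro r hr
    by_contra hc
    push Not at hc
    exact absurd (csInf_le hbb ⟨⟨hr.1, hr.2.le.trans hmem.1.2⟩, hc.le⟩) (not_le.2 hr.2)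
  have h00 : ‖w 0‖ < δ := lt_of_le_of_lt (le_mul_of_one_le_left (norm_nonneg _) hM) h0
  have ht₁ : 0 < t₁ := by
    rcases hmem.1.1.eq_or_lt with h | h
    · rw [← h] at hmem; exact absurd hmem.2 (not_le.2 h00)
    · exact h
  have hall : ∀ r ∈ Icc 0 t₁, ‖w r‖ ≤ δ := by
    have hc : IsClosed (Icc 0 t₁ ∩ (fun r => ‖w r‖) ⁻¹' Iic δ) :=
      (hw.mono hmem.1.2).continuousOn.norm.preimage_isClosed_of_isClosed isClosed_Icc isClosed_Iic
    have hsub : closure (Ico 0 t₁) ⊆ Icc 0 t₁ ∩ (fun r => ‖w r‖) ⁻¹' Iic δ :=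
      closure_minimal (fun r hr => ⟨Ico_subset_Icc_self hr, hbefore r hr⟩) hc
    rw [closure_Ico ht₁.ne] at hsub
    exact fun r hr => (hsub hr).2
  exact absurd (step t₁ hmem.1 hall).1 (not_lt.2 hmem.2)

/-- In the variable `v = Φ(-t) w` the unbounded generator disappears and the equation becomes `v' =
Φ(-t) F(Φ(t) v)`, an ordinary differential equation to which the classical theory applies. -/
theorem LinearFlow.lipschitzOnWith_conj (Φ : LinearFlow E) {F : E → E} {s : Set E} {Λ C : NNReal}
    (hF : LipschitzOnWith Λ F s) {t : ℝ} (h1 : ‖Φ.toFun t‖ ≤ C) (h2 : ‖Φ.toFun (-t)‖ ≤ C) :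
    LipschitzOnWith (C * (Λ * C)) (fun v => Φ.toFun (-t) (F (Φ.toFun t v)))
      {v | Φ.toFun t v ∈ s} := by
  refine LipschitzOnWith.of_dist_le_mul fun x hx y hy => ?_
  have h3 := hF.dist_le_mul _ hx _ hy
  rw [dist_eq_norm, dist_eq_norm, ← map_sub] at h3
  rw [dist_eq_norm, dist_eq_norm, ← map_sub]
  refine ((Φ.toFun (-t)).le_of_opNorm_le h2 _).trans ?_
  push_cast
  rw [mul_assoc, mul_assoc]
  gcongr
  exact h3.trans (by gcongr; exact (Φ.toFun t).le_of_opNorm_le h1 _)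

theorem LinearFlow.exists_bound_nnreal (Φ : LinearFlow E) (T : ℝ) :
    ∃ C : NNReal, ∀ t ∈ Icc 0 T, ‖Φ.toFun t‖ ≤ C ∧ ‖Φ.toFun (-t)‖ ≤ C := by
  obtain ⟨C, hC, hb⟩ := Φ.exists_bound T
  refine ⟨⟨C, hC⟩, fun t ht => ⟨hb t ?_, hb (-t) ?_⟩⟩
  · rw [abs_of_nonneg ht.1]; exact ht.2
  · rw [abs_neg, abs_of_nonneg ht.1]; exact ht.2

theorem LinearFlow.exists_lipschitz_dependence (Φ : LinearFlow E) {F : E → E} {s : Set E}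
    {Λ : NNReal} (hF : LipschitzOnWith Λ F s) (T : ℝ) :
    ∃ L : ℝ, 0 ≤ L ∧ ∀ w w' : ℝ → E, IsMildSolution Φ F T w → IsMildSolution Φ F T w' →
      (∀ t ∈ Icc 0 T, w t ∈ s) → (∀ t ∈ Icc 0 T, w' t ∈ s) →
      ∀ t ∈ Icc 0 T, ‖w t - w' t‖ ≤ L * ‖w 0 - w' 0‖ := by
  obtain ⟨C, hC⟩ := Φ.exists_bound_nnreal T
  refine ⟨C * Real.exp ((C * (Λ * C) : NNReal) * T), by positivity,
    fun w w' hw hw' hs hs' t ht => ?_⟩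
  have hd : ∀ w : ℝ → E, IsMildSolution Φ F T w → ∀ t ∈ Ico 0 T,
      HasDerivWithinAt (fun s => Φ.toFun (-s) (w s))
        (Φ.toFun (-t) (F (Φ.toFun t (Φ.toFun (-t) (w t))))) (Ici t) t := fun w hw t ht => by
    rw [Φ.apply_neg_apply]
    exact hasDerivWithinAt_Ici_of_Icc (hw.hasDerivWithinAt t (Ico_subset_Icc_self ht)) ht
  have hc : ∀ w : ℝ → E, IsMildSolution Φ F T w →
      ContinuousOn (fun s => Φ.toFun (-s) (w s)) (Icc 0 T) := fun w hw t ht =>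
    (hw.hasDerivWithinAt t ht).continuousWithinAt
  have key := dist_le_of_trajectories_ODE_of_mem
    (v := fun t v => Φ.toFun (-t) (F (Φ.toFun t v))) (s := fun t => {v | Φ.toFun t v ∈ s})
    (fun t ht => Φ.lipschitzOnWith_conj hF (hC t (Ico_subset_Icc_self ht)).1
      (hC t (Ico_subset_Icc_self ht)).2)
    (hc w hw) (hd w hw) (fun t ht => by
      simpa [Φ.apply_neg_apply] using hs t (Ico_subset_Icc_self ht))
    (hc w' hw') (hd w' hw') (fun t ht => by
      simpa [Φ.apply_neg_apply] using hs' t (Ico_subset_Icc_self ht)) le_rfl t ht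
  simp only [dist_eq_norm, ← map_sub, neg_zero, Φ.apply_zero, sub_zero] at key
  have h1 := (Φ.toFun t).le_of_opNorm_le (hC t ht).1 (Φ.toFun (-t) (w t - w' t))
  rw [Φ.apply_neg_apply] at h1
  refine h1.trans ?_
  calc C * ‖Φ.toFun (-t) (w t - w' t)‖ ≤
        C * (‖w 0 - w' 0‖ * Real.exp ((C * (Λ * C) : NNReal) * t)) := by gcongr
    _ ≤ C * (‖w 0 - w' 0‖ * Real.exp ((C * (Λ * C) : NNReal) * T)) := by gcongr; exact ht.2
    _ = _ := by ring

/-- The radial retraction onto the ball of radius `δ`. -/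
def radial (δ : ℝ) (x : E) : E := (δ / max δ ‖x‖) • x

theorem radial_of_le {δ : ℝ} (hδ : 0 < δ) {x : E} (hx : ‖x‖ ≤ δ) : radial δ x = x := by
  rw [radial, max_eq_left hx, div_self hδ.ne', one_smul]

theorem norm_radial_le_norm {δ : ℝ} (hδ : 0 < δ) (x : E) : ‖radial δ x‖ ≤ ‖x‖ := by
  have hm : 0 < max δ ‖x‖ := lt_max_of_lt_left hδ
  rw [radial, norm_smul, Real.norm_of_nonneg (by positivity)]
  exact mul_le_of_le_one_left (norm_nonneg _) ((div_le_one hm).2 (le_max_left _ _))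

theorem norm_radial_le {δ : ℝ} (hδ : 0 < δ) (x : E) : ‖radial δ x‖ ≤ δ := by
  have hm : 0 < max δ ‖x‖ := lt_max_of_lt_left hδ
  rw [radial, norm_smul, Real.norm_of_nonneg (by positivity), div_mul_eq_mul_div, div_le_iff₀ hm]
  exact mul_le_mul_of_nonneg_left (le_max_right _ _) hδ.le

theorem lipschitzWith_radial {δ : ℝ} (hδ : 0 < δ) : LipschitzWith 2 (radial δ : E → E) := by
  refine LipschitzWith.of_dist_le_mul fun x y => ?_
  rw [dist_eq_norm, dist_eq_norm]
  have hm : 0 < max δ ‖x‖ := lt_max_of_lt_left hδ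
  have hn : 0 < max δ ‖y‖ := lt_max_of_lt_left hδ
  have e : radial δ x - radial δ y = (δ / max δ ‖x‖) • (x - y) +
      (δ / max δ ‖x‖ - δ / max δ ‖y‖) • y := by
    rw [radial, radial, smul_sub, sub_smul]; abel
  have h1 : ‖(δ / max δ ‖x‖) • (x - y)‖ ≤ ‖x - y‖ := by
    rw [norm_smul, Real.norm_of_nonneg (by positivity)]
    exact mul_le_of_le_one_left (norm_nonneg _) ((div_le_one hm).2 (le_max_left _ _))
  have h2 : ‖(δ / max δ ‖x‖ - δ / max δ ‖y‖) • y‖ ≤ ‖x - y‖ := by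
    have e2 : δ / max δ ‖x‖ - δ / max δ ‖y‖ =
        (δ / max δ ‖x‖) * ((max δ ‖y‖ - max δ ‖x‖) / max δ ‖y‖) := by
      field_simp
    have h3 : |max δ ‖y‖ - max δ ‖x‖| ≤ ‖x - y‖ := by
      have h4 := abs_max_sub_max_le_abs ‖y‖ ‖x‖ δ
      rw [max_comm δ, max_comm δ, norm_sub_rev]
      exact h4.trans (abs_norm_sub_norm_le _ _)
    rw [norm_smul, e2, norm_mul, Real.norm_of_nonneg (by positivity : 0 ≤ δ / max δ ‖x‖),
      norm_div, Real.norm_of_nonneg hn.le, Real.norm_eq_abs, mul_assoc,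
      div_mul_eq_mul_div |max δ ‖y‖ - max δ ‖x‖|]
    have h5 : |max δ ‖y‖ - max δ ‖x‖| * ‖y‖ / max δ ‖y‖ ≤ ‖x - y‖ := by
      rw [div_le_iff₀ hn]
      exact mul_le_mul h3 (le_max_right _ _) (norm_nonneg _) (norm_nonneg _)
    exact (mul_le_of_le_one_left (by positivity) ((div_le_one hm).2 (le_max_left _ _))).trans h5
  rw [e]
  refine (norm_add_le _ _).trans ((add_le_add h1 h2).trans (le_of_eq ?_))
  push_cast
  ring

theorem LinearFlow.exists_isMildSolution [CompleteSpace E] (Φ : LinearFlow E) {F : E → E}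
    {Λ : NNReal} (hF : LipschitzWith Λ F) {N : NNReal} (hN : ∀ x, ‖F x‖ ≤ N) {T : ℝ}
    (hT : 0 ≤ T) (x : E) : ∃ w, w 0 = x ∧ IsMildSolution Φ F T w := by
  obtain ⟨C, hC⟩ := Φ.exists_bound_nnreal T
  have hT' : (0 : ℝ) ∈ Icc 0 T := ⟨le_rfl, hT⟩
  -- As the field is bounded by `C N`, a ball of radius `C N T` cannot be left before time `T`; so
  -- one application covers all of `[0, T]`.
  have hP : IsPicardLindelof (fun t v => Φ.toFun (-t) (F (Φ.toFun t v))) (⟨0, hT'⟩ : Icc 0 T) x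
      (C * N * ⟨T, hT⟩) 0 (C * N) (C * (Λ * C)) :=
    { lipschitzOnWith := fun t ht => by
        have := Φ.lipschitzOnWith_conj (hF.lipschitzOnWith (s := univ)) (hC t ht).1 (hC t ht).2
        exact this.mono fun _ _ => mem_univ _
      continuousOn := fun x _ => Φ.continuousOn_apply (by fun_prop)
        (hF.continuous.comp_continuousOn (Φ.continuousOn_apply (by fun_prop) (by fun_prop)))
      norm_le := fun t ht x _ =>
        ((Φ.toFun (-t)).le_of_opNorm_le (hC t ht).2 _).trans (by push_cast; gcongr; exact hN _)
      mul_max_le := by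
        simp only [sub_zero, sub_self, max_eq_left hT]
        simp only [NNReal.coe_zero, sub_zero]
        exact le_rfl }
  obtain ⟨α, hα, hd⟩ := hP.exists_eq_forall_mem_Icc_hasDerivWithinAt₀
  refine ⟨fun t => Φ.toFun t (α t), by simpa [Φ.apply_zero] using hα, ?_, fun t ht => ?_⟩
  · exact Φ.continuousOn_apply (by fun_prop) fun t ht => (hd t ht).continuousWithinAt
  · simp only [Φ.neg_apply_apply]
    exact hd t ht

/-- Local well-posedness and exponential stability for a semilinear equation, when the linear part
is exponentially stable and the nonlinearity is small near `0`. -/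
theorem LinearFlow.exists_locally_exp_stable [CompleteSpace E] (Φ : LinearFlow E)
    {M ν μ η δ : ℝ} (hM : 1 ≤ M) (hη : 0 ≤ η) (hδ : 0 < δ) (hμ : 0 ≤ μ)
    (hΦ : ∀ t, 0 ≤ t → ‖Φ.toFun t‖ ≤ M * Real.exp (-ν * t)) (hν : M * η + μ ≤ ν)
    {F : E → E} (hF : Continuous F) (hFb : ∀ x, ‖x‖ ≤ δ → ‖F x‖ ≤ η * ‖x‖)
    {Λ : NNReal} (hFL : LipschitzOnWith Λ F (Metric.closedBall 0 δ)) :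
    (∀ x, M * ‖x‖ < δ → ∃ w : ℝ → E, w 0 = x ∧ (∀ T, IsMildSolution Φ F T w) ∧
      ∀ t, 0 ≤ t → ‖w t‖ ≤ M * Real.exp (-μ * t) * ‖x‖) ∧
    ∀ T, ∃ L : ℝ, 0 ≤ L ∧ ∀ w w' : ℝ → E, IsMildSolution Φ F T w → IsMildSolution Φ F T w' →
      M * ‖w 0‖ < δ → M * ‖w' 0‖ < δ → ∀ t ∈ Icc 0 T, ‖w t - w' t‖ ≤ L * ‖w 0 - w' 0‖ := by
  have hν' : M * η ≤ ν := by linarith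
  have dep : ∀ T, ∃ L : ℝ, 0 ≤ L ∧ ∀ w w' : ℝ → E, IsMildSolution Φ F T w →
      IsMildSolution Φ F T w' → M * ‖w 0‖ < δ → M * ‖w' 0‖ < δ →
      ∀ t ∈ Icc 0 T, ‖w t - w' t‖ ≤ L * ‖w 0 - w' 0‖ := by
    intro T
    obtain ⟨L, hL, hb⟩ := Φ.exists_lipschitz_dependence hFL T
    refine ⟨L, hL, fun w w' hw hw' h0 h0' => hb w w' hw hw' (fun t ht => ?_) (fun t ht => ?_)⟩
    · exact mem_closedBall_zero_iff.2 (hw.norm_le_of_small hM hη hΦ hν' hF hFb h0 ht).1.le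
    · exact mem_closedBall_zero_iff.2 (hw'.norm_le_of_small hM hη hΦ hν' hF hFb h0' ht).1.le
  refine ⟨fun x hx => ?_, dep⟩
  -- Composing `F` with the radial retraction makes it globally Lipschitz and bounded, and keeps the
  -- smallness bound everywhere. The a priori estimate keeps the solution inside the ball, where the
  -- truncation is invisible.
  have hex : ∀ n : ℕ, ∃ w : ℝ → E, w 0 = x ∧ IsMildSolution Φ F n w := by
    intro n
    have hLip : LipschitzWith (Λ * 2) (fun x => F (radial δ x)) := by
      rw [← lipschitzOnWith_univ] at *
      exact hFL.comp (lipschitzOnWith_univ.2 (lipschitzWith_radial hδ))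
        fun y _ => mem_closedBall_zero_iff.2 (norm_radial_le hδ y)
    have hb : ∀ y, ‖F (radial δ y)‖ ≤ η * ‖radial δ y‖ := fun y => hFb _ (norm_radial_le hδ y)
    obtain ⟨w, hw0, hw⟩ := Φ.exists_isMildSolution hLip (N := ⟨η * δ, by positivity⟩)
      (fun y => (hb y).trans (mul_le_mul_of_nonneg_left (norm_radial_le hδ y) hη))
      (Nat.cast_nonneg n) x
    have hsm : ∀ t ∈ Icc 0 (n : ℝ), ‖w t‖ < δ := fun t ht =>
      (hw.norm_le_of_small hM hη hΦ hν' hLip.continuous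
        (fun y _ => (hb y).trans (mul_le_mul_of_nonneg_left (norm_radial_le_norm hδ y) hη))
        (by rwa [hw0]) ht).1
    exact ⟨w, hw0, hw.congr (fun _ _ => rfl) fun t ht => by
      simp only [radial_of_le hδ (hsm t ht).le]⟩
  choose W hW0 hW using hex
  have huniq : ∀ (m n : ℕ) (t : ℝ), 0 ≤ t → t ≤ m → t ≤ n → W m t = W n t := by
    intro m n t ht hm hn
    obtain ⟨L, -, hL⟩ := dep t
    have := hL (W m) (W n) ((hW m).mono hm) ((hW n).mono hn) (by rwa [hW0]) (by rwa [hW0]) t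
      ⟨ht, le_rfl⟩
    rw [hW0, hW0, sub_self, norm_zero, mul_zero] at this
    exact sub_eq_zero.1 (norm_le_zero_iff.1 this)
  -- The solutions on `[0, n]` agree by uniqueness, so evaluating at `t` the one with index `⌈t⌉₊`
  -- glues them together.
  have hmild : ∀ T, IsMildSolution Φ F T (fun t => W ⌈t⌉₊ t) := fun T =>
    ((hW ⌈T⌉₊).mono (Nat.le_ceil T)).congr (fun t ht => huniq _ _ t ht.1 (Nat.le_ceil t)
      (ht.2.trans (Nat.le_ceil T))) fun _ _ => rfl
  have h0 : W ⌈(0 : ℝ)⌉₊ 0 = x := hW0 _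
  refine ⟨fun t => W ⌈t⌉₊ t, h0, hmild, fun t ht => ?_⟩
  have h1 := ((hmild t).norm_le_of_small hM hη hΦ hν' hF hFb (by rwa [h0]) ⟨ht, le_rfl⟩).2
  rw [h0] at h1
  refine h1.trans ?_
  gcongr
  nlinarith

end Semilinear


/-! ### The feedback group `e^{at} S(-t)^*` and the observation operator `-B^*` -/

section DualFeedback

variable {𝕜 : Type w} {H : Type u} {U : Type v} [RCLike 𝕜]
  [NormedAddCommGroup H] [InnerProductSpace 𝕜 H] [CompleteSpace H]
  [NormedAddCommGroup U] [InnerProductSpace 𝕜 U]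
  [NormedSpace ℝ H] [IsScalarTower ℝ 𝕜 H]

theorem C0Group.exists_adjoint_of_dual_scale (S : C0Group 𝕜 H) {a : ℝ} {x w : H}
    (h : (S.dual.scale a).HasGeneratorValue x w) :
    ∃ hx : x ∈ S.adjointGenerator.domain, S.adjointGenerator ⟨x, hx⟩ = -(w - a • x) :=
  S.exists_adjoint_of_dual h.of_scale

/-- The inclusion of the domain of the generator of `e^{at} S(-t)^*` into `D(A^*)`. -/
def C0Group.toAdjointDomain (S : C0Group 𝕜 H) (a : ℝ) :
    (S.dual.scale a).generator.domain →ₗ[𝕜] S.adjointGenerator.domain :=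
  Submodule.inclusion fun _ hx =>
    (S.exists_adjoint_of_dual_scale (C0Group.generator_spec _ ⟨_, hx⟩)).1

theorem C0Group.generator_dual_scale (S : C0Group 𝕜 H) (a : ℝ)
    (x : (S.dual.scale a).generator.domain) :
    (S.dual.scale a).generator x = -S.adjointGenerator (S.toAdjointDomain a x) + a • (x : H) := by
  obtain ⟨hx, h⟩ := S.exists_adjoint_of_dual_scale ((S.dual.scale a).generator_spec x)
  change _ = -S.adjointGenerator ⟨x, hx⟩ + a • (x : H)
  rw [h]
  abel

/-- The observation operator `-B^*` for the group `e^{at} S(-t)^*`. -/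
def DomainOperator.dualFeedback {S : C0Group 𝕜 H} (B : ControlOperator S U) (a : ℝ) :
    DomainOperator (S.dual.scale a).generator U where
  toMap := -(B.toMap ∘ₗ S.toAdjointDomain a)
  bound := by
    obtain ⟨C, hC⟩ := B.bound
    refine ⟨max C 0 * (1 + |a|), fun x => ?_⟩
    have h1 : ‖S.adjointGenerator (S.toAdjointDomain a x)‖ ≤
        ‖(S.dual.scale a).generator x‖ + |a| * ‖(x : H)‖ := by
      rw [S.generator_dual_scale a x, ← Real.norm_eq_abs, ← norm_smul]
      refine (le_of_eq ?_).trans (norm_sub_le _ _)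
      rw [add_sub_cancel_right, norm_neg]
    have h2 : ‖B.toMap (S.toAdjointDomain a x)‖ ≤
        max C 0 * (‖(x : H)‖ + ‖S.adjointGenerator (S.toAdjointDomain a x)‖) :=
      (hC _).trans (mul_le_mul_of_nonneg_right (le_max_left _ _) (by positivity))
    rw [LinearMap.neg_apply, norm_neg, LinearMap.comp_apply, mul_assoc]
    refine h2.trans (mul_le_mul_of_nonneg_left ?_ (le_max_right _ _))
    nlinarith [abs_nonneg a, norm_nonneg ((S.dual.scale a).generator x), norm_nonneg (x : H),
      mul_nonneg (abs_nonneg a) (norm_nonneg ((S.dual.scale a).generator x))]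

variable {S : C0Group 𝕜 H} {B : ControlOperator S U}

theorem DomainOperator.dualFeedback_onDomain (B : ControlOperator S U) (a t : ℝ)
    (x : (S.dual.scale a).generator.domain) :
    (B.dualFeedback a).toMap ((S.dual.scale a).onDomain t x) =
      -(((Real.exp (a * t) : ℝ) : 𝕜) • B.dualOutput (S.toAdjointDomain a x) t) := by
  change -B.toMap (S.toAdjointDomain a ((S.dual.scale a).onDomain t x)) = _
  rw [DomainOperator.dualOutput, ← map_smul]
  rfl

theorem IsAdmissibleControl.dualFeedback [CompleteSpace U] (hB : IsAdmissibleControl S B) {c : ℝ} (hc : 0 ≤ c) :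
    IsAdmissibleObservation _ (B.dualFeedback (-c)) := by
  intro T hT
  obtain ⟨C, -, hC⟩ := hB.exists_bound hT
  refine ⟨C, fun x => ?_⟩
  simp only [DomainOperator.dualFeedback_onDomain, norm_neg, norm_exp_smul_sq]
  have hb := (B.continuous_dualOutput (S.toAdjointDomain (-c) x)).norm.pow 2
  refine le_trans (intervalIntegral.integral_mono_on hT.le ?_ (hb.intervalIntegrable _ _) ?_) (hC _)
  · exact (Continuous.mul (by fun_prop) hb).intervalIntegrable _ _
  · intro t ht
    refine mul_le_of_le_one_left (sq_nonneg _) (Real.exp_le_one_iff.2 ?_)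
    nlinarith [mul_nonneg hc ht.1]

theorem IsOutputMap.isExtendedOutput {c : ℝ} {Q : H →L[𝕜] Lp U 2 (volume : Measure ℝ)}
    (hQ : IsOutputMap B c Q) : IsExtendedOutput (B.dualFeedback (-c)) (-Q) := by
  intro x
  obtain ⟨h, e⟩ := hQ (S.toAdjointDomain (-c) x)
  change Q (x : H) = _ at e
  rw [_root_.neg_apply, e]
  filter_upwards [Lp.coeFn_neg (h.toLp _), h.coeFn_toLp] with s h1 h2
  rw [h1, Pi.neg_apply, h2]
  simp only [DomainOperator.weightedOutput, indicator, DomainOperator.dualFeedback_onDomain]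
  split_ifs <;> simp

/-- The Lyapunov equation read as the intertwining relation `P Ã = A P + B K` for `P = Q^* Q`; the
sign of `K` absorbs the term `-B B^*`. -/
theorem IsOutputMap.inner_dualFeedback [CompleteSpace U] {c : ℝ}
    {Q : H →L[𝕜] Lp U 2 (volume : Measure ℝ)} (hQ : IsOutputMap B c Q) (φ : S.adjointGenerator.domain)
    (x : (S.dual.scale (-(2 * c))).generator.domain) :
    ⟪(φ : H), (ContinuousLinearMap.adjoint Q ∘L Q) ((S.dual.scale (-(2 * c))).generator x)⟫_𝕜 =
      ⟪S.adjointGenerator φ, (ContinuousLinearMap.adjoint Q ∘L Q) x⟫_𝕜 +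
        ⟪B.toMap φ, (B.dualFeedback (-(2 * c))).toMap x⟫_𝕜 := by
  have h := hQ.lyapunov φ (S.toAdjointDomain _ x)
  rw [S.generator_dual_scale]
  change _ = _ + ⟪B.toMap φ, -B.toMap (S.toAdjointDomain _ x)⟫_𝕜
  rw [inner_neg_right, ← sub_eq_add_neg]
  exact h

end DualFeedback

/-! ### Superposition, rescaling and products of solutions -/

section ClosedLoop

variable {𝕜 : Type w} {H : Type u} [RCLike 𝕜]
  [NormedAddCommGroup H] [InnerProductSpace 𝕜 H] [CompleteSpace H]

theorem IsWeakSolution.congr_forcing {S : C0Group 𝕜 H} {T : ℝ}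
    {F F' : S.adjointGenerator.domain → ℝ → 𝕜} {y : ℝ → H}
    (h : IsWeakSolution S T F y) (hF : ∀ φ s, F φ s = F' φ s) : IsWeakSolution S T F' y := by
  have : F = F' := funext fun φ => funext fun s => hF φ s
  rwa [← this]

theorem IsWeakSolution.intervalIntegrable {S : C0Group 𝕜 H} {T : ℝ}
    {F : S.adjointGenerator.domain → ℝ → 𝕜} {y : ℝ → H}
    (h : IsWeakSolution S T F y) (φ : S.adjointGenerator.domain) {t : ℝ} (ht : t ∈ Icc 0 T) :
    IntervalIntegrable (fun s => ⟪S.adjointGenerator φ, y s⟫_𝕜 + F φ s) volume 0 t := by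
  have h0 : (0 : ℝ) ∈ Icc 0 T := ⟨le_rfl, ht.1.trans ht.2⟩
  exact (intervalIntegrable_of_continuousOn (continuousOn_const.inner h.continuousOn) h0 ht).add
    (intervalIntegrable_of_Ioc (h.integrable φ) h0 ht)

theorem IsWeakSolution.add {S : C0Group 𝕜 H} {T : ℝ} {F F' : S.adjointGenerator.domain → ℝ → 𝕜}
    {y y' : ℝ → H} (h : IsWeakSolution S T F y) (h' : IsWeakSolution S T F' y') :
    IsWeakSolution S T (fun φ s => F φ s + F' φ s) (fun s => y s + y' s) where
  continuousOn := h.continuousOn.add h'.continuousOn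
  integrable φ := (h.integrable φ).add (h'.integrable φ)
  weak φ t ht := by
    rw [inner_add_right, inner_add_right, h.weak φ t ht, h'.weak φ t ht, add_add_add_comm,
      ← intervalIntegral.integral_add (h.intervalIntegrable φ ht) (h'.intervalIntegrable φ ht)]
    simp only [inner_add_right, add_add_add_comm]

theorem IsWeakSolution.sub {S : C0Group 𝕜 H} {T : ℝ} {F F' : S.adjointGenerator.domain → ℝ → 𝕜}
    {y y' : ℝ → H} (h : IsWeakSolution S T F y) (h' : IsWeakSolution S T F' y') :
    IsWeakSolution S T (fun φ s => F φ s - F' φ s) (fun s => y s - y' s) where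
  continuousOn := h.continuousOn.sub h'.continuousOn
  integrable φ := (h.integrable φ).sub (h'.integrable φ)
  weak φ t ht := by
    rw [inner_sub_right, inner_sub_right, h.weak φ t ht, h'.weak φ t ht, add_sub_add_comm,
      ← intervalIntegral.integral_sub (h.intervalIntegrable φ ht) (h'.intervalIntegrable φ ht)]
    simp only [inner_sub_right, add_sub_add_comm]

theorem C0Group.scale_scale_neg {𝕜 : Type w} {H : Type u} [RCLike 𝕜] [NormedAddCommGroup H]
    [InnerProductSpace 𝕜 H] (S : C0Group 𝕜 H) (a t : ℝ) (x : H) :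
    ((S.scale a).scale (-a)).toFun t x = S.toFun t x := by
  rw [C0Group.scale_apply, C0Group.scale_apply, smul_smul, ← RCLike.ofReal_mul, ← Real.exp_add,
    neg_mul, neg_add_cancel, Real.exp_zero, RCLike.ofReal_one, one_smul]

variable [NormedSpace ℝ H] [IsScalarTower ℝ 𝕜 H]

omit [CompleteSpace H] in
theorem C0Group.hasDerivWithinAt_scale {S : C0Group 𝕜 H} {y : ℝ → H} {h : H} {s : Set ℝ} {t : ℝ}
    (hy : HasDerivWithinAt (fun s => S.toFun (-s) (y s)) (S.toFun (-t) h) s t) (a : ℝ) :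
    HasDerivWithinAt (fun s => (S.scale a).toFun (-s) (y s))
      ((S.scale a).toFun (-t) (h - a • y t)) s t := by
  have h1 : HasDerivWithinAt (fun s => Real.exp (a * -s)) (Real.exp (a * -t) * (a * -1)) s t :=
    (((hasDerivAt_id t).neg.const_mul a).exp).hasDerivWithinAt
  simp only [C0Group.scale_apply, ofReal_smul_eq]
  refine (h1.smul hy).congr_deriv ?_
  rw [map_sub, smul_sub, ← ofReal_smul_eq (𝕜 := 𝕜) a (y t), map_smul, ofReal_smul_eq, mul_smul]
  module

omit [CompleteSpace H] in
theorem C0Group.hasDerivWithinAt_of_scale {S : C0Group 𝕜 H} {y : ℝ → H} {h : H} {s : Set ℝ}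
    {t a : ℝ} (hy : HasDerivWithinAt (fun s => (S.scale a).toFun (-s) (y s))
      ((S.scale a).toFun (-t) h) s t) :
    HasDerivWithinAt (fun s => S.toFun (-s) (y s)) (S.toFun (-t) (h + a • y t)) s t := by
  simpa only [S.scale_scale_neg, neg_smul, sub_neg_eq_add] using
    C0Group.hasDerivWithinAt_scale hy (-a)

/-- The product of two groups, as a flow over the real numbers. -/
def C0Group.prodFlow (S G : C0Group 𝕜 H) : LinearFlow (H × H) where
  toFun t := ((S.toFun t).restrictScalars ℝ).prodMap ((G.toFun t).restrictScalars ℝ)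
  apply_zero x := Prod.ext (S.apply_zero _) (G.apply_zero _)
  apply_add s t x := Prod.ext (S.apply_add _ _ _) (G.apply_add _ _ _)
  continuous_uncurry :=
    (S.continuous_apply continuous_fst (continuous_fst.comp continuous_snd)).prodMk
      (G.continuous_apply continuous_fst (continuous_snd.comp continuous_snd))
  exists_bound T := by
    obtain ⟨M, hM, hb⟩ := S.exists_bound_Icc T
    obtain ⟨N, hN, hb'⟩ := G.exists_bound_Icc T
    refine ⟨max M N, le_max_of_le_left hM.le, fun t ht => ?_⟩
    refine ContinuousLinearMap.opNorm_le_bound _ (le_max_of_le_left hM.le) fun x => ?_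
    exact max_le
      (((S.toFun t).le_of_opNorm_le (hb t ht) _).trans (mul_le_mul (le_max_left _ _)
        (norm_fst_le x) (norm_nonneg _) (le_max_of_le_left hM.le)))
      (((G.toFun t).le_of_opNorm_le (hb' t ht) _).trans (mul_le_mul (le_max_right _ _)
        (norm_snd_le x) (norm_nonneg _) (le_max_of_le_left hM.le)))

theorem C0Group.norm_prodFlow_le {S G : C0Group 𝕜 H} {t M : ℝ} (h : ‖S.toFun t‖ ≤ M)
    (h' : ‖G.toFun t‖ ≤ M) : ‖(S.prodFlow G).toFun t‖ ≤ M := by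
  have hM : 0 ≤ M := (norm_nonneg _).trans h
  refine ContinuousLinearMap.opNorm_le_bound _ hM fun x => ?_
  exact max_le
    (((S.toFun t).le_of_opNorm_le h _).trans (mul_le_mul_of_nonneg_left (norm_fst_le x) hM))
    (((G.toFun t).le_of_opNorm_le h' _).trans (mul_le_mul_of_nonneg_left (norm_snd_le x) hM))

theorem C0Group.isMildSolution_prodFlow {S G : C0Group 𝕜 H} {F : H × H → H × H} {T : ℝ}
    {w : ℝ → H × H} (hw : ContinuousOn w (Icc 0 T))
    (h1 : ∀ t ∈ Icc 0 T, HasDerivWithinAt (fun s => S.toFun (-s) (w s).1)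
      (S.toFun (-t) (F (w t)).1) (Icc 0 T) t)
    (h2 : ∀ t ∈ Icc 0 T, HasDerivWithinAt (fun s => G.toFun (-s) (w s).2)
      (G.toFun (-t) (F (w t)).2) (Icc 0 T) t) :
    IsMildSolution (S.prodFlow G) F T w :=
  ⟨hw, fun t ht => (h1 t ht).prodMk (h2 t ht)⟩

end ClosedLoop


/-! ### Decoupling the extended system, and stabilization -/

section Linearization

variable {𝕜 : Type w} {H : Type u} {U : Type v} [RCLike 𝕜]
  [NormedAddCommGroup H] [InnerProductSpace 𝕜 H] [CompleteSpace H]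
  [NormedAddCommGroup U] [InnerProductSpace 𝕜 U]
  [NormedSpace ℝ H] [IsScalarTower ℝ 𝕜 H]

/-- A dynamic feedback for which `ζ = y - P z` solves `ζ' = (A - λ) ζ` along the extended
system. -/
structure DynamicFeedback.IsDecoupling {S : C0Group 𝕜 H} (D : DynamicFeedback 𝕜 H U H)
    (B : ControlOperator S U) (f : H → H) (P R : H →L[𝕜] H) (l : ℝ) : Prop where
  norm_lt : ‖D.group.toFun 1‖ < 1
  inner_map : ∀ (φ : S.adjointGenerator.domain) (x : D.group.generator.domain),
    ⟪(φ : H), P (D.group.generator x)⟫_𝕜 =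
      ⟪S.adjointGenerator φ, P x⟫_𝕜 + ⟪B.toMap φ, D.K.toMap x⟫_𝕜
  exists_output : ∃ Ψ : H →L[𝕜] Lp U 2 (volume : Measure ℝ), IsExtendedOutput D.K Ψ
  map_inverse : ∀ x, P (R x) = x
  g_eq : ∀ p, D.g p = R (f p.1 + l • (p.1 - P p.2))

variable {S : C0Group 𝕜 H} {B : ControlOperator S U} {f : H → H} {P R : H →L[𝕜] H} {l k : ℝ}
  {D : DynamicFeedback 𝕜 H U H}

/-- The state `(y, z)` in terms of the coordinates `(k (y - P z), z)`. -/
def stateOfCoord (P : H →L[𝕜] H) (k : ℝ) : H × H →L[ℝ] H :=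
  k⁻¹ • ContinuousLinearMap.fst ℝ H H + P.restrictScalars ℝ ∘L ContinuousLinearMap.snd ℝ H H

omit [CompleteSpace H] in
theorem stateOfCoord_apply (w : H × H) : stateOfCoord P k w = k⁻¹ • w.1 + P w.2 := rfl

/-- The coordinates `(k (y - P z), z)`. -/
def coordOfState (P : H →L[𝕜] H) (k : ℝ) : H × H →L[ℝ] H × H :=
  (k • (ContinuousLinearMap.fst ℝ H H - P.restrictScalars ℝ ∘L
    ContinuousLinearMap.snd ℝ H H)).prod (ContinuousLinearMap.snd ℝ H H)

omit [CompleteSpace H] in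
theorem coordOfState_apply (p : H × H) : coordOfState P k p = (k • (p.1 - P p.2), p.2) := rfl

omit [CompleteSpace H] in
theorem stateOfCoord_coordOfState (hk : k ≠ 0) (p : H × H) :
    stateOfCoord P k (coordOfState P k p) = p.1 := by
  rw [stateOfCoord_apply, coordOfState_apply, inv_smul_smul₀ hk, sub_add_cancel]

/-- The nonlinearity of the extended system in the coordinates `(k (y - P z), z)`. -/
def coordForcing (f : H → H) (P R : H →L[𝕜] H) (l k : ℝ) (w : H × H) : H × H :=
  (0, R (f (stateOfCoord P k w) + (l * k⁻¹) • w.1))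

/-- Subtracting the equation transported by `P` from that of `y` removes the control term, whatever
the output `u` is. Hence every closed-loop solution, not only a constructed one, is mild in the new
coordinates, and this yields uniqueness. -/
theorem DynamicFeedback.IsDecoupling.isMildSolution (h : D.IsDecoupling B f P R l)
    (hk : k ≠ 0) {T : ℝ} {y z : ℝ → H} (hs : IsClosedLoopSolution S B f D T y z) :
    IsMildSolution ((S.scale (-l)).prodFlow D.group) (coordForcing f P R l k) T
      (fun t => coordOfState P k (y t, z t)) := by
  obtain ⟨u, hu, hy, hz⟩ := hs
  have hgc : ContinuousOn (fun s => D.g (y s, z s)) (Icc 0 T) :=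
    D.continuous_g.comp_continuousOn (hy.continuousOn.prodMk hz.continuousOn)
  have hζ : IsWeakSolution S T (fun φ s => ⟪(φ : H), (-l) • (y s - P (z s))⟫_𝕜)
      (fun s => y s - P (z s)) := by
    refine (hy.sub (hu.isWeakSolution_map h.norm_lt h.inner_map hgc hz)).congr_forcing
      fun φ s => ?_
    -- Since `P R = 1`, the forcing is `f(y) - P R (f(y) + l ζ) = -l ζ` with `ζ = y - P z`.
    rw [add_sub_add_right_eq_sub, ← inner_sub_right, h.g_eq, h.map_inverse]
    congr 1
    module
  refine C0Group.isMildSolution_prodFlow ((coordOfState P k).continuous.comp_continuousOn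
    (hy.continuousOn.prodMk hz.continuousOn)) (fun t ht => ?_) fun t ht => ?_
  · have h1 := C0Group.hasDerivWithinAt_scale
      (IsWeakSolution.hasDerivWithinAt (h := fun s => (-l) • (y s - P (z s)))
        (hζ.continuousOn.const_smul (-l)) hζ ht) (-l)
    rw [sub_self, _root_.map_zero] at h1
    have h2 : HasDerivWithinAt (fun s => k • (S.scale (-l)).toFun (-s) (y s - P (z s))) (k • 0)
      (Icc 0 T) t := h1.const_smul k
    simp only [coordForcing, coordOfState_apply, _root_.map_zero]
    simpa only [smul_zero, ← ofReal_smul_eq (𝕜 := 𝕜) k, map_smul] using h2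
  · have h1 := hz.hasDerivWithinAt hgc ht
    have e : D.g (y t, z t) = (coordForcing f P R l k (coordOfState P k (y t, z t))).2 := by
      rw [h.g_eq, coordForcing, stateOfCoord_coordOfState hk, coordOfState_apply, smul_smul,
        mul_assoc, inv_mul_cancel₀ hk, mul_one]
    rw [← e]
    exact h1

/-- Conversely, `y = ζ + P z` is a superposition: `ζ` carries the forcing `-l ζ`, and `P z` carries
the control and `P g = f(y) + l ζ`. -/
theorem DynamicFeedback.IsDecoupling.isClosedLoopSolution [CompleteSpace U]
    (h : D.IsDecoupling B f P R l) {T : ℝ} {w : ℝ → H × H}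
    (hw : IsMildSolution ((S.scale (-l)).prodFlow D.group) (coordForcing f P R l k) T w) :
    IsClosedLoopSolution S B f D T (fun t => stateOfCoord P k (w t)) (fun t => (w t).2) := by
  obtain ⟨Ψ, hΨ⟩ := h.exists_output
  have hyc : ContinuousOn (fun t => stateOfCoord P k (w t)) (Icc 0 T) :=
    (stateOfCoord P k).continuous.comp_continuousOn hw.continuousOn
  have hzc : ContinuousOn (fun t => (w t).2) (Icc 0 T) :=
    continuous_snd.comp_continuousOn hw.continuousOn
  have hac : ContinuousOn (fun t => k⁻¹ • (w t).1) (Icc 0 T) :=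
    (continuous_fst.comp_continuousOn hw.continuousOn).const_smul _
  have hgc : ContinuousOn (fun s => D.g (stateOfCoord P k (w s), (w s).2)) (Icc 0 T) :=
    D.continuous_g.comp_continuousOn (hyc.prodMk hzc)
  have hz : IsWeakSolution D.group T
      (fun φ s => ⟪(φ : H), D.g (stateOfCoord P k (w s), (w s).2)⟫_𝕜) (fun t => (w t).2) := by
    refine isWeakSolution_of_hasDerivWithinAt hzc hgc fun t ht => ?_
    have e : D.g (stateOfCoord P k (w t), (w t).2) = (coordForcing f P R l k (w t)).2 := by
      rw [h.g_eq, coordForcing, stateOfCoord_apply, add_sub_cancel_right, smul_smul]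
    rw [e]
    exact (hasFDerivAt_snd (𝕜 := ℝ)).comp_hasDerivWithinAt t (hw.hasDerivWithinAt t ht)
  have ha : IsWeakSolution S T (fun φ s => ⟪(φ : H), (-l) • (k⁻¹ • (w s).1)⟫_𝕜)
      (fun t => k⁻¹ • (w t).1) := by
    refine isWeakSolution_of_hasDerivWithinAt hac (hac.const_smul _) fun t ht => ?_
    have h1 : HasDerivWithinAt (fun s => (S.scale (-l)).toFun (-s) (w s).1)
        ((S.scale (-l)).toFun (-t) (coordForcing f P R l k (w t)).1) (Icc 0 T) t :=
      (ContinuousLinearMap.fst ℝ H H).hasFDerivAt.comp_hasDerivWithinAt t (hw.hasDerivWithinAt t ht)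
    have h2 : HasDerivWithinAt (fun s => k⁻¹ • S.toFun (-s) (w s).1)
      (k⁻¹ • S.toFun (-t) (0 + (-l) • (w t).1)) (Icc 0 T) t :=
      (C0Group.hasDerivWithinAt_of_scale h1).const_smul k⁻¹
    rw [zero_add] at h2
    simpa only [← ofReal_smul_eq (𝕜 := 𝕜) k⁻¹, ← ofReal_smul_eq (𝕜 := 𝕜) (-l), map_smul,
      smul_comm ((k⁻¹ : ℝ) : 𝕜)] using h2
  obtain ⟨u, hu⟩ := hΨ.exists_isOutput h.norm_lt hgc hz
  refine ⟨u, hu, ?_, hz⟩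
  refine (ha.add (hu.isWeakSolution_map h.norm_lt h.inner_map hgc hz)).congr_forcing fun φ s => ?_
  rw [← add_assoc, ← inner_add_right, h.g_eq, h.map_inverse, stateOfCoord_apply,
    add_sub_cancel_right, neg_smul, neg_add_cancel_comm_assoc]
  rfl

omit [CompleteSpace H] in
theorem exists_coordForcing_bound (hf_small : ∀ ε > 0, ∃ δ > 0, ∀ x : H, ‖x‖ < δ → ‖f x‖ ≤ ε * ‖x‖)
    {r : ℝ} (hr : 0 < r) {Λ : NNReal} (hfL : LipschitzOnWith Λ f (Metric.ball 0 r))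
    (P R : H →L[𝕜] H) (hl : 0 ≤ l) {η : ℝ} (hη : 0 < η) :
    ∃ k : ℝ, 0 < k ∧ ∃ δ : ℝ, 0 < δ ∧ (∀ w, ‖w‖ ≤ δ → ‖coordForcing f P R l k w‖ ≤ η * ‖w‖) ∧
      ∃ Λ' : NNReal, LipschitzOnWith Λ' (coordForcing f P R l k) (Metric.closedBall 0 δ) := by
  -- Chosen so that the coupling `R (l k⁻¹ w.1)` has norm at most `η/2 · ‖w‖`; the other half of `η`
  -- is left for `f`.
  set k : ℝ := 1 + 2 * (l * ‖R‖) / η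
  have hk : 0 < k := by positivity
  set J := stateOfCoord P k
  obtain ⟨δ₀, hδ₀, hb⟩ := hf_small (η / (2 * (‖R‖ + 1) * (‖J‖ + 1))) (by positivity)
  -- With this radius `J` maps the closed `δ`-ball strictly inside the balls where `f` is small and
  -- where it is Lipschitz.
  set δ := min δ₀ r / (2 * (‖J‖ + 1))
  have hm : 0 < min δ₀ r := lt_min hδ₀ hr
  have hδ : 0 < δ := by positivity
  have hJ : ∀ w : H × H, ‖w‖ ≤ δ → ‖J w‖ < min δ₀ r := fun w hw => by
    have h1 : ‖J w‖ ≤ (‖J‖ + 1) * δ :=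
      (J.le_opNorm w).trans (by gcongr; linarith)
    have h2 : (‖J‖ + 1) * δ = min δ₀ r / 2 := by
      simp only [δ]; field_simp
    linarith
  refine ⟨k, hk, δ, hδ, fun w hw => ?_, ?_⟩
  · have h1 : ‖f (J w)‖ ≤ η / (2 * (‖R‖ + 1)) * ‖w‖ := by
      refine (hb _ ((hJ w hw).trans_le (min_le_left _ _))).trans ?_
      refine (mul_le_mul_of_nonneg_left ((J.le_opNorm w).trans (mul_le_mul_of_nonneg_right
        (le_add_of_nonneg_right zero_le_one) (norm_nonneg w))) (by positivity)).trans (le_of_eq ?_)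
      field_simp
    have h2 : ‖(l * k⁻¹) • w.1‖ ≤ l * k⁻¹ * ‖w‖ := by
      rw [norm_smul, Real.norm_of_nonneg (by positivity)]
      exact mul_le_mul_of_nonneg_left (norm_fst_le w) (by positivity)
    have h3 : ‖R‖ * (l * k⁻¹) ≤ η / 2 := by
      have : ‖R‖ * l ≤ η / 2 * k := by
        have : η / 2 * k = η / 2 + l * ‖R‖ := by simp only [k]; field_simp
        rw [this]; nlinarith
      rw [← mul_assoc, ← div_eq_mul_inv, div_le_iff₀ hk]
      exact this
    have h4 : ‖R‖ * (η / (2 * (‖R‖ + 1))) ≤ η / 2 := by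
      rw [mul_div_assoc', div_le_div_iff₀ (by positivity) two_pos]
      nlinarith [norm_nonneg R]
    have h5 : ‖R (f (J w) + (l * k⁻¹) • w.1)‖ ≤ η * ‖w‖ := by
      refine (R.le_opNorm _).trans ((mul_le_mul_of_nonneg_left ((norm_add_le _ _).trans
        (add_le_add h1 h2)) (norm_nonneg R)).trans ?_)
      rw [mul_add, ← mul_assoc, ← mul_assoc, ← add_mul]
      exact mul_le_mul_of_nonneg_right (by linarith) (norm_nonneg w)
    exact max_le ((norm_zero (E := H)).trans_le (by positivity)) h5
  · have h1 : LipschitzOnWith (Λ * ‖J‖₊) (fun w => f (J w)) (Metric.closedBall 0 δ) :=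
      hfL.comp J.lipschitz.lipschitzOnWith fun w hw => mem_ball_zero_iff.2
        ((hJ w (mem_closedBall_zero_iff.1 hw)).trans_le (min_le_right _ _))
    have h2 := ((l * k⁻¹) • ContinuousLinearMap.fst ℝ H H).lipschitz.lipschitzOnWith
      (s := Metric.closedBall 0 δ)
    exact ⟨_, (LipschitzWith.const (0 : H)).lipschitzOnWith.prodMk (R.lipschitz.comp_lipschitzOnWith
      (h1.add h2))⟩

theorem DynamicFeedback.IsDecoupling.isLocallyExpStable [CompleteSpace U]
    (h : D.IsDecoupling B f P R l) (hf : Continuous f)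
    (hf_small : ∀ ε > 0, ∃ δ > 0, ∀ x : H, ‖x‖ < δ → ‖f x‖ ≤ ε * ‖x‖)
    {r : ℝ} (hr : 0 < r) {Λ : NNReal} (hfL : LipschitzOnWith Λ f (Metric.ball 0 r))
    (hl : 0 ≤ l) {M μ : ℝ} (hM : 1 ≤ M) (hμ : 0 ≤ μ)
    (hS : ∀ t, 0 ≤ t → ‖(S.scale (-l)).toFun t‖ ≤ M * Real.exp (-(1 + μ) * t))
    (hG : ∀ t, 0 ≤ t → ‖D.group.toFun t‖ ≤ M * Real.exp (-(1 + μ) * t)) :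
    IsLocallyExpStable S B f D μ := by
  have hM0 : 0 < M := zero_lt_one.trans_le hM
  -- With smallness constant `η = 1/M` the loss `M η = 1` uses up exactly the surplus in the linear
  -- rate `1 + μ`.
  obtain ⟨k, hk, δ, hδ, hb, Λ', hΛ'⟩ :=
    exists_coordForcing_bound hf_small hr hfL P R hl (inv_pos.2 hM0)
  have hF : Continuous (coordForcing f P R l k) :=
    continuous_const.prodMk (R.continuous.comp
      ((hf.comp (stateOfCoord P k).continuous).add (continuous_fst.const_smul _)))
  obtain ⟨hex, hdep⟩ := ((S.scale (-l)).prodFlow D.group).exists_locally_exp_stable hM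
    (inv_nonneg.2 hM0.le) hδ hμ (fun t ht => C0Group.norm_prodFlow_le (hS t ht) (hG t ht))
    (by rw [mul_inv_cancel₀ hM0.ne']) hF hb hΛ'
  set V := coordOfState P k
  set J := stateOfCoord P k
  have hV : ∀ y z : H, ‖V (y, z)‖ ≤ (‖V‖ + 1) * (‖y‖ + ‖z‖) := fun y z =>
    (V.le_opNorm _).trans (mul_le_mul (le_add_of_nonneg_right zero_le_one)
      (max_le_add_of_nonneg (norm_nonneg y) (norm_nonneg z)) (norm_nonneg _) (by positivity))
  have hJ : ∀ w : H × H, ‖J w‖ + ‖w.2‖ ≤ (‖J‖ + 1) * ‖w‖ := fun w => by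
    rw [add_mul, one_mul]
    exact add_le_add (J.le_opNorm w) (norm_snd_le w)
  have hsmall : ∀ y z : H, ‖y‖ + ‖z‖ ≤ δ / (2 * M * (‖V‖ + 1)) → M * ‖V (y, z)‖ < δ := by
    intro y z hyz
    have h1 : M * ‖V (y, z)‖ ≤ M * ((‖V‖ + 1) * (δ / (2 * M * (‖V‖ + 1)))) :=
      mul_le_mul_of_nonneg_left ((hV y z).trans (by gcongr)) hM0.le
    have h2 : M * ((‖V‖ + 1) * (δ / (2 * M * (‖V‖ + 1)))) = δ / 2 := by field_simp
    linarith
  refine ⟨δ / (2 * M * (‖V‖ + 1)), by positivity, (‖J‖ + 1) * M * (‖V‖ + 1), by positivity,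
    fun y₀ z₀ h0 => ?_, fun T hT => ?_⟩
  · obtain ⟨w, hw0, hw, hdecay⟩ := hex _ (hsmall y₀ z₀ h0)
    refine ⟨fun t => J (w t), fun t => (w t).2, ?_, ?_,
      fun T _ => h.isClosedLoopSolution (hw T), fun t ht => ?_⟩
    · simp only [hw0]
      exact stateOfCoord_coordOfState hk.ne' (y₀, z₀)
    · simp only [hw0]
      rfl
    · refine (hJ _).trans ((mul_le_mul_of_nonneg_left ((hdecay t ht).trans
        (mul_le_mul_of_nonneg_left (hV y₀ z₀) (by positivity))) (by positivity)).trans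
        (le_of_eq ?_))
      ring
  · obtain ⟨L, hL, hLip⟩ := hdep T
    refine ⟨(‖J‖ + 1) * L * (‖V‖ + 1), fun y y' z z' hs hs' h0 h0' t ht => ?_⟩
    have h1 := hLip _ _ (h.isMildSolution hk.ne' hs) (h.isMildSolution hk.ne' hs')
      (hsmall _ _ h0) (hsmall _ _ h0') t ht
    rw [← map_sub, ← map_sub, Prod.mk_sub_mk, Prod.mk_sub_mk] at h1
    have h2 := hJ (V (y t - y' t, z t - z' t))
    rw [stateOfCoord_coordOfState hk.ne'] at h2
    refine h2.trans ((mul_le_mul_of_nonneg_left (h1.trans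
      (mul_le_mul_of_nonneg_left (hV _ _) hL)) (by positivity)).trans (le_of_eq ?_))
    ring

theorem exists_isDecoupling [CompleteSpace U] (hB : IsAdmissibleControl S B)
    {T : ℝ} (hT : 0 < T) (hctrl : IsExactlyControllableIn S B T) (hf : Continuous f)
    {r : ℝ} (hr : 0 < r) {Λ : NNReal} (hfL : LipschitzOnWith Λ f (Metric.ball 0 r)) {c : ℝ}
    (hc : 0 ≤ c) (hc1 : Real.exp (-(2 * c)) * ‖S.toFun (-1)‖ ^ 2 ≤ 1 / 2)
    (hc2 : Real.exp (-(2 * c)) * ‖S.toFun (-1)‖ < 1) (l : ℝ) :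
    ∃ (D : DynamicFeedback 𝕜 H U H) (P R : H →L[𝕜] H), D.IsDecoupling B f P R l ∧
      D.group = S.dual.scale (-(2 * c)) := by
  obtain ⟨Q, hQ⟩ := hB.exists_outputMap hc1
  -- Two weights occur: `Q` has weight `e^{-cs}`, squared in `P = Q^* Q`, whereas the output of
  -- `e^{-2ct} S(-t)^*` itself has weight `e^{-2cs}`.
  obtain ⟨Q', hQ'⟩ := hB.exists_outputMap (c := 2 * c)
    ((mul_le_mul_of_nonneg_right (Real.exp_le_exp.2 (by linarith)) (sq_nonneg _)).trans hc1)
  obtain ⟨R, hR⟩ := IsOutputMap.exists_inverse hQ hT hctrl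
  set P := ContinuousLinearMap.adjoint Q ∘L Q
  let J : H × H →L[ℝ] H := l • (ContinuousLinearMap.fst ℝ H H - P.restrictScalars ℝ ∘L
    ContinuousLinearMap.snd ℝ H H)
  let D : DynamicFeedback 𝕜 H U H :=
    { group := S.dual.scale (-(2 * c))
      K := B.dualFeedback (-(2 * c))
      admissible := hB.dualFeedback (by positivity)
      g := fun p => R (f p.1 + J p)
      continuous_g := R.continuous.comp ((hf.comp continuous_fst).add J.continuous)
      lipschitz_g := ⟨r, hr, _, R.lipschitz.comp_lipschitzOnWith
        (LipschitzOnWith.add (hfL.comp LipschitzWith.prod_fst.lipschitzOnWith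
          fun p hp => mem_ball_zero_iff.2 ((norm_fst_le p).trans_lt (mem_ball_zero_iff.1 hp)))
          J.lipschitz.lipschitzOnWith)⟩ }
  refine ⟨D, P, R, ⟨?_, IsOutputMap.inner_dualFeedback hQ, ⟨_, IsOutputMap.isExtendedOutput hQ'⟩, hR,
    fun _ => rfl⟩, rfl⟩
  refine (S.dual.norm_scale_le _ _).trans_lt ?_
  rw [mul_one]
  exact (congrArg (Real.exp (-(2 * c)) * ·) (S.norm_star (-1))).trans_lt hc2

theorem isLocallyRapidlyDynamicallyStabilizable_of_exactlyControllable [CompleteSpace U]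
    (hB : IsAdmissibleControl S B) {T : ℝ} (hT : 0 < T) (hctrl : IsExactlyControllableIn S B T)
    (hf : Continuous f) (hf_small : ∀ ε > 0, ∃ δ > 0, ∀ x : H, ‖x‖ < δ → ‖f x‖ ≤ ε * ‖x‖)
    {r : ℝ} (hr : 0 < r) {Λ : NNReal} (hfL : LipschitzOnWith Λ f (Metric.ball 0 r)) :
    IsLocallyRapidlyDynamicallyStabilizable S B f := by
  intro μ hμ
  obtain ⟨M, hM, a, ha, hS⟩ := S.exists_growth_bound
  set N := M * Real.exp a
  have hN : 1 ≤ N := one_le_mul_of_one_le_of_one_le hM (Real.one_le_exp ha)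
  have hS1 : ‖S.toFun (-1)‖ ≤ N := by simpa using hS (-1)
  -- The term `N ^ 2` gives `e^{-2c} N² ≤ 1/2` through `e^{2c} ≥ 1 + 2c`; the others make `2c` at
  -- least `a + 1 + μ`, the damping needed for rate `1 + μ`. The damping of `y - P z` is this same
  -- `a + 1 + μ`.
  set c := a + 1 + μ + N ^ 2
  have hc : 0 ≤ c := by positivity
  have h1 : Real.exp (-(2 * c)) * N ^ 2 ≤ 1 / 2 := by
    rw [Real.exp_neg, inv_mul_le_iff₀ (Real.exp_pos _)]
    have := Real.add_one_le_exp (2 * c)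
    simp only [c] at this ⊢
    linarith
  have h2 : Real.exp (-(2 * c)) * ‖S.toFun (-1)‖ ^ 2 ≤ 1 / 2 := by
    refine le_trans ?_ h1
    gcongr
  have h3 : Real.exp (-(2 * c)) * ‖S.toFun (-1)‖ < 1 := by
    refine lt_of_le_of_lt ?_ (h1.trans_lt one_half_lt_one)
    gcongr
    exact hS1.trans (le_self_pow₀ hN two_ne_zero)
  have key : ∀ b t : ℝ, a + 1 + μ ≤ b → 0 ≤ t →
      Real.exp (-b * t) * (M * Real.exp (a * t)) ≤ M * Real.exp (-(1 + μ) * t) := by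
    intro b t hb ht
    rw [mul_left_comm, ← Real.exp_add]
    gcongr
    nlinarith
  obtain ⟨D, P, R, hD, hG⟩ :=
    exists_isDecoupling hB hT hctrl hf hr hfL hc h2 h3 (a + 1 + μ)
  refine ⟨H, inferInstance, inferInstance, inferInstance, D,
    hD.isLocallyExpStable hf hf_small hr hfL (by positivity) hM hμ.le (fun t ht => ?_)
    fun t ht => ?_⟩
  · have h4 := hS t
    rw [abs_of_nonneg ht] at h4
    exact (S.norm_scale_le _ t).trans ((mul_le_mul_of_nonneg_left h4 (Real.exp_pos _).le).trans
      (key _ t le_rfl ht))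
  · have h4 := hS (-t)
    rw [abs_neg, abs_of_nonneg ht, ← S.norm_star] at h4
    rw [hG]
    refine (S.dual.norm_scale_le _ t).trans ((mul_le_mul_of_nonneg_left h4
      (Real.exp_pos _).le).trans (key _ t ?_ ht))
    simp only [c]
    nlinarith

end Linearization

end StabControl

end

theorem mainTheorem10 {𝕜 : Type w} {H : Type u} {U : Type v} [RCLike 𝕜]
    [NormedAddCommGroup H] [InnerProductSpace 𝕜 H] [CompleteSpace H]
    [NormedAddCommGroup U] [InnerProductSpace 𝕜 U] [CompleteSpace U]
    (S : StabControl.C0Group 𝕜 H) (B : StabControl.ControlOperator S U)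
    (hB : StabControl.IsAdmissibleControl S B)
    (hctrl : ∃ T : ℝ, 0 < T ∧ StabControl.IsExactlyControllableIn S B T)
    (f : H → H) (hf : Continuous f)
    (hf_small : ∀ ε > 0, ∃ δ > 0, ∀ x : H, ‖x‖ < δ → ‖f x‖ ≤ ε * ‖x‖)
    (hf_lip : ∃ r > 0, ∃ Λ > 0, ∀ x y : H, ‖x‖ < r → ‖y‖ < r → ‖f x - f y‖ ≤ Λ * ‖x - y‖) :
    StabControl.IsLocallyRapidlyDynamicallyStabilizable S B f := by
  let : NormedSpace ℝ H := NormedSpace.restrictScalars ℝ 𝕜 H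
  have : IsScalarTower ℝ 𝕜 H := RestrictScalars.isScalarTower ℝ 𝕜 H
  obtain ⟨T, hT, hctrl⟩ := hctrl
  obtain ⟨r, hr, Λ, hΛ, hfL⟩ := hf_lip
  refine StabControl.isLocallyRapidlyDynamicallyStabilizable_of_exactlyControllable hB hT hctrl hf
    hf_small hr (Λ := ⟨Λ, hΛ.le⟩) (LipschitzOnWith.of_dist_le_mul fun x hx y hy => ?_)
  rw [dist_eq_norm, dist_eq_norm]
  exact hfL x y (mem_ball_zero_iff.1 hx) (mem_ball_zero_iff.1 hy)
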